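/- Notation. Put $\epsilon_1=\epsilon_2=1$, $\epsilon_3=-1$; $(i,j,k)$ denotes any cyclic permutation of $(1,2,3)$, and $s,t\in\{1,2,3\}$. Let $n\ge 1$ and let $M$ be a smooth manifold of dimension $4n+3$ with a paraquaternionic contact (pqc) structure $(g,\mathbb{PQ})$. That is, $M$ carries a codimension three distribution $H\subset TM$, a metric $g$ of signature $(2n,2n)$ on $H$ and a bundle $\mathbb{PQ}\subset \mathrm{End}(H)$ such that, locally, there are a 1-form $\eta=(\eta_1,\eta_2,\eta_3)$ with $H=\bigcap_s\ker\eta_s$ and endomorphisms $I_1,I_2,I_3$ of $H$ spanning $\mathbb{PQ}$ with $$I_s^2=\epsilon_s\,\mathrm{id}_H,\quad I_1I_2=-I_2I_1=I_3,\quad g(I_sX,I_sY)=-\epsilon_s g(X,Y),\quad d\eta_s(X,Y)=-2\epsilon_s g(I_sX,Y)\qquad (X,Y\in H).$$ The Reeb vector fields of $(\eta,I_s)$ are the $\xi_1,\xi_2,\xi_3$ with $\eta_s(\xi_t)=\delta_{st}$ and $(\xi_s\lrcorner d\eta_s)|_H=0$; if $n=1$, their existence together with the condition $(\xi_j\lrcorner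 d\eta_i)|_H=\epsilon_k(\xi_i\lrcorner d\eta_j)|_H$ is part of the definition of a pqc structure. Let $V$ be the vertical distribution, spanned by the Reeb vector fields, so $TM=H\oplus V$. Let $\nabla$ be the canonical pqc connection, with torsion $T$. It is characterized by the following conditions: $\nabla$ preserves $H$, $V$, $g$ and $\mathbb{PQ}$; $T(X,Y)=-[X,Y]_V$ for $X,Y\in H$; for $\xi\in V$ the torsion endomorphism $T(\xi,\cdot)|_H$ is an endomorphism of $H$ that is orthogonal to $sp(n,\mathbb R)\oplus sp(1,\mathbb R)$ (the sum of the $g$-skew endomorphisms commuting with $\mathbb{PQ}$, and of $\mathbb{PQ}$) with respect to $\langle A,B\rangle=\sum_a g(e_a,e_a)g(Ae_a,Be_a)$, $(e_a)$ an orthonormal basis of $H$; and $\nabla\varphi=0$ for the identification $\varphi:V\to\mathbb{PQ}$, $\xi_s\mapsto I_s$. Let $T^0(\xi,X,Y)$ and $T^a(\xi,X,Y)$ be the symmetric and skew-symmetric parts in $X,Y$ of $g(T(\xi,X),Y)$, $X,Y\in H$, $\xi\in V$, and put $$\tau(X,Y)=-\sum_s\epsilon_sT^0(\xi_s,I_sX,Y),\qquad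 \mu(X,Y)=\epsilon_sT^a(\xi_s,I_sX,Y)$$ (the latter is the same tensor for $s=1,2,3$). Let $R(A,B)=[\nabla_A,\nabla_B]-\nabla_{[A,B]}$ and, for $X,Y\in H$, $$Ric(X,Y)=\sum_a g(e_a,e_a)\,g(R(e_a,X)Y,e_a),\qquad Scal=\sum_a g(e_a,e_a)\,Ric(e_a,e_a).$$ The structure is called pqc-Einstein if $Ric(X,Y)=\frac{Scal}{4n}g(X,Y)$ for all $X,Y\in H$. Finally let $\omega_s=g(I_s\cdot,\cdot)$ on $H$, extended to $TM$ by $V\lrcorner\,\omega_s=0$, and let $\Omega=-\omega_1\wedge\omega_1-\omega_2\wedge\omega_2+\omega_3\wedge\omega_3$ be the fundamental 4-form, which is globally defined. Theorem. (a) $(M,g,\mathbb{PQ})$ is pqc-Einstein if and only if $\tau=\mu=0$; and $\tau=\mu=0$ if and only if the torsion endomorphism vanishes identically, $T(\xi,X)=0$ for all $\xi\in V$, $X\in H$. (b) If $\dim M>7$ and $(M,g,\mathbb{PQ})$ is pqc-Einstein, then $d(Scal)=0$, i.e. the pqc scalar curvature is (locally) constant, and the vertical distribution is integrable: brackets of vertical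 vector fields are vertical; in particular $[\xi_s,\xi_t]\in V$. (c) If $n>1$, then $(M,g,\mathbb{PQ})$ is pqc-Einstein if and only if $d\Omega=0$. -/

import Mathlib

open scoped Manifold ContDiff Bundle

noncomputable section

namespace PQC

/-- The model space `ℝ^{4n+3}`. -/
abbrev Model (n : ℕ) : Type := EuclideanSpace ℝ (Fin (4 * n + 3))

/-- The signs `ε₁ = ε₂ = 1`, `ε₃ = -1` (the indices `1, 2, 3` are `0, 1, 2 : Fin 3`; the cyclic
permutations `(i, j, k)` of `(1, 2, 3)` are the triples `(i, i + 1, i + 2)` in `Fin 3`). -/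
def eps : Fin 3 → ℝ := ![1, 1, -1]

section Calculus

variable {n : ℕ} {M : Type*} [TopologicalSpace M] [ChartedSpace (Model n) M]

/-- A vector field that is smooth on the set `W`. -/
def SmoothFieldOn [IsManifold 𝓘(ℝ, Model n) ∞ M] (W : Set M)
    (A : ∀ x : M, TangentSpace 𝓘(ℝ, Model n) x) : Prop :=
  ContMDiffOn 𝓘(ℝ, Model n) 𝓘(ℝ, Model n).tangent ∞ (T% A) W

/-- A real function that is smooth on the set `W`. -/
def SmoothFunOn (W : Set M) (f : M → ℝ) : Prop :=
  ContMDiffOn 𝓘(ℝ, Model n) 𝓘(ℝ, ℝ) ∞ f W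

/-- The exterior derivative of a `1`-form, evaluated on vector fields:
`dα(A, B) = A (α(B)) - B (α(A)) - α([A, B])`. -/
def dOneForm (α : ∀ x : M, TangentSpace 𝓘(ℝ, Model n) x →L[ℝ] ℝ)
    (A B : ∀ x : M, TangentSpace 𝓘(ℝ, Model n) x) (x : M) : ℝ :=
  mvfderiv 𝓘(ℝ, Model n) (fun y => α y (B y)) x (A x)
    - mvfderiv 𝓘(ℝ, Model n) (fun y => α y (A y)) x (B x)
    - α x (VectorField.mlieBracket 𝓘(ℝ, Model n) A B x)

/-- The exterior derivative of a `(k+1)`-form, evaluated on vector fields `A₀, …, A_{k+1}`: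
`∑ᵢ (-1)ⁱ Aᵢ (Θ(…, Âᵢ, …)) + ∑_{i < j} (-1)^{i+j} Θ([Aᵢ, Aⱼ], …, Âᵢ, …, Âⱼ, …)`; in the second
sum below the pair `(i, j)` stands for `(i, j + 1)`, whence the sign in front of it. -/
def dForm {k : ℕ} (Θ : ∀ x : M, (Fin (k + 1) → TangentSpace 𝓘(ℝ, Model n) x) → ℝ)
    (A : Fin (k + 2) → ∀ x : M, TangentSpace 𝓘(ℝ, Model n) x) (x : M) : ℝ :=
  (∑ i : Fin (k + 2), (-1 : ℝ) ^ (i : ℕ) *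
      mvfderiv 𝓘(ℝ, Model n) (fun y => Θ y (i.removeNth (fun m => A m y))) x (A i x))
    - ∑ i : Fin (k + 1), ∑ j ∈ Finset.Ici i, (-1 : ℝ) ^ ((i : ℕ) + (j : ℕ)) *
        Θ x (Matrix.vecCons
          (VectorField.mlieBracket 𝓘(ℝ, Model n) (A i.castSucc) (A j.succ) x)
          (j.removeNth (i.castSucc.removeNth (fun m => A m x))))

variable [IsManifold 𝓘(ℝ, Model n) ∞ M]

/-- The curvature `R(A, B)C = ∇_A ∇_B C - ∇_B ∇_A C - ∇_{[A, B]} C` on vector fields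
(`cov C x (A x)` is `(∇_A C)(x)`). -/
def curvatureField
    (cov : CovariantDerivative 𝓘(ℝ, Model n) (Model n)
      (TangentSpace 𝓘(ℝ, Model n) : M → Type _))
    (A B C : ∀ x : M, TangentSpace 𝓘(ℝ, Model n) x) (x : M) : TangentSpace 𝓘(ℝ, Model n) x :=
  cov (fun y => cov C y (B y)) x (A x) - cov (fun y => cov C y (A y)) x (B x)
    - cov C x (VectorField.mlieBracket 𝓘(ℝ, Model n) A B x)

/-- The curvature tensor at a point, computed with the extensions of tangent vectors to vector
fields that are smooth near the point. -/
def curvature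
    (cov : CovariantDerivative 𝓘(ℝ, Model n) (Model n)
      (TangentSpace 𝓘(ℝ, Model n) : M → Type _))
    (x : M) (u v w : TangentSpace 𝓘(ℝ, Model n) x) : TangentSpace 𝓘(ℝ, Model n) x :=
  curvatureField cov (FiberBundle.extend (Model n) u) (FiberBundle.extend (Model n) v)
    (FiberBundle.extend (Model n) w) x

end Calculus

/-! ### Paraquaternionic contact structures -/

section Gauge

variable {n : ℕ} {M : Type*} [TopologicalSpace M] [ChartedSpace (Model n) M]
  [IsManifold 𝓘(ℝ, Model n) ∞ M]

/-- A section of the distribution `H` that is smooth on `W`. -/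
def SmoothSectionOn (H : ∀ x : M, Submodule ℝ (TangentSpace 𝓘(ℝ, Model n) x)) (W : Set M)
    (X : ∀ x : M, H x) : Prop :=
  SmoothFieldOn W (fun x => (X x : TangentSpace 𝓘(ℝ, Model n) x))

/-- An endomorphism field of the distribution `H` that is smooth on `W`: it maps sections of `H`
that are smooth on an open part of `W` to such sections. -/
def SmoothEndOn (H : ∀ x : M, Submodule ℝ (TangentSpace 𝓘(ℝ, Model n) x)) (W : Set M)
    (σ : ∀ x : M, Module.End ℝ (H x)) : Prop :=
  ∀ W' : Set M, IsOpen W' → W' ⊆ W → ∀ X : ∀ x : M, H x, SmoothSectionOn H W' X →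
    SmoothSectionOn H W' (fun x => σ x (X x))

/-- Local data of a paraquaternionic contact structure on the open set `U`: an `ℝ³`-valued
`1`-form `η` with kernel `H`, and endomorphisms `J₁, J₂, J₃` of `H` that generate the bundle `PQ`,
satisfy the identities of the imaginary unit paraquaternions, are compatible with the horizontal
metric `g`, and satisfy the contact condition `-2 ε_s g(J_s X, Y) = dη_s(X, Y)` on `H`. -/
structure IsGauge (H : ∀ x : M, Submodule ℝ (TangentSpace 𝓘(ℝ, Model n) x))
    (g : ∀ x : M, LinearMap.BilinForm ℝ (H x))
    (PQ : ∀ x : M, Submodule ℝ (Module.End ℝ (H x)))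
    (U : Set M)
    (η : Fin 3 → ∀ x : M, TangentSpace 𝓘(ℝ, Model n) x →L[ℝ] ℝ)
    (J : Fin 3 → ∀ x : M, Module.End ℝ (H x)) : Prop where
  isOpen : IsOpen U
  smooth_form : ∀ s : Fin 3, ∀ W : Set M, IsOpen W → W ⊆ U →
    ∀ A : ∀ x : M, TangentSpace 𝓘(ℝ, Model n) x, SmoothFieldOn W A →
      SmoothFunOn (n := n) W (fun x => η s x (A x))
  mem_iff : ∀ x ∈ U, ∀ v : TangentSpace 𝓘(ℝ, Model n) x, v ∈ H x ↔ ∀ s : Fin 3, η s x v = 0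
  smooth_end : ∀ s : Fin 3, SmoothEndOn H U (J s)
  span_eq : ∀ x ∈ U, PQ x = Submodule.span ℝ (Set.range fun s => J s x)
  sq_eq : ∀ x ∈ U, ∀ s : Fin 3, J s x * J s x = eps s • (1 : Module.End ℝ (H x))
  mul_eq : ∀ x ∈ U, J 0 x * J 1 x = J 2 x
  mul_eq_neg : ∀ x ∈ U, J 1 x * J 0 x = -J 2 x
  compatible : ∀ x ∈ U, ∀ (s : Fin 3) (u v : H x), g x (J s x u) (J s x v) = -eps s * g x u v
  contact : ∀ s : Fin 3, ∀ W : Set M, IsOpen W → W ⊆ U → ∀ X Y : ∀ x : M, H x,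
    SmoothSectionOn H W X → SmoothSectionOn H W Y → ∀ x ∈ W,
      -2 * eps s * g x (J s x (X x)) (Y x) = dOneForm (η s) (fun y => X y) (fun y => Y y) x

/-- Vector fields `ξ₁, ξ₂, ξ₃` on `U` with `η_s(ξ_t) = δ_{st}` and `(ξ_s ⌟ dη_s)|_H = 0`. -/
structure IsReeb (H : ∀ x : M, Submodule ℝ (TangentSpace 𝓘(ℝ, Model n) x))
    (U : Set M)
    (η : Fin 3 → ∀ x : M, TangentSpace 𝓘(ℝ, Model n) x →L[ℝ] ℝ)
    (ξ : Fin 3 → ∀ x : M, TangentSpace 𝓘(ℝ, Model n) x) : Prop where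
  smooth : ∀ s : Fin 3, SmoothFieldOn U (ξ s)
  dual : ∀ x ∈ U, ∀ s t : Fin 3, η s x (ξ t x) = if s = t then 1 else 0
  interior : ∀ s : Fin 3, ∀ W : Set M, IsOpen W → W ⊆ U → ∀ X : ∀ x : M, H x,
    SmoothSectionOn H W X → ∀ x ∈ W, dOneForm (η s) (ξ s) (fun y => X y) x = 0

/-- The additional condition `(ξ_j ⌟ dη_i)|_H = ε_k (ξ_i ⌟ dη_j)|_H` for all cyclic permutations
`(i, j, k)` of `(1, 2, 3)`. -/
def IsReebSymmetric (H : ∀ x : M, Submodule ℝ (TangentSpace 𝓘(ℝ, Model n) x))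
    (U : Set M)
    (η : Fin 3 → ∀ x : M, TangentSpace 𝓘(ℝ, Model n) x →L[ℝ] ℝ)
    (ξ : Fin 3 → ∀ x : M, TangentSpace 𝓘(ℝ, Model n) x) : Prop :=
  ∀ i : Fin 3, ∀ W : Set M, IsOpen W → W ⊆ U → ∀ X : ∀ x : M, H x,
    SmoothSectionOn H W X → ∀ x ∈ W,
      dOneForm (η i) (ξ (i + 1)) (fun y => X y) x
        = eps (i + 2) * dOneForm (η (i + 1)) (ξ i) (fun y => X y) x

end Gauge

/-- A paraquaternionic contact structure on the `(4n+3)`-dimensional manifold `M`, with a fixed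
horizontal metric `g` in its conformal class. In dimension seven (`n = 1`) the existence of Reeb
vector fields is part of the notion. -/
structure Structure (n : ℕ) (M : Type*) [TopologicalSpace M] [ChartedSpace (Model n) M]
    [IsManifold 𝓘(ℝ, Model n) ∞ M] where
  /-- The horizontal distribution. -/
  H : ∀ x : M, Submodule ℝ (TangentSpace 𝓘(ℝ, Model n) x)
  /-- The horizontal metric. -/
  g : ∀ x : M, LinearMap.BilinForm ℝ (H x)
  /-- The bundle of endomorphisms of `H` locally generated by `J₁, J₂, J₃`. -/
  PQ : ∀ x : M, Submodule ℝ (Module.End ℝ (H x))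
  /-- `H` has rank `4n` and `g` has signature `(2n, 2n)`. -/
  exists_orthonormal : ∀ x : M, ∃ b : Module.Basis (Fin (2 * n) ⊕ Fin (2 * n)) ℝ (H x),
    ∀ a c, g x (b a) (b c) = if a = c then Sum.elim (fun _ => (1 : ℝ)) (fun _ => -1) a else 0
  smooth_metric : ∀ W : Set M, IsOpen W → ∀ X Y : ∀ x : M, H x,
    SmoothSectionOn H W X → SmoothSectionOn H W Y →
      SmoothFunOn (n := n) W (fun x => g x (X x) (Y x))
  exists_gauge : ∀ x₀ : M, ∃ (U : Set M)
    (η : Fin 3 → ∀ x : M, TangentSpace 𝓘(ℝ, Model n) x →L[ℝ] ℝ)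
    (J : Fin 3 → ∀ x : M, Module.End ℝ (H x)),
    x₀ ∈ U ∧ IsGauge H g PQ U η J ∧
      (n = 1 → ∃ ξ : Fin 3 → ∀ x : M, TangentSpace 𝓘(ℝ, Model n) x,
        IsReeb H U η ξ ∧ IsReebSymmetric H U η ξ)

namespace Structure

variable {n : ℕ} {M : Type*} [TopologicalSpace M] [ChartedSpace (Model n) M]
  [IsManifold 𝓘(ℝ, Model n) ∞ M] (P : Structure n M)

/-- An orthonormal basis `e_a` of the horizontal space at `x`. -/
def basis (x : M) : Module.Basis (Fin (2 * n) ⊕ Fin (2 * n)) ℝ (P.H x) :=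
  Classical.choose (P.exists_orthonormal x)

/-- The metric trace `∑_a g(e_a, e_a) B(e_a, e_a)` over an orthonormal basis of `H`. -/
def trace (x : M) (B : P.H x → P.H x → ℝ) : ℝ :=
  ∑ a, P.g x (P.basis x a) (P.basis x a) * B (P.basis x a) (P.basis x a)

/-- The inner product `⟨A, B⟩ = ∑_a g(e_a, e_a) g(A e_a, B e_a)` of endomorphisms of `H`. -/
def endInner (x : M) (A B : Module.End ℝ (P.H x)) : ℝ :=
  P.trace x (fun u v => P.g x (A u) (B v))

/-- The Lie algebra `sp(n, ℝ)`: the `g`-skew endomorphisms of `H` that commute with `PQ`. -/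
def sp (x : M) : Submodule ℝ (Module.End ℝ (P.H x)) where
  carrier := {A | (∀ u v, P.g x (A u) v = -P.g x u (A v)) ∧ ∀ B ∈ P.PQ x, A * B = B * A}
  add_mem' := by
    rintro A A' ⟨h1, h2⟩ ⟨h1', h2'⟩
    refine ⟨fun u v => ?_, fun B hB => ?_⟩
    · simp only [LinearMap.add_apply, map_add, h1, h1']; ring
    · rw [add_mul, mul_add, h2 B hB, h2' B hB]
  zero_mem' := by simp
  smul_mem' := by
    rintro c A ⟨h1, h2⟩
    refine ⟨fun u v => ?_, fun B hB => ?_⟩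
    · simp only [LinearMap.smul_apply, map_smul, smul_eq_mul, h1]; ring
    · rw [smul_mul_assoc, mul_smul_comm, h2 B hB]

/-- The identification `φ : V → PQ` determined by `ξ_s ↦ J_s`, that is `φ(v) = ∑_s η_s(v) J_s`. -/
def phi (η : Fin 3 → ∀ x : M, TangentSpace 𝓘(ℝ, Model n) x →L[ℝ] ℝ)
    (J : Fin 3 → ∀ x : M, Module.End ℝ (P.H x)) (x : M)
    (v : TangentSpace 𝓘(ℝ, Model n) x) : Module.End ℝ (P.H x) :=
  ∑ s, η s x v • J s x

end Structure

/-- A local gauge together with its Reeb vector fields, which span `V`. -/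
structure IsReebFrame {n : ℕ} {M : Type*} [TopologicalSpace M] [ChartedSpace (Model n) M]
    [IsManifold 𝓘(ℝ, Model n) ∞ M] (P : Structure n M)
    (V : ∀ x : M, Submodule ℝ (TangentSpace 𝓘(ℝ, Model n) x)) (U : Set M)
    (η : Fin 3 → ∀ x : M, TangentSpace 𝓘(ℝ, Model n) x →L[ℝ] ℝ)
    (J : Fin 3 → ∀ x : M, Module.End ℝ (P.H x))
    (ξ : Fin 3 → ∀ x : M, TangentSpace 𝓘(ℝ, Model n) x) : Prop where
  gauge : IsGauge P.H P.g P.PQ U η J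
  reeb : IsReeb P.H U η ξ
  span_eq : ∀ x ∈ U, V x = Submodule.span ℝ (Set.range fun s => ξ s x)

/-- The horizontal component of a tangent vector with respect to a complement of `H`. -/
def horizontal {n : ℕ} {M : Type*} [TopologicalSpace M] [ChartedSpace (Model n) M]
    {H V : ∀ x : M, Submodule ℝ (TangentSpace 𝓘(ℝ, Model n) x)}
    (h : ∀ x, IsCompl (H x) (V x)) (x : M) : TangentSpace 𝓘(ℝ, Model n) x →ₗ[ℝ] H x :=
  (H x).projectionOnto (V x) (h x)

/-- The canonical connection of a paraquaternionic contact structure with its vertical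
distribution `V`. -/
structure CanonicalConnection {n : ℕ} {M : Type*} [TopologicalSpace M]
    [ChartedSpace (Model n) M] [IsManifold 𝓘(ℝ, Model n) ∞ M] (P : Structure n M) where
  /-- The vertical distribution. -/
  V : ∀ x : M, Submodule ℝ (TangentSpace 𝓘(ℝ, Model n) x)
  /-- The connection; `cov A x v` is `∇_v A`. -/
  cov : CovariantDerivative 𝓘(ℝ, Model n) (Model n) (TangentSpace 𝓘(ℝ, Model n) : M → Type _)
  isCompl : ∀ x, IsCompl (P.H x) (V x)
  /-- `V` is locally spanned by Reeb vector fields. -/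
  exists_reebFrame : ∀ x₀ : M, ∃ (U : Set M)
    (η : Fin 3 → ∀ x : M, TangentSpace 𝓘(ℝ, Model n) x →L[ℝ] ℝ)
    (J : Fin 3 → ∀ x : M, Module.End ℝ (P.H x))
    (ξ : Fin 3 → ∀ x : M, TangentSpace 𝓘(ℝ, Model n) x),
    x₀ ∈ U ∧ IsReebFrame P V U η J ξ
  smooth : cov.ContMDiffCovariantDerivative ∞
  /-- `∇` preserves `H`. -/
  cov_mem_horizontal : ∀ W : Set M, IsOpen W → ∀ X : ∀ x : M, P.H x, SmoothSectionOn P.H W X →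
    ∀ x ∈ W, ∀ v, cov (fun y => X y) x v ∈ P.H x
  /-- `∇` preserves `V`. -/
  cov_mem_vertical : ∀ W : Set M, IsOpen W → ∀ A : ∀ x : M, V x, SmoothSectionOn V W A →
    ∀ x ∈ W, ∀ v, cov (fun y => A y) x v ∈ V x
  /-- `∇ g = 0`. -/
  cov_metric : ∀ W : Set M, IsOpen W → ∀ X Y : ∀ x : M, P.H x,
    SmoothSectionOn P.H W X → SmoothSectionOn P.H W Y → ∀ x ∈ W, ∀ v,
      mvfderiv 𝓘(ℝ, Model n) (fun y => P.g y (X y) (Y y)) x v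
        = P.g x (horizontal isCompl x (cov (fun y => X y) x v)) (Y x)
          + P.g x (X x) (horizontal isCompl x (cov (fun y => Y y) x v))
  /-- `∇ σ` is a section of `PQ` for every section `σ` of `PQ`, where
  `(∇_v σ) X = ∇_v (σ X) - σ (∇_v X)`. -/
  cov_PQ : ∀ W : Set M, IsOpen W → ∀ σ : ∀ x : M, Module.End ℝ (P.H x), SmoothEndOn P.H W σ →
    (∀ x ∈ W, σ x ∈ P.PQ x) → ∀ x ∈ W, ∀ v, ∃ τ ∈ P.PQ x,
      ∀ X : ∀ x : M, P.H x, SmoothSectionOn P.H W X →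
        horizontal isCompl x (cov (fun y => σ y (X y)) x v)
          - σ x (horizontal isCompl x (cov (fun y => X y) x v)) = τ (X x)
  /-- `T(X, Y) = -[X, Y]_V` for horizontal `X, Y`. -/
  torsion_horizontal : ∀ W : Set M, IsOpen W → ∀ X Y : ∀ x : M, P.H x,
    SmoothSectionOn P.H W X → SmoothSectionOn P.H W Y → ∀ x ∈ W,
      cov.torsion x (X x) (Y x)
        = -((V x).projectionOnto (P.H x) (isCompl x).symm (VectorField.mlieBracket
            𝓘(ℝ, Model n) (fun y => (X y : TangentSpace 𝓘(ℝ, Model n) y)) (fun y => Y y) x) :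
              TangentSpace 𝓘(ℝ, Model n) x)
  /-- For vertical `ξ` the torsion `T(ξ, ·)` restricts to an endomorphism of `H`. -/
  torsion_mem : ∀ x, ∀ ξ ∈ V x, ∀ u : P.H x, cov.torsion x ξ u ∈ P.H x
  /-- This endomorphism is orthogonal to `sp(n, ℝ) ⊕ sp(1, ℝ)`; the subalgebra `sp(1, ℝ)` is `PQ`. -/
  torsion_orthogonal : ∀ x, ∀ ξ ∈ V x, ∀ B ∈ P.sp x ⊔ P.PQ x,
    P.endInner x (horizontal isCompl x ∘ₗ (cov.torsion x ξ).toLinearMap ∘ₗ (P.H x).subtype) B = 0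
  /-- `∇ φ = 0` for the identification `φ` of `V` with `PQ`. -/
  cov_phi : ∀ U η J, IsGauge P.H P.g P.PQ U η J → ∀ W : Set M, IsOpen W → W ⊆ U →
    ∀ (A : ∀ x : M, V x) (X : ∀ x : M, P.H x), SmoothSectionOn V W A → SmoothSectionOn P.H W X →
      ∀ x ∈ W, ∀ v,
        horizontal isCompl x (cov (fun y => P.phi η J y (A y) (X y)) x v)
          - P.phi η J x (A x) (horizontal isCompl x (cov (fun y => X y) x v))
          = P.phi η J x (cov (fun y => A y) x v) (X x)

namespace CanonicalConnection

variable {n : ℕ} {M : Type*} [TopologicalSpace M] [ChartedSpace (Model n) M]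
  [IsManifold 𝓘(ℝ, Model n) ∞ M] {P : Structure n M} (C : CanonicalConnection P)

/-- The horizontal pqc-Ricci tensor `Ric(u, v) = R(e_a, u, v, e_a)`, where
`R(A, B, C, D) = g(R(A, B)C, D)`. -/
def ric (x : M) (u v : P.H x) : ℝ :=
  P.trace x (fun e e' => P.g x (horizontal C.isCompl x (curvature C.cov x e u v)) e')

/-- The pqc-scalar curvature `Scal = Ric(e_a, e_a)`. -/
def scal (x : M) : ℝ := P.trace x (C.ric x)

/-- The pqc-Einstein condition: the horizontal Ricci tensor is trace-free. -/
def IsEinstein : Prop :=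
  ∀ (x : M) (u v : P.H x), C.ric x u v = C.scal x / (4 * n) * P.g x u v

/-- `T(ξ, u, v) = g(T(ξ, u), v)` for vertical `ξ` and horizontal `u, v`. -/
def tor (x : M) (ξ : TangentSpace 𝓘(ℝ, Model n) x) (u v : P.H x) : ℝ :=
  P.g x (horizontal C.isCompl x (C.cov.torsion x ξ u)) v

/-- The symmetric part of the torsion endomorphism. -/
def torSym (x : M) (ξ : TangentSpace 𝓘(ℝ, Model n) x) (u v : P.H x) : ℝ :=
  (C.tor x ξ u v + C.tor x ξ v u) / 2

/-- The skew-symmetric part of the torsion endomorphism. -/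
def torSkew (x : M) (ξ : TangentSpace 𝓘(ℝ, Model n) x) (u v : P.H x) : ℝ :=
  (C.tor x ξ u v - C.tor x ξ v u) / 2

/-- `τ(u, v) = -∑_s ε_s T⁰(ξ_s, J_s u, v)`. -/
def tau (J : Fin 3 → ∀ x : M, Module.End ℝ (P.H x))
    (ξ : Fin 3 → ∀ x : M, TangentSpace 𝓘(ℝ, Model n) x) (x : M) (u v : P.H x) : ℝ :=
  -∑ s, eps s * C.torSym x (ξ s x) (J s x u) v

/-- `μ_s(u, v) = ε_s Tᵃ(ξ_s, J_s u, v)`; the three tensors `μ_s` coincide with `μ`. -/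
def mu (J : Fin 3 → ∀ x : M, Module.End ℝ (P.H x))
    (ξ : Fin 3 → ∀ x : M, TangentSpace 𝓘(ℝ, Model n) x) (s : Fin 3) (x : M) (u v : P.H x) : ℝ :=
  eps s * C.torSkew x (ξ s x) (J s x u) v

/-- `τ = 0` and `μ = 0`, for all local Reeb frames. -/
def TauMuVanish : Prop :=
  ∀ U η J ξ, IsReebFrame P C.V U η J ξ → ∀ x ∈ U, ∀ u v : P.H x,
    C.tau J ξ x u v = 0 ∧ ∀ s, C.mu J ξ s x u v = 0

/-- The torsion endomorphism vanishes: `T(ξ, X) = 0` for vertical `ξ` and horizontal `X`. -/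
def TorsionEndVanish : Prop :=
  ∀ x, ∀ ξ ∈ C.V x, ∀ u ∈ P.H x, C.cov.torsion x ξ u = 0

/-- The vertical distribution is integrable: brackets of vertical fields are vertical. -/
def VerticalIntegrable : Prop :=
  ∀ W : Set M, IsOpen W → ∀ A B : ∀ x : M, C.V x, SmoothSectionOn C.V W A →
    SmoothSectionOn C.V W B → ∀ x ∈ W, VectorField.mlieBracket 𝓘(ℝ, Model n)
      (fun y => (A y : TangentSpace 𝓘(ℝ, Model n) y)) (fun y => B y) x ∈ C.V x

/-- The fundamental `2`-form `ω_s = g(J_s ·, ·)`, extended to `TM` by `V ⌟ ω_s = 0`. -/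
def omega (J : Fin 3 → ∀ x : M, Module.End ℝ (P.H x)) (s : Fin 3) (x : M)
    (u v : TangentSpace 𝓘(ℝ, Model n) x) : ℝ :=
  P.g x (J s x (horizontal C.isCompl x u)) (horizontal C.isCompl x v)

/-- The fundamental `4`-form `Ω = -ω₁ ∧ ω₁ - ω₂ ∧ ω₂ + ω₃ ∧ ω₃`, where `(α ∧ α)(a, b, c, d)` is
`2 (α(a, b) α(c, d) - α(a, c) α(b, d) + α(a, d) α(b, c))` for a `2`-form `α`. -/
def Omega (J : Fin 3 → ∀ x : M, Module.End ℝ (P.H x)) (x : M)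
    (w : Fin 4 → TangentSpace 𝓘(ℝ, Model n) x) : ℝ :=
  -∑ s, eps s * (2 * (C.omega J s x (w 0) (w 1) * C.omega J s x (w 2) (w 3)
    - C.omega J s x (w 0) (w 2) * C.omega J s x (w 1) (w 3)
    + C.omega J s x (w 0) (w 3) * C.omega J s x (w 1) (w 2)))

/-- `dΩ = 0`: the exterior derivative of `Ω`, which is given by `Omega J` in every local gauge,
vanishes on all smooth local vector fields. -/
def OmegaClosed : Prop :=
  ∀ U η J, IsGauge P.H P.g P.PQ U η J → ∀ W : Set M, IsOpen W → W ⊆ U →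
    ∀ A : Fin 5 → ∀ x : M, TangentSpace 𝓘(ℝ, Model n) x, (∀ m, SmoothFieldOn W (A m)) →
      ∀ x ∈ W, dForm (C.Omega J) A x = 0

end CanonicalConnection

end PQC

end

/-! Everything is extracted from the first Bianchi identity of ∇, because the torsion is almost
entirely known. On H it is T(X,Y) = -2 Σ ε_s g(I_s X,Y) ξ_s, and this tensor is parallel: ∇φ = 0
makes ∇ rotate the ξ_s and the I_s by the same ε-skew coefficients, and Σ ε_s ω_s ⊗ ξ_s is invariant
under such rotations.

The vertical part of the identity for (X, Y, ξ_s) expresses η_r(R(X,Y)ξ_s) through the torsion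
endomorphisms T_s = T(ξ_s,·) and the numbers η_r(T(ξ_t,ξ_s)). These curvature coefficients are again
ε-skew. Together with the orthogonality to sp(n,ℝ) ⊕ sp(1,ℝ) this forces a normal form
(`IsUnits.exists_torsionNormalForm`, `TorsionForm`): T_1 = I_1 m + I_2 p + I_3 q, T_2 = I_2 m - I_1
p + I_3 r, T_3 = I_3 m + I_1 q + I_2 r, where m, p, q, r commute with PQ, m is symmetric and
trace-free, p, q, r are skew, and the vertical part of T on V is governed by one number l =
η_1(T(ξ_2,ξ_3)). The tensor μ detects m and τ detects p, q, r, so τ = μ = 0 means that all T_s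
vanish. (In the code the indices start at 0.)

The identity on H, contracted with I_t (`TorsionForm.trace_equation`), relates the skew part of
Ric(X, I_t Y) to tr(I_t R(X,Y)), and this trace is known because the commutators of R(X,Y) with the
units are. If Ric = c g, the equations split over the units, and m, p, q, r vanish because their
coefficients 2d+20 and ±(2d+8), with d = 4n, are nonzero. If all T_s vanish, the same equations give
Ric = (2n+4) l g. This is (a).

For (b), let T_s = 0. The horizontal part of the mixed identity says that the antisymmetrization of
(X,Y) ↦ R(ξ_s,X)Y is a combination of the ω_t with coefficients T(ξ_t,ξ_s)_H. Its traces form a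
linear system that is nonsingular for d > 4 (`IsUnits.mixed_curvature_eq_zero`), so T(V,V) ⊂ V and V
is integrable. The identity for (X, ξ_2, ξ_3) then yields dl(X) = 0 for horizontal X, and dl = 0
follows since brackets of horizontal fields generate V.

For (c), Ω is parallel, so dΩ is an alternating sum of terms Ω(T(·,·),·,·,·). If T_s = 0 and n > 1,
all values of T are vertical and dΩ = 0. Conversely, dΩ(ξ_s,X,Y,Z,U) = 0 says that T_s annihilates Ω
as a derivation; contraction with the units leaves p, q, r with the factor ±(4d-16) and m with ±4d
(`TorsionForm.eq_zero_of_annihilates`). -/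

noncomputable section

/-! ### Calculus of locally smooth vector fields and connections. -/

namespace PQC
section Calculus
variable {n : ℕ} {M : Type*} [TopologicalSpace M] [ChartedSpace (Model n) M]
  [IsManifold 𝓘(ℝ, Model n) ∞ M]

variable {W : Set M} {A B C : ∀ x : M, TangentSpace 𝓘(ℝ, Model n) x} {f : M → ℝ} {x : M}

lemma SmoothFieldOn.mono (hA : SmoothFieldOn W A) {W' : Set M} (h : W' ⊆ W) :
    SmoothFieldOn W' A := ContMDiffOn.mono hA h

lemma SmoothFieldOn.congr (hA : SmoothFieldOn W A) (h : ∀ y ∈ W, B y = A y) :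
    SmoothFieldOn W B :=
  ContMDiffOn.congr hA fun y hy => by simp [h y hy]

lemma SmoothFieldOn.add (hA : SmoothFieldOn W A) (hB : SmoothFieldOn W B) :
    SmoothFieldOn W (fun y => A y + B y) := ContMDiffOn.add_section hA hB

lemma SmoothFieldOn.sub (hA : SmoothFieldOn W A) (hB : SmoothFieldOn W B) :
    SmoothFieldOn W (fun y => A y - B y) := ContMDiffOn.sub_section hA hB

lemma SmoothFieldOn.smul (hf : SmoothFunOn (n := n) W f) (hA : SmoothFieldOn W A) :
    SmoothFieldOn W (fun y => f y • A y) := ContMDiffOn.smul_section hf hA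

lemma SmoothFieldOn.const_smul (c : ℝ) (hA : SmoothFieldOn W A) :
    SmoothFieldOn W (fun y => c • A y) := ContMDiffOn.const_smul_section hA

lemma SmoothFieldOn.sum {ι : Type*} [Fintype ι]
    {F : ι → ∀ x : M, TangentSpace 𝓘(ℝ, Model n) x} (hF : ∀ i, SmoothFieldOn W (F i)) :
    SmoothFieldOn W (fun y => ∑ i, F i y) := ContMDiffOn.sum_section fun i _ => hF i

lemma SmoothFieldOn.contMDiffAt (hA : SmoothFieldOn W A) (hW : IsOpen W) (hx : x ∈ W) :
    ContMDiffAt 𝓘(ℝ, Model n) 𝓘(ℝ, Model n).tangent ∞ (T% A) x :=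
  ContMDiffOn.contMDiffAt hA (hW.mem_nhds hx)

lemma SmoothFieldOn.mdifferentiableAt (hA : SmoothFieldOn W A) (hW : IsOpen W) (hx : x ∈ W) :
    MDifferentiableAt 𝓘(ℝ, Model n) 𝓘(ℝ, Model n).tangent (T% A) x :=
  (hA.contMDiffAt hW hx).mdifferentiableAt (by simp)

omit [IsManifold 𝓘(ℝ, Model n) ∞ M] in
lemma SmoothFunOn.mdifferentiableAt (hf : SmoothFunOn (n := n) W f) (hW : IsOpen W) (hx : x ∈ W) :
    MDifferentiableAt 𝓘(ℝ, Model n) 𝓘(ℝ, ℝ) f x :=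
  (ContMDiffOn.contMDiffAt hf (hW.mem_nhds hx)).mdifferentiableAt (by simp)

instance isManifold_minSmoothness_two : IsManifold 𝓘(ℝ, Model n) (minSmoothness ℝ 2) M := by
  rw [minSmoothness_of_isRCLikeNormedField]; infer_instance

instance isManifold_minSmoothness_three : IsManifold 𝓘(ℝ, Model n) (minSmoothness ℝ 3) M := by
  rw [minSmoothness_of_isRCLikeNormedField]; infer_instance

lemma SmoothFieldOn.mlieBracket (hW : IsOpen W) (hA : SmoothFieldOn W A)
    (hB : SmoothFieldOn W B) :
    SmoothFieldOn W (VectorField.mlieBracket 𝓘(ℝ, Model n) A B) := by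
  intro y hy
  have : IsManifold 𝓘(ℝ, Model n) (((⊤ : ℕ∞) : ℕ∞ω) + 1) M := by simpa using ‹IsManifold _ ∞ M›
  refine ContMDiffAt.contMDiffWithinAt ?_
  exact ContMDiffAt.mlieBracket_vectorField (m := ⊤) (n := ⊤) (hA.contMDiffAt hW hy)
    (hB.contMDiffAt hW hy) (by simp)

/-- A smooth local field coincides near a given point with a globally smooth field. -/
lemma SmoothFieldOn.exists_global [T2Space M] (hW : IsOpen W) (hA : SmoothFieldOn W A)
    (hx : x ∈ W) : ∃ B : ∀ x : M, TangentSpace 𝓘(ℝ, Model n) x,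
      ContMDiff 𝓘(ℝ, Model n) 𝓘(ℝ, Model n).tangent ∞ (T% B) ∧ ∀ᶠ y in nhds x, B y = A y := by
  obtain ⟨f, -, hf⟩ := (SmoothBumpFunction.nhds_basis_tsupport (I := 𝓘(ℝ, Model n)) x).mem_iff.1
    (hW.mem_nhds hx)
  refine ⟨(f : M → ℝ) • A, ContMDiffOn.smul_section_of_tsupport f.contMDiff.contMDiffOn hW hf hA, ?_⟩
  filter_upwards [f.eventuallyEq_one] with y hy
  simp [hy]

lemma exists_smooth_extension [T2Space M] (v : TangentSpace 𝓘(ℝ, Model n) x) :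
    ∃ B : ∀ x : M, TangentSpace 𝓘(ℝ, Model n) x,
      SmoothFieldOn Set.univ B ∧ B x = v := by
  obtain ⟨s, hs, hB⟩ := FiberBundle.exists_contMDiffOn_extend (k := ∞) 𝓘(ℝ, Model n) (Model n) v
  obtain ⟨W, hWs, hW, hx⟩ := mem_nhds_iff.1 hs
  obtain ⟨B, hB, h⟩ := SmoothFieldOn.exists_global hW (hB.mono hWs) hx
  exact ⟨B, hB.contMDiffOn, by simpa using h.self_of_nhds⟩

variable (cov : CovariantDerivative 𝓘(ℝ, Model n) (Model n)
      (TangentSpace 𝓘(ℝ, Model n) : M → Type _))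

lemma cov_congr (hW : IsOpen W) (hA : SmoothFieldOn W A)
    (h : ∀ y ∈ W, A y = B y) (hx : x ∈ W) : cov A x = cov B x := by
  refine cov.isCovariantDerivativeOn.congr_of_eqOn (s := W) (hA.mdifferentiableAt hW hx)
    ((hA.congr fun y hy => (h y hy).symm).mdifferentiableAt hW hx) (hW.mem_nhds hx) h

/-- Smoothness of the connection is used for fields smooth on all of M; near each point a local
field is replaced by a global one, and `cov` is local. -/
lemma cov_contMDiffOn [T2Space M] (hc : cov.ContMDiffCovariantDerivative ∞) (hW : IsOpen W)
    (hA : SmoothFieldOn W A) :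
    letI c (x : M) : Bundle.TotalSpace (Model n →L[ℝ] Model n)
      (fun x ↦ TangentSpace 𝓘(ℝ, Model n) x →L[ℝ] TangentSpace 𝓘(ℝ, Model n) x) := ⟨x, cov A x⟩
    ContMDiffOn 𝓘(ℝ, Model n) (𝓘(ℝ, Model n).prod 𝓘(ℝ, Model n →L[ℝ] Model n)) ∞ c W := by
  intro y hy
  obtain ⟨B, hB, hBA⟩ := hA.exists_global hW hy
  have h1 := hc.contMDiff.contMDiff (σ := B) (by simpa using hB.contMDiffOn)
  have h2 := (h1 y (Set.mem_univ _)).contMDiffAt Filter.univ_mem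
  refine (h2.congr_of_eventuallyEq ?_).contMDiffWithinAt
  obtain ⟨V, hV, hVo, hyV⟩ := eventually_nhds_iff.1 hBA
  filter_upwards [(hVo.inter hW).mem_nhds ⟨hyV, hy⟩] with z hz
  rw [cov_congr cov (hVo.inter hW) (hA.mono Set.inter_subset_right) (B := B) (fun w hw => (hV w hw.1).symm) hz]

lemma SmoothFieldOn.covariant [T2Space M] (hc : cov.ContMDiffCovariantDerivative ∞) (hW : IsOpen W)
    (hA : SmoothFieldOn W A) (hB : SmoothFieldOn W B) :
    SmoothFieldOn W (fun y => cov A y (B y)) :=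
  (cov_contMDiffOn cov hc hW hA).clm_bundle_apply hB

variable {cov} in
lemma cov_add (hA : MDifferentiableAt 𝓘(ℝ, Model n) 𝓘(ℝ, Model n).tangent (T% A) x)
    (hB : MDifferentiableAt 𝓘(ℝ, Model n) 𝓘(ℝ, Model n).tangent (T% B) x) :
    cov (fun y => A y + B y) x = cov A x + cov B x :=
  cov.isCovariantDerivativeOn.add hA hB (Set.mem_univ _)

variable {cov} in
lemma cov_smul (hf : MDifferentiableAt 𝓘(ℝ, Model n) 𝓘(ℝ, ℝ) f x)
    (hA : MDifferentiableAt 𝓘(ℝ, Model n) 𝓘(ℝ, Model n).tangent (T% A) x)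
    (v : TangentSpace 𝓘(ℝ, Model n) x) :
    cov (fun y => f y • A y) x v = f x • cov A x v + mvfderiv 𝓘(ℝ, Model n) f x v • A x := by
  have := cov.isCovariantDerivativeOn.leibniz hA hf (Set.mem_univ _)
  exact congr($this v)

variable {cov} in
lemma cov_const_smul (c : ℝ)
    (hA : MDifferentiableAt 𝓘(ℝ, Model n) 𝓘(ℝ, Model n).tangent (T% A) x) :
    cov (fun y => c • A y) x = c • cov A x :=
  cov.isCovariantDerivativeOn.smul_const c hA (Set.mem_univ _)

variable {cov} in
lemma cov_sub (hA : MDifferentiableAt 𝓘(ℝ, Model n) 𝓘(ℝ, Model n).tangent (T% A) x)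
    (hB : MDifferentiableAt 𝓘(ℝ, Model n) 𝓘(ℝ, Model n).tangent (T% B) x) :
    cov (fun y => A y - B y) x = cov A x - cov B x := by
  have h := cov_const_smul (cov := cov) (-1) hB
  have h2 := cov_add (cov := cov) hA (B := fun y => (-1 : ℝ) • B y)
    (MDifferentiableAt.smul_const_section hB)
  rw [h] at h2
  simpa [sub_eq_add_neg] using h2

variable {cov} in
lemma cov_zero : cov (fun y => (0 : TangentSpace 𝓘(ℝ, Model n) y)) x = 0 :=
  cov.isCovariantDerivativeOn.zero (Set.mem_univ _)

variable {cov} in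
lemma cov_sum {ι : Type*} [Fintype ι] {F : ι → ∀ x : M, TangentSpace 𝓘(ℝ, Model n) x}
    (hW : IsOpen W) (hF : ∀ i, SmoothFieldOn W (F i)) (hx : x ∈ W) :
    cov (fun y => ∑ i, F i y) x = ∑ i, cov (F i) x := by
  classical
  have key : ∀ s : Finset ι, SmoothFieldOn W (fun y => ∑ i ∈ s, F i y) ∧
      cov (fun y => ∑ i ∈ s, F i y) x = ∑ i ∈ s, cov (F i) x := by
    intro s
    refine ⟨ContMDiffOn.sum_section fun i _ => hF i, ?_⟩
    induction s using Finset.induction_on with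
    | empty => simpa using cov_zero
    | insert a s ha ih =>
      simp only [Finset.sum_insert ha]
      rw [cov_add ((hF a).mdifferentiableAt hW hx), ih]
      exact SmoothFieldOn.mdifferentiableAt (ContMDiffOn.sum_section fun i _ => hF i) hW hx
  exact (key Finset.univ).2

lemma SmoothFunOn.mvfderiv (hW : IsOpen W) (hf : SmoothFunOn (n := n) W f)
    (hA : SmoothFieldOn W A) :
    SmoothFunOn (n := n) W (fun y => mvfderiv 𝓘(ℝ, Model n) f y (A y)) := by
  have h1 := ContMDiffOn.contMDiffOn_tangentMapWithin (m := ∞) hf (by simp) hW.uniqueMDiffOn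
  have h2 := h1.comp hA (fun y hy => hy)
  have h3 := (contMDiff_snd_tangentBundle_modelSpace ℝ 𝓘(ℝ, ℝ) (n := ∞)).comp_contMDiffOn h2
  refine h3.congr fun y hy => ?_
  simp only [Function.comp, tangentMapWithin, mfderivWithin_of_isOpen hW hy]
  rfl

/-- A vector field bracket acts on functions as the commutator of derivations. -/
lemma mvfderiv_mlieBracket [T2Space M] (hW : IsOpen W) (hf : SmoothFunOn (n := n) W f)
    (hA : SmoothFieldOn W A) (hB : SmoothFieldOn W B) (hx : x ∈ W) :
    mvfderiv 𝓘(ℝ, Model n) f x (VectorField.mlieBracket 𝓘(ℝ, Model n) A B x)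
      = mvfderiv 𝓘(ℝ, Model n) (fun y => mvfderiv 𝓘(ℝ, Model n) f y (B y)) x (A x)
        - mvfderiv 𝓘(ℝ, Model n) (fun y => mvfderiv 𝓘(ℝ, Model n) f y (A y)) x (B x) := by
  -- The formula is read off from the Jacobi identity for (A, B, f C) minus f times the one for (A,
  -- B, C): the cross terms cancel and the coefficient of C is the difference of the two sides. A
  -- field C with C(x) ≠ 0 exists since dim M > 0.
  obtain ⟨v, hv⟩ : ∃ v : TangentSpace 𝓘(ℝ, Model n) x, v ≠ 0 :=
    exists_ne (α := Model n) 0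
  obtain ⟨C, hC, hCx⟩ := exists_smooth_extension v
  replace hC := hC.mono (Set.subset_univ W)
  have hs : ∀ {D : ∀ x : M, TangentSpace 𝓘(ℝ, Model n) x}, SmoothFieldOn W D →
      ContMDiffAt 𝓘(ℝ, Model n) 𝓘(ℝ, Model n).tangent (minSmoothness ℝ 2) (T% D) x := by
    intro D hD
    refine (hD.contMDiffAt hW hx).of_le ?_
    rw [minSmoothness_of_isRCLikeNormedField]; exact WithTop.coe_le_coe.2 le_top
  have hdf := fun {D} (hD : SmoothFieldOn W D) => (SmoothFunOn.mvfderiv hW hf hD)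
  have hfx := hf.mdifferentiableAt hW hx
  have key : ∀ {D : ∀ x : M, TangentSpace 𝓘(ℝ, Model n) x}, SmoothFieldOn W D → ∀ y ∈ W,
      VectorField.mlieBracket 𝓘(ℝ, Model n) D (f • C) y
        = mvfderiv 𝓘(ℝ, Model n) f y (D y) • C y
          + f y • VectorField.mlieBracket 𝓘(ℝ, Model n) D C y := fun {D} hD y hy =>
    VectorField.mlieBracket_smul_right (V := D) (hf.mdifferentiableAt hW hy)
      (hC.mdifferentiableAt hW hy)
  have key2 : ∀ {D E : ∀ x : M, TangentSpace 𝓘(ℝ, Model n) x}, SmoothFieldOn W D →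
      SmoothFieldOn W E → 
      VectorField.mlieBracket 𝓘(ℝ, Model n) E (VectorField.mlieBracket 𝓘(ℝ, Model n) D (f • C)) x
        = (mvfderiv 𝓘(ℝ, Model n) (fun y => mvfderiv 𝓘(ℝ, Model n) f y (D y)) x (E x) • C x
          + mvfderiv 𝓘(ℝ, Model n) f x (D x) • VectorField.mlieBracket 𝓘(ℝ, Model n) E C x) 
          + (mvfderiv 𝓘(ℝ, Model n) f x (E x) • VectorField.mlieBracket 𝓘(ℝ, Model n) D C x 
            + f x • VectorField.mlieBracket 𝓘(ℝ, Model n) E 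
              (VectorField.mlieBracket 𝓘(ℝ, Model n) D C) x) := by
    intro D E hD hE
    have h1 : VectorField.mlieBracket 𝓘(ℝ, Model n) D (f • C) =ᶠ[nhds x]
        ((fun y => mvfderiv 𝓘(ℝ, Model n) f y (D y)) • C
          + f • VectorField.mlieBracket 𝓘(ℝ, Model n) D C) := by
      filter_upwards [hW.mem_nhds hx] with y hy
      exact key hD y hy
    have h0 : E =ᶠ[nhds x] E := Filter.Eventually.of_forall fun _ => rfl
    rw [Filter.EventuallyEq.mlieBracket_vectorField_eq h0 h1,
      VectorField.mlieBracket_add_right, VectorField.mlieBracket_smul_right,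
      VectorField.mlieBracket_smul_right hfx]
    · exact (hD.mlieBracket hW hC).mdifferentiableAt hW hx
    · exact (hdf hD).mdifferentiableAt hW hx
    · exact hC.mdifferentiableAt hW hx
    · exact ((hC.smul (hdf hD))).mdifferentiableAt hW hx
    · exact ((hD.mlieBracket hW hC).smul hf).mdifferentiableAt hW hx
  have J1 := VectorField.leibniz_identity_mlieBracket_apply (hs hA) (hs hB) (hs (hC.smul hf))
  have J2 := VectorField.leibniz_identity_mlieBracket_apply (hs hA) (hs hB) (hs hC)
  change VectorField.mlieBracket 𝓘(ℝ, Model n) A (VectorField.mlieBracket _ B (f • C)) x =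
    VectorField.mlieBracket _ _ (f • C) x +
      VectorField.mlieBracket _ B (VectorField.mlieBracket _ A (f • C)) x at J1
  rw [key2 hB hA, key2 hA hB, key (hA.mlieBracket hW hB) x hx, J2] at J1
  rw [hCx] at J1
  have : (mvfderiv 𝓘(ℝ, Model n) f x (VectorField.mlieBracket 𝓘(ℝ, Model n) A B x)
      - (mvfderiv 𝓘(ℝ, Model n) (fun y => mvfderiv 𝓘(ℝ, Model n) f y (B y)) x (A x)
        - mvfderiv 𝓘(ℝ, Model n) (fun y => mvfderiv 𝓘(ℝ, Model n) f y (A y)) x (B x))) • v = 0 := by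
    have := sub_eq_zero.2 J1
    rw [← neg_eq_zero, ← this]
    module
  exact sub_eq_zero.1 ((smul_eq_zero.1 this).resolve_right hv)

end Calculus
end PQC

/-! ### Curvature, torsion and the first Bianchi identity of an arbitrary connection. -/

namespace PQC
section Curvature
variable {n : ℕ} {M : Type*} [TopologicalSpace M] [ChartedSpace (Model n) M]
  [IsManifold 𝓘(ℝ, Model n) ∞ M] [T2Space M]

variable {W : Set M} {A B C A' B' C' : ∀ x : M, TangentSpace 𝓘(ℝ, Model n) x} {f : M → ℝ} {x : M}
  {cov : CovariantDerivative 𝓘(ℝ, Model n) (Model n)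
      (TangentSpace 𝓘(ℝ, Model n) : M → Type _)}

omit [IsManifold 𝓘(ℝ, Model n) ∞ M] [T2Space M] in
lemma mlieBracket_congr_on (hW : IsOpen W) (hA : ∀ y ∈ W, A y = A' y) (hB : ∀ y ∈ W, B y = B' y)
    (hx : x ∈ W) : VectorField.mlieBracket 𝓘(ℝ, Model n) A B x
      = VectorField.mlieBracket 𝓘(ℝ, Model n) A' B' x :=
  Filter.EventuallyEq.mlieBracket_vectorField_eq
    (Filter.eventuallyEq_of_mem (hW.mem_nhds hx) hA)
    (Filter.eventuallyEq_of_mem (hW.mem_nhds hx) hB)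

omit [IsManifold 𝓘(ℝ, Model n) ∞ M] [T2Space M] in
lemma mvfderiv_congr_on {f g : M → ℝ} (hW : IsOpen W) (h : ∀ y ∈ W, f y = g y) (hx : x ∈ W) :
    mvfderiv 𝓘(ℝ, Model n) f x = mvfderiv 𝓘(ℝ, Model n) g x := by
  have h1 : f =ᶠ[nhds x] g := Filter.eventuallyEq_of_mem (hW.mem_nhds hx) h
  ext v
  simp only [mvfderiv, h1.mfderiv_eq]
  rfl

omit [T2Space M] in
lemma mlieBracket_jacobi (hW : IsOpen W) (hA : SmoothFieldOn W A) (hB : SmoothFieldOn W B)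
    (hC : SmoothFieldOn W C) (hx : x ∈ W) :
    VectorField.mlieBracket 𝓘(ℝ, Model n) (VectorField.mlieBracket 𝓘(ℝ, Model n) A B) C x
      + VectorField.mlieBracket 𝓘(ℝ, Model n) (VectorField.mlieBracket 𝓘(ℝ, Model n) B C) A x
      + VectorField.mlieBracket 𝓘(ℝ, Model n) (VectorField.mlieBracket 𝓘(ℝ, Model n) C A) B x
      = 0 := by
  have hs : ∀ {D : ∀ x : M, TangentSpace 𝓘(ℝ, Model n) x}, SmoothFieldOn W D →
      ContMDiffAt 𝓘(ℝ, Model n) 𝓘(ℝ, Model n).tangent (minSmoothness ℝ 2) (T% D) x := by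
    intro D hD
    refine (hD.contMDiffAt hW hx).of_le ?_
    rw [minSmoothness_of_isRCLikeNormedField]; exact WithTop.coe_le_coe.2 le_top
  have J := VectorField.leibniz_identity_mlieBracket_apply (hs hA) (hs hB) (hs hC)
  have h1 : ∀ (D E : ∀ x : M, TangentSpace 𝓘(ℝ, Model n) x) (y : M),
      VectorField.mlieBracket 𝓘(ℝ, Model n) D E y = - VectorField.mlieBracket 𝓘(ℝ, Model n) E D y :=
    fun D E y => VectorField.mlieBracket_swap_apply
  have h2 : ∀ {D E F : ∀ x : M, TangentSpace 𝓘(ℝ, Model n) x}, SmoothFieldOn W E →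
      SmoothFieldOn W F → 
      VectorField.mlieBracket 𝓘(ℝ, Model n) D (VectorField.mlieBracket 𝓘(ℝ, Model n) E F) x
      = - VectorField.mlieBracket 𝓘(ℝ, Model n) D (VectorField.mlieBracket 𝓘(ℝ, Model n) F E) x := by
    intro D E F hE hF
    rw [mlieBracket_congr_on hW (A' := D) (fun _ _ => rfl) (fun y _ => h1 E F y) hx]
    have := VectorField.mlieBracket_const_smul_right (V := D) (c := (-1 : ℝ))
      ((hF.mlieBracket hW hE).mdifferentiableAt hW hx)
    have e : (fun y => -VectorField.mlieBracket 𝓘(ℝ, Model n) F E y)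
        = (-1 : ℝ) • VectorField.mlieBracket 𝓘(ℝ, Model n) F E := by ext1 y; simp
    rw [e, this, neg_one_smul]
  rw [h1 (VectorField.mlieBracket 𝓘(ℝ, Model n) B C) A, J,
    h1 (VectorField.mlieBracket 𝓘(ℝ, Model n) C A) B, h2 (D := B) hC hA]
  abel

omit [T2Space M] in
lemma torsion_field (hW : IsOpen W) (hA : SmoothFieldOn W A) (hB : SmoothFieldOn W B)
    (hx : x ∈ W) : cov.torsion x (A x) (B x)
      = cov B x (A x) - cov A x (B x) - VectorField.mlieBracket 𝓘(ℝ, Model n) A B x :=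
  cov.torsion_apply (hA.mdifferentiableAt hW hx) (hB.mdifferentiableAt hW hx)

lemma SmoothFieldOn.torsion (hc : cov.ContMDiffCovariantDerivative ∞) (hW : IsOpen W)
    (hA : SmoothFieldOn W A) (hB : SmoothFieldOn W B) :
    SmoothFieldOn W (fun y => cov.torsion y (A y) (B y)) :=
  (((hB.covariant cov hc hW hA).sub (hA.covariant cov hc hW hB)).sub
    (hA.mlieBracket hW hB)).congr fun _ hy => torsion_field hW hA hB hy

/-- The covariant derivative of the torsion, `(∇_A T)(B, C)`, on vector fields. -/
def covTorsion (cov : CovariantDerivative 𝓘(ℝ, Model n) (Model n)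
      (TangentSpace 𝓘(ℝ, Model n) : M → Type _))
    (A B C : ∀ x : M, TangentSpace 𝓘(ℝ, Model n) x) (x : M) : TangentSpace 𝓘(ℝ, Model n) x :=
  cov (fun y => cov.torsion y (B y) (C y)) x (A x) - cov.torsion x (cov B x (A x)) (C x)
    - cov.torsion x (B x) (cov C x (A x))

lemma cov_torsion_field (hc : cov.ContMDiffCovariantDerivative ∞) (hW : IsOpen W)
    (hB : SmoothFieldOn W B) (hC : SmoothFieldOn W C) (hx : x ∈ W)
    (v : TangentSpace 𝓘(ℝ, Model n) x) :
    cov (fun y => cov.torsion y (B y) (C y)) x v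
      = cov (fun y => cov C y (B y)) x v - cov (fun y => cov B y (C y)) x v
        - cov (VectorField.mlieBracket 𝓘(ℝ, Model n) B C) x v := by
  rw [cov_congr cov hW (hB.torsion hc hW hC) (fun y hy => torsion_field hW hB hC hy) hx,
    cov_sub (((hC.covariant cov hc hW hB).sub (hB.covariant cov hc hW hC)).mdifferentiableAt hW hx)
      ((hB.mlieBracket hW hC).mdifferentiableAt hW hx),
    cov_sub ((hC.covariant cov hc hW hB).mdifferentiableAt hW hx)
      ((hB.covariant cov hc hW hC).mdifferentiableAt hW hx)]
  rfl

omit [T2Space M] in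
lemma torsion_torsion_field (hW : IsOpen W)
    (hA : SmoothFieldOn W A) (hB : SmoothFieldOn W B) (hC : SmoothFieldOn W C) (hx : x ∈ W) :
    cov.torsion x (cov.torsion x (A x) (B x)) (C x)
      = cov.torsion x (cov B x (A x)) (C x) - cov.torsion x (cov A x (B x)) (C x)
        - (cov C x (VectorField.mlieBracket 𝓘(ℝ, Model n) A B x)
          - cov (VectorField.mlieBracket 𝓘(ℝ, Model n) A B) x (C x)
          - VectorField.mlieBracket 𝓘(ℝ, Model n)
              (VectorField.mlieBracket 𝓘(ℝ, Model n) A B) C x) := by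
  rw [← torsion_field hW (hA.mlieBracket hW hB) hC hx, torsion_field hW hA hB hx]
  rw [map_sub, map_sub]
  rfl

omit [T2Space M] in
-- In (∇_A T)(B,C) + T(T(A,B),C) the term T(∇_A B, C) cancels. The two torsion terms that survive
-- telescope in the cyclic sum, which is why the two tensors are grouped.
lemma covTorsion_add_torsion_torsion (hc : cov.ContMDiffCovariantDerivative ∞) [T2Space M]
    (hW : IsOpen W) (hA : SmoothFieldOn W A) (hB : SmoothFieldOn W B) (hC : SmoothFieldOn W C)
    (hx : x ∈ W) :
    covTorsion cov A B C x + cov.torsion x (cov.torsion x (A x) (B x)) (C x)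
      = (cov (fun y => cov C y (B y)) x (A x) - cov (fun y => cov B y (C y)) x (A x)
        - cov (VectorField.mlieBracket 𝓘(ℝ, Model n) B C) x (A x))
        + cov.torsion x (cov C x (A x)) (B x) - cov.torsion x (cov A x (B x)) (C x)
        - (cov C x (VectorField.mlieBracket 𝓘(ℝ, Model n) A B x)
          - cov (VectorField.mlieBracket 𝓘(ℝ, Model n) A B) x (C x)
          - VectorField.mlieBracket 𝓘(ℝ, Model n)
              (VectorField.mlieBracket 𝓘(ℝ, Model n) A B) C x) := by
  rw [covTorsion, cov_torsion_field hc hW hB hC hx, torsion_torsion_field hW hA hB hC hx,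
    cov.torsion_antisymm (B x) (cov C x (A x))]
  abel

/-- The first Bianchi identity of a connection with torsion. -/
lemma first_bianchi_field (hc : cov.ContMDiffCovariantDerivative ∞) (hW : IsOpen W)
    (hA : SmoothFieldOn W A) (hB : SmoothFieldOn W B) (hC : SmoothFieldOn W C) (hx : x ∈ W) :
    curvatureField cov A B C x + curvatureField cov B C A x + curvatureField cov C A B x
      = (covTorsion cov A B C x + cov.torsion x (cov.torsion x (A x) (B x)) (C x))
        + (covTorsion cov B C A x + cov.torsion x (cov.torsion x (B x) (C x)) (A x))
        + (covTorsion cov C A B x + cov.torsion x (cov.torsion x (C x) (A x)) (B x)) := by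
  have J := mlieBracket_jacobi hW hA hB hC hx
  have h1 := covTorsion_add_torsion_torsion (cov := cov) hc hW hA hB hC hx
  have h2 := covTorsion_add_torsion_torsion (cov := cov) hc hW hB hC hA hx
  have h3 := covTorsion_add_torsion_torsion (cov := cov) hc hW hC hA hB hx
  rw [h1, h2, h3]
  clear h1 h2 h3
  simp only [curvatureField]
  -- The letters u, v, w stand for T(∇_A C, B), T(∇_B A, C), T(∇_C B, A), and j1, j2, j3 for the
  -- iterated brackets, whose sum vanishes by Jacobi.
  have aux : ∀ {G : Type} [AddCommGroup G] {a b c d e f g h i j m p u v w j1 j2 j3 : G},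
      j1 + j2 + j3 = 0 →
      (a - b - c) + (d - e - f) + (g - h - i)
        = ((a - h - j) + u - v - (c - m - j1)) + ((d - b - p) + v - w - (f - j - j2))
          + ((g - e - m) + w - u - (i - p - j3)) := by
    intro G _ a b c d e f g h i j m p u v w j1 j2 j3 h
    rw [← sub_eq_zero, ← neg_eq_zero, ← h]
    abel
  exact aux J

/-- The second covariant derivative `∇_A ∇_B C - ∇_{∇_A B} C`. -/
def hessField (cov : CovariantDerivative 𝓘(ℝ, Model n) (Model n)
      (TangentSpace 𝓘(ℝ, Model n) : M → Type _))
    (C A B : ∀ x : M, TangentSpace 𝓘(ℝ, Model n) x) (x : M) : TangentSpace 𝓘(ℝ, Model n) x :=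
  cov (fun y => cov C y (B y)) x (A x) - cov C x (cov B x (A x))

omit [T2Space M] in
-- Each term on the right depends on A and B only through their values at the point, whereas the
-- terms in the definition of the curvature do not. Tensoriality in the first two arguments rests on
-- this.
lemma curvatureField_eq_hessField (hW : IsOpen W) (hA : SmoothFieldOn W A)
    (hB : SmoothFieldOn W B) (hx : x ∈ W) :
    curvatureField cov A B C x = hessField cov C A B x - hessField cov C B A x
      + cov C x (cov.torsion x (A x) (B x)) := by
  rw [torsion_field hW hA hB hx]
  simp only [curvatureField, hessField, map_sub]
  abel

/-- Replacing B by f B produces the same extra term (Af) ∇_B C in both summands of `hessField`, so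
the difference is linear over functions in B. -/
lemma hessField_congr (hc : cov.ContMDiffCovariantDerivative ∞) (hW : IsOpen W)
    (hC : SmoothFieldOn W C) (hB : SmoothFieldOn W B) (hB' : SmoothFieldOn W B') (hx : x ∈ W)
    (hAA : A x = A' x) (hBB : B x = B' x) :
    hessField cov C A B x = hessField cov C A' B' x := by
  have hT : TensorialAt 𝓘(ℝ, Model n) (Model n) (fun B => hessField cov C A B x) x := by
    have hd : ∀ {B : ∀ x : M, TangentSpace 𝓘(ℝ, Model n) x},
        MDifferentiableAt 𝓘(ℝ, Model n) 𝓘(ℝ, Model n).tangent (T% B) x →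
        MDifferentiableAt 𝓘(ℝ, Model n) 𝓘(ℝ, Model n).tangent (T% (fun y => cov C y (B y))) x := by
      intro B hB
      have h1 := ((cov_contMDiffOn cov hc hW hC).contMDiffAt
        (hW.mem_nhds hx)).mdifferentiableAt (by simp)
      exact h1.clm_bundle_apply hB
    refine ⟨fun {f σ} hf hσ => ?_, fun {σ σ'} hσ hσ' => ?_⟩
    · have e1 : (fun y => cov C y ((f • σ) y)) = fun y => f y • cov C y (σ y) := by
        ext1 y; exact (cov C y).map_smul _ _
      have e2 : cov (f • σ) x (A x) = _ := cov_smul hf hσ (A x)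
      simp only [hessField, e1, e2, cov_smul hf (hd hσ), map_add, map_smul]
      module
    · have e1 : (fun y => cov C y ((σ + σ') y)) = fun y => cov C y (σ y) + cov C y (σ' y) := by
        ext1 y; exact (cov C y).map_add _ _
      have e2 : cov (σ + σ') x = _ := cov_add hσ hσ'
      simp only [hessField, e1, e2, cov_add (hd hσ) (hd hσ'), add_apply, map_add]
      abel
  rw [show hessField cov C A B x = hessField cov C A B' x from
    hT.pointwise (hB.mdifferentiableAt hW hx) (hB'.mdifferentiableAt hW hx) hBB]
  simp only [hessField, hAA]

lemma curvatureField_congr_left (hc : cov.ContMDiffCovariantDerivative ∞) (hW : IsOpen W)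
    (hA : SmoothFieldOn W A) (hA' : SmoothFieldOn W A')
    (hB : SmoothFieldOn W B) (hB' : SmoothFieldOn W B') (hC : SmoothFieldOn W C) (hx : x ∈ W)
    (hAA : A x = A' x) (hBB : B x = B' x) :
    curvatureField cov A B C x = curvatureField cov A' B' C x := by
  rw [curvatureField_eq_hessField hW hA hB hx, curvatureField_eq_hessField hW hA' hB' hx,
    hessField_congr hc hW hC hB hB' hx hAA hBB, hessField_congr hc hW hC hA hA' hx hBB hAA, hAA, hBB]

/-- The first-order cross terms are symmetric in A and B and cancel; the second derivatives of f
cancel against the bracket term by `mvfderiv_mlieBracket`. -/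
lemma curvatureField_smul (hc : cov.ContMDiffCovariantDerivative ∞) (hW : IsOpen W)
    (hA : SmoothFieldOn W A) (hB : SmoothFieldOn W B) (hC : SmoothFieldOn W C)
    (hf : SmoothFunOn (n := n) W f) (hx : x ∈ W) :
    curvatureField cov A B (fun y => f y • C y) x = f x • curvatureField cov A B C x := by
  have key : ∀ {A B : ∀ x : M, TangentSpace 𝓘(ℝ, Model n) x}, SmoothFieldOn W A →
      SmoothFieldOn W B → cov (fun y => cov (fun y => f y • C y) y (B y)) x (A x)
        = f x • cov (fun y => cov C y (B y)) x (A x)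
          + mvfderiv 𝓘(ℝ, Model n) f x (A x) • cov C x (B x)
          + (mvfderiv 𝓘(ℝ, Model n) f x (B x) • cov C x (A x)
            + mvfderiv 𝓘(ℝ, Model n) (fun y => mvfderiv 𝓘(ℝ, Model n) f y (B y)) x (A x) • C x) := by
    intro A B hA hB
    have hf' := hf.mvfderiv hW hB
    rw [cov_congr cov hW ((hC.smul hf).covariant cov hc hW hB)
      (fun y hy => cov_smul (hf.mdifferentiableAt hW hy) (hC.mdifferentiableAt hW hy) (B y)) hx,
      cov_add (((hC.covariant cov hc hW hB).smul hf).mdifferentiableAt hW hx)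
        ((hC.smul hf').mdifferentiableAt hW hx), add_apply,
      cov_smul (hf.mdifferentiableAt hW hx) ((hC.covariant cov hc hW hB).mdifferentiableAt hW hx),
      cov_smul (hf'.mdifferentiableAt hW hx) (hC.mdifferentiableAt hW hx)]
  simp only [curvatureField]
  rw [key hA hB, key hB hA, cov_smul (hf.mdifferentiableAt hW hx) (hC.mdifferentiableAt hW hx),
    mvfderiv_mlieBracket hW hf hA hB hx]
  module

lemma curvatureField_sum (hc : cov.ContMDiffCovariantDerivative ∞) (hW : IsOpen W)
    (hA : SmoothFieldOn W A) (hB : SmoothFieldOn W B) {ι : Type*} [Fintype ι]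
    {F : ι → ∀ x : M, TangentSpace 𝓘(ℝ, Model n) x} (hF : ∀ i, SmoothFieldOn W (F i)) (hx : x ∈ W) :
    curvatureField cov A B (fun y => ∑ i, F i y) x = ∑ i, curvatureField cov A B (F i) x := by
  have key : ∀ {A B : ∀ x : M, TangentSpace 𝓘(ℝ, Model n) x}, SmoothFieldOn W A →
      SmoothFieldOn W B → cov (fun y => cov (fun y => ∑ i, F i y) y (B y)) x (A x)
        = ∑ i, cov (fun y => cov (F i) y (B y)) x (A x) := by
    intro A B hA hB
    rw [cov_congr cov hW ((SmoothFieldOn.sum hF).covariant cov hc hW hB)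
      (B := fun y => ∑ i, cov (F i) y (B y)) (fun y hy => by rw [cov_sum hW hF hy]; simp) hx,
      cov_sum hW (fun i => (hF i).covariant cov hc hW hB) hx]
    simp
  simp only [curvatureField]
  rw [key hA hB, key hB hA, cov_sum hW hF hx]
  simp [Finset.sum_sub_distrib]

omit [T2Space M] in
lemma curvatureField_congr_on (hc : cov.ContMDiffCovariantDerivative ∞) [T2Space M] (hW : IsOpen W)
    (hA : SmoothFieldOn W A) (hB : SmoothFieldOn W B) (hC : SmoothFieldOn W C)
    (h : ∀ y ∈ W, C y = C' y) (hx : x ∈ W) :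
    curvatureField cov A B C x = curvatureField cov A B C' x := by
  have hy := fun y hy => cov_congr cov hW hC h (x := y) hy
  simp only [curvatureField]
  rw [cov_congr cov hW (hC.covariant cov hc hW hB) (fun y hy' => by rw [hy y hy']) hx,
    cov_congr cov hW (hC.covariant cov hc hW hA) (fun y hy' => by rw [hy y hy']) hx, hy x hx]

lemma curvatureField_congr_right (hc : cov.ContMDiffCovariantDerivative ∞) (hW : IsOpen W)
    (hA : SmoothFieldOn W A) (hB : SmoothFieldOn W B) (hC : SmoothFieldOn W C)
    (hC' : SmoothFieldOn W C') (hx : x ∈ W) (hCC : C x = C' x) :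
    curvatureField cov A B C x = curvatureField cov A B C' x := by
  let e := trivializationAt (Model n) (TangentSpace 𝓘(ℝ, Model n) : M → Type _) x
  let b := Module.finBasis ℝ (Model n)
  have he : x ∈ e.baseSet := FiberBundle.mem_baseSet_trivializationAt' x
  let W' := W ∩ e.baseSet
  have hW' : IsOpen W' := hW.inter e.open_baseSet
  have hx' : x ∈ W' := ⟨hx, he⟩
  have hF : ∀ i, SmoothFieldOn W' (e.localFrame b i) := fun i =>
    ContMDiffOn.mono (e.contMDiffOn_localFrame_baseSet ∞ b i) Set.inter_subset_right
  -- In a local frame the curvature of C at x is determined by the coefficients of C at x, because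
  -- it is linear over functions.
  have key : ∀ {C : ∀ x : M, TangentSpace 𝓘(ℝ, Model n) x}, SmoothFieldOn W C →
      curvatureField cov A B C x = ∑ i, (e.localFrameCoeff 𝓘(ℝ, Model n) b i x (C x)) •
        curvatureField cov A B (e.localFrame b i) x := by
    intro C hC
    have hco : ∀ i, SmoothFunOn (n := n) W' 
        (fun y => e.localFrameCoeff 𝓘(ℝ, Model n) b i y (C y)) := fun i =>
      contMDiffOn_localFrameCoeff b hW' Set.inter_subset_right (hC.mono Set.inter_subset_left) i
    rw [curvatureField_congr_on hc hW' (hA.mono Set.inter_subset_left) 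
      (hB.mono Set.inter_subset_left) (hC.mono Set.inter_subset_left)
      (fun y hy => e.eq_sum_localFrameCoeff_smul (I := 𝓘(ℝ, Model n)) (b := b) hy.2) hx',
      curvatureField_sum hc hW' (hA.mono Set.inter_subset_left) 
      (hB.mono Set.inter_subset_left) (fun i => (hF i).smul (hco i)) hx']
    refine Finset.sum_congr rfl fun i _ => ?_
    exact curvatureField_smul hc hW' (hA.mono Set.inter_subset_left) 
      (hB.mono Set.inter_subset_left) (hF i) (hco i) hx'
  rw [key hC, key hC', hCC]

/-- By tensoriality in all three arguments the particular extensions chosen in `curvature` do not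
matter. They are smooth only near the point, so the comparison is made on a common smaller
neighbourhood. -/
lemma curvature_apply (hc : cov.ContMDiffCovariantDerivative ∞) (hW : IsOpen W)
    (hA : SmoothFieldOn W A) (hB : SmoothFieldOn W B) (hC : SmoothFieldOn W C) (hx : x ∈ W) :
    curvature cov x (A x) (B x) (C x) = curvatureField cov A B C x := by
  have h : ∀ v : TangentSpace 𝓘(ℝ, Model n) x, ∃ W' : Set M, IsOpen W' ∧ x ∈ W' ∧
      SmoothFieldOn W' (FiberBundle.extend (Model n) v) := by
    intro v
    obtain ⟨s, hs, hB⟩ := FiberBundle.exists_contMDiffOn_extend (k := ∞) 𝓘(ℝ, Model n) (Model n) v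
    obtain ⟨W', hWs, hW, hx⟩ := mem_nhds_iff.1 hs
    exact ⟨W', hW, hx, hB.mono hWs⟩
  obtain ⟨W₁, h₁, hx₁, hA₁⟩ := h (A x)
  obtain ⟨W₂, h₂, hx₂, hB₂⟩ := h (B x)
  obtain ⟨W₃, h₃, hx₃, hC₃⟩ := h (C x)
  let V := W ∩ W₁ ∩ W₂ ∩ W₃
  have hV : IsOpen V := ((hW.inter h₁).inter h₂).inter h₃
  have hxV : x ∈ V := ⟨⟨⟨hx, hx₁⟩, hx₂⟩, hx₃⟩
  have s0 : V ⊆ W := fun y hy => hy.1.1.1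
  have s1 : V ⊆ W₁ := fun y hy => hy.1.1.2
  have s2 : V ⊆ W₂ := fun y hy => hy.1.2
  have s3 : V ⊆ W₃ := fun y hy => hy.2
  rw [curvature, curvatureField_congr_left hc hV (hA₁.mono s1) (hA.mono s0) (hB₂.mono s2)
    (hB.mono s0) (hC₃.mono s3) hxV (by simp) (by simp),
    curvatureField_congr_right hc hV (hA.mono s0) (hB.mono s0) (hC₃.mono s3) (hC.mono s0) hxV
    (by simp)]

section Tensor

variable (hc : cov.ContMDiffCovariantDerivative ∞) (u u' v w w' : TangentSpace 𝓘(ℝ, Model n) x)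
include hc

lemma curvature_swap : curvature cov x u v w = - curvature cov x v u w := by
  obtain ⟨A, hA, rfl⟩ := exists_smooth_extension u
  obtain ⟨B, hB, rfl⟩ := exists_smooth_extension v
  obtain ⟨C, hC, rfl⟩ := exists_smooth_extension w
  rw [curvature_apply hc isOpen_univ hA hB hC (Set.mem_univ _),
    curvature_apply hc isOpen_univ hB hA hC (Set.mem_univ _)]
  simp only [curvatureField]
  rw [VectorField.mlieBracket_swap_apply (V := A) (W := B), map_neg]
  abel

lemma curvature_add_left :
    curvature cov x (u + u') v w = curvature cov x u v w + curvature cov x u' v w := by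
  obtain ⟨A, hA, rfl⟩ := exists_smooth_extension u
  obtain ⟨A', hA', rfl⟩ := exists_smooth_extension u'
  obtain ⟨B, hB, rfl⟩ := exists_smooth_extension v
  obtain ⟨C, hC, rfl⟩ := exists_smooth_extension w
  rw [curvature_apply hc isOpen_univ hA hB hC (Set.mem_univ _),
    curvature_apply hc isOpen_univ hA' hB hC (Set.mem_univ _),
    curvature_apply hc isOpen_univ (hA.add hA') hB hC (Set.mem_univ _)]
  simp only [curvatureField]
  have h1 := VectorField.mlieBracket_add_left (W := B)
    (hA.mdifferentiableAt isOpen_univ (Set.mem_univ x))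
    (hA'.mdifferentiableAt isOpen_univ (Set.mem_univ x))
  rw [show VectorField.mlieBracket 𝓘(ℝ, Model n) (fun y => A y + A' y) B x = _ from h1,
    cov_congr cov isOpen_univ (hC.covariant cov hc isOpen_univ (hA.add hA'))
      (B := fun y => cov C y (A y) + cov C y (A' y)) (fun y _ => (cov C y).map_add _ _)
      (Set.mem_univ x), cov_add
      ((hC.covariant cov hc isOpen_univ hA).mdifferentiableAt isOpen_univ (Set.mem_univ x))
      ((hC.covariant cov hc isOpen_univ hA').mdifferentiableAt isOpen_univ (Set.mem_univ x))]
  simp only [map_add, add_apply]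
  abel

lemma curvature_smul_left (c : ℝ) :
    curvature cov x (c • u) v w = c • curvature cov x u v w := by
  obtain ⟨A, hA, rfl⟩ := exists_smooth_extension u
  obtain ⟨B, hB, rfl⟩ := exists_smooth_extension v
  obtain ⟨C, hC, rfl⟩ := exists_smooth_extension w
  rw [curvature_apply hc isOpen_univ hA hB hC (Set.mem_univ _),
    curvature_apply hc isOpen_univ (hA.const_smul c) hB hC (Set.mem_univ _)]
  simp only [curvatureField]
  have h1 := VectorField.mlieBracket_const_smul_left (W := B) (c := c)
    (hA.mdifferentiableAt isOpen_univ (Set.mem_univ x))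
  rw [show VectorField.mlieBracket 𝓘(ℝ, Model n) (fun y => c • A y) B x = _ from h1,
    cov_congr cov isOpen_univ (hC.covariant cov hc isOpen_univ (hA.const_smul c))
      (B := fun y => c • cov C y (A y)) (fun y _ => (cov C y).map_smul _ _)
      (Set.mem_univ x), cov_const_smul c
      ((hC.covariant cov hc isOpen_univ hA).mdifferentiableAt isOpen_univ (Set.mem_univ x))]
  simp only [map_smul, smul_apply, smul_sub]

lemma curvature_add_right :
    curvature cov x u v (w + w') = curvature cov x u v w + curvature cov x u v w' := by
  obtain ⟨A, hA, rfl⟩ := exists_smooth_extension u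
  obtain ⟨B, hB, rfl⟩ := exists_smooth_extension v
  obtain ⟨C, hC, rfl⟩ := exists_smooth_extension w
  obtain ⟨C', hC', rfl⟩ := exists_smooth_extension w'
  have h := curvatureField_sum hc isOpen_univ hA hB (ι := Fin 2) (F := ![C, C'])
    (fun i => by fin_cases i <;> assumption) (Set.mem_univ x)
  simp only [Fin.sum_univ_two, Matrix.cons_val_zero, Matrix.cons_val_one] at h
  rw [curvature_apply hc isOpen_univ hA hB hC (Set.mem_univ _),
    curvature_apply hc isOpen_univ hA hB hC' (Set.mem_univ _),
    curvature_apply hc isOpen_univ hA hB (hC.add hC') (Set.mem_univ _), h]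

lemma curvature_smul_right (c : ℝ) :
    curvature cov x u v (c • w) = c • curvature cov x u v w := by
  obtain ⟨A, hA, rfl⟩ := exists_smooth_extension u
  obtain ⟨B, hB, rfl⟩ := exists_smooth_extension v
  obtain ⟨C, hC, rfl⟩ := exists_smooth_extension w
  rw [curvature_apply hc isOpen_univ hA hB hC (Set.mem_univ _),
    curvature_apply hc isOpen_univ hA hB (hC.const_smul c) (Set.mem_univ _)]
  exact curvatureField_smul hc isOpen_univ hA hB hC (f := fun _ => c) contMDiffOn_const
    (Set.mem_univ x)

lemma curvature_add_middle :
    curvature cov x v (u + u') w = curvature cov x v u w + curvature cov x v u' w := by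
  rw [curvature_swap hc, curvature_add_left hc, curvature_swap hc v u, curvature_swap hc v u']
  abel

lemma curvature_smul_middle (c : ℝ) :
    curvature cov x v (c • u) w = c • curvature cov x v u w := by
  rw [curvature_swap hc, curvature_smul_left hc, curvature_swap hc v u, smul_neg]

end Tensor

end Curvature
end PQC

/-! ### Reeb frames and the splitting into horizontal and vertical parts. -/

namespace PQC
section Frame
variable {n : ℕ} {M : Type*} [TopologicalSpace M] [ChartedSpace (Model n) M]
  [IsManifold 𝓘(ℝ, Model n) ∞ M] {P : Structure n M} {C : CanonicalConnection P}
  {U : Set M} {η : Fin 3 → ∀ x : M, TangentSpace 𝓘(ℝ, Model n) x →L[ℝ] ℝ}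
  {J : Fin 3 → ∀ x : M, Module.End ℝ (P.H x)}
  {ξ : Fin 3 → ∀ x : M, TangentSpace 𝓘(ℝ, Model n) x} {x : M} {W : Set M}

lemma Structure.g_comm (P : Structure n M) (x : M) (u v : P.H x) : P.g x u v = P.g x v u := by
  obtain ⟨b, hb⟩ := P.exists_orthonormal x
  have h : P.g x = (P.g x).flip := by
    refine b.ext fun a => b.ext fun c => ?_
    change _ = P.g x (b c) (b a)
    rw [hb, hb]
    by_cases hac : a = c
    · rw [hac]
    · rw [if_neg hac, if_neg (Ne.symm hac)]
  conv_lhs => rw [h]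
  rfl

lemma Structure.g_nondegenerate (P : Structure n M) (x : M) {u : P.H x}
    (h : ∀ v, P.g x u v = 0) : u = 0 := by
  obtain ⟨b, hb⟩ := P.exists_orthonormal x
  refine b.ext_elem fun a => ?_
  have h1 := h (b a)
  rw [← b.sum_repr u] at h1
  simp only [map_sum, map_smul, LinearMap.sum_apply, LinearMap.smul_apply, hb, smul_eq_mul,
    mul_ite, mul_zero, Finset.sum_ite_eq', Finset.mem_univ, if_true] at h1
  rcases a with a | a <;> simpa using h1

lemma eps_mul_self (s : Fin 3) : eps s * eps s = 1 := by
  fin_cases s <;> simp [eps]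

lemma eps_ne_zero (s : Fin 3) : eps s ≠ 0 := fun h => by simpa [h] using eps_mul_self s

lemma horizontal_coe (u : P.H x) :
    horizontal C.isCompl x (u : TangentSpace 𝓘(ℝ, Model n) x) = u := by
  simp [horizontal]

lemma coe_horizontal {v : TangentSpace 𝓘(ℝ, Model n) x} (hv : v ∈ P.H x) :
    (horizontal C.isCompl x v : TangentSpace 𝓘(ℝ, Model n) x) = v := by
  have := horizontal_coe (C := C) (⟨v, hv⟩ : P.H x)
  simpa using congrArg Subtype.val this

lemma horizontal_eq_zero {v : TangentSpace 𝓘(ℝ, Model n) x} (hv : v ∈ C.V x) :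
    horizontal C.isCompl x v = 0 := by
  simpa [horizontal] using hv

/-- The vertical component of a tangent vector. -/
def CanonicalConnection.vertical (C : CanonicalConnection P) (x : M) :
    TangentSpace 𝓘(ℝ, Model n) x →ₗ[ℝ] C.V x :=
  (C.V x).projectionOnto (P.H x) (C.isCompl x).symm

lemma coe_vertical {v : TangentSpace 𝓘(ℝ, Model n) x} (hv : v ∈ C.V x) :
    (C.vertical x v : TangentSpace 𝓘(ℝ, Model n) x) = v := by
  simpa [CanonicalConnection.vertical] using
    congrArg Subtype.val ((C.V x).projectionOnto_apply_left (C.isCompl x).symm ⟨v, hv⟩)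

namespace IsReebFrame

variable (hF : IsReebFrame P C.V U η J ξ)
include hF

lemma xi_mem (hx : x ∈ U) (s : Fin 3) : ξ s x ∈ C.V x := by
  rw [hF.span_eq x hx]; exact Submodule.subset_span ⟨s, rfl⟩

lemma eta_coe (hx : x ∈ U) (s : Fin 3) (u : P.H x) : η s x u = 0 :=
  (hF.gauge.mem_iff x hx _).1 u.2 s

lemma sum_eta_smul_xi (hx : x ∈ U) (v : TangentSpace 𝓘(ℝ, Model n) x) :
    v = horizontal C.isCompl x v + ∑ s, η s x v • ξ s x := by
  have h1 : v - ∑ s, η s x v • ξ s x ∈ P.H x := by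
    rw [hF.gauge.mem_iff x hx]
    intro t
    simp [hF.reeb.dual x hx]
  have h2 : ∑ s, η s x v • ξ s x ∈ C.V x :=
    Submodule.sum_mem _ fun s _ => Submodule.smul_mem _ _ (hF.xi_mem hx s)
  have h3 : horizontal C.isCompl x v = horizontal C.isCompl x (v - ∑ s, η s x v • ξ s x) := by
    rw [map_sub, horizontal_eq_zero h2, sub_zero]
  rw [h3, coe_horizontal h1]
  abel

lemma eq_sum_of_mem_V (hx : x ∈ U) {v : TangentSpace 𝓘(ℝ, Model n) x} (hv : v ∈ C.V x) :
    v = ∑ s, η s x v • ξ s x := by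
  have := hF.sum_eta_smul_xi (C := C) hx v
  rw [horizontal_eq_zero hv] at this
  simpa using this

/-- Smoothness of the projection is not assumed; it comes from the formula A - Σ η_s(A) ξ_s in the
Reeb frame. -/
lemma smooth_horizontal (hWU : W ⊆ U) (hW : IsOpen W)
    {A : ∀ x : M, TangentSpace 𝓘(ℝ, Model n) x} (hA : SmoothFieldOn W A) :
    SmoothSectionOn P.H W (fun y => horizontal C.isCompl y (A y)) := by
  refine (hA.sub (SmoothFieldOn.sum (ι := Fin 3) fun s =>
    ((hF.reeb.smooth s).mono hWU).smul (hF.gauge.smooth_form s W hW hWU A hA))).congr fun y hy => ?_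
  exact eq_sub_of_add_eq (hF.sum_eta_smul_xi (C := C) (hWU hy) (A y)).symm

lemma exists_section [T2Space M] (hWU : W ⊆ U) (hW : IsOpen W) (u : P.H x) :
    ∃ X : ∀ x : M, P.H x, SmoothSectionOn P.H W X ∧ X x = u := by
  obtain ⟨A, hA, hAx⟩ := exists_smooth_extension (u : TangentSpace 𝓘(ℝ, Model n) x)
  exact ⟨_, hF.smooth_horizontal (C := C) hWU hW (hA.mono (Set.subset_univ _)), by
    rw [hAx, horizontal_coe]⟩

lemma phi_xi (hx : x ∈ U) (s : Fin 3) : P.phi η J x (ξ s x) = J s x := by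
  simp [Structure.phi, hF.reeb.dual x hx]

lemma smooth_phi (hWU : W ⊆ U) (hW : IsOpen W)
    {D : ∀ x : M, TangentSpace 𝓘(ℝ, Model n) x} (hD : SmoothFieldOn W D)
    {X : ∀ x : M, P.H x} (hX : SmoothSectionOn P.H W X) :
    SmoothSectionOn P.H W (fun y => P.phi η J y (D y) (X y)) := by
  refine (SmoothFieldOn.sum (ι := Fin 3) fun s => SmoothFieldOn.smul
    (hF.gauge.smooth_form s W hW hWU D hD) (hF.gauge.smooth_end s W hW hWU X hX)).congr
    fun y hy => ?_
  simp [Structure.phi, LinearMap.sum_apply]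

/-- The identification of `V` with `PQ` is parallel. -/
lemma horizontal_cov_phi (hWU : W ⊆ U) (hW : IsOpen W)
    {D : ∀ x : M, TangentSpace 𝓘(ℝ, Model n) x} (hD : SmoothFieldOn W D)
    (hDV : ∀ y ∈ W, D y ∈ C.V y)
    {X : ∀ x : M, P.H x} (hX : SmoothSectionOn P.H W X) (hx : x ∈ W)
    (v : TangentSpace 𝓘(ℝ, Model n) x) :
    horizontal C.isCompl x (C.cov (fun y => P.phi η J y (D y) (X y)) x v)
      = P.phi η J x (D x) (horizontal C.isCompl x (C.cov (fun y => X y) x v))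
        + P.phi η J x (C.cov D x v) (X x) := by
  -- The axioms of the connection speak of sections with values in the subspaces V; the projection
  -- `vertical` repackages D as such a section.
  have e : ∀ y ∈ W, (C.vertical y (D y) : TangentSpace 𝓘(ℝ, Model n) y) = D y :=
    fun y hy => coe_vertical (hDV y hy)
  have h1 := C.cov_phi U η J hF.gauge W hW hWU (fun y => C.vertical y (D y)) X
    (SmoothFieldOn.congr hD e) hX x hx v
  have h2 := cov_congr C.cov hW hD (fun y hy => (e y hy).symm) hx
  have h3 := cov_congr C.cov hW (hF.smooth_phi hWU hW hD hX)
    (B := fun y => P.phi η J y (C.vertical y (D y)) (X y)) (fun y hy => by rw [e y hy]) hx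
  rw [h3, h2]
  rw [e x hx, sub_eq_iff_eq_add] at h1
  exact h1.trans (add_comm _ _)

omit hF in
lemma cov_mem_V (hW : IsOpen W) {D : ∀ x : M, TangentSpace 𝓘(ℝ, Model n) x}
    (hD : SmoothFieldOn W D) (hDV : ∀ y ∈ W, D y ∈ C.V y) (hx : x ∈ W)
    (v : TangentSpace 𝓘(ℝ, Model n) x) : C.cov D x v ∈ C.V x := by
  have e : ∀ y ∈ W, (C.vertical y (D y) : TangentSpace 𝓘(ℝ, Model n) y) = D y :=
    fun y hy => coe_vertical (hDV y hy)
  rw [cov_congr C.cov hW hD (fun y hy => (e y hy).symm) hx]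
  exact C.cov_mem_vertical W hW (fun y => C.vertical y (D y)) (SmoothFieldOn.congr hD e) x hx v

/-- Since φ(ξ_s) = J_s and φ is parallel, ∇J_s = φ(∇ξ_s): the same coefficients rotate the units and
the Reeb fields. -/
lemma horizontal_cov_J (hWU : W ⊆ U) (hW : IsOpen W)
    {X : ∀ x : M, P.H x} (hX : SmoothSectionOn P.H W X) (hx : x ∈ W) (s : Fin 3)
    (v : TangentSpace 𝓘(ℝ, Model n) x) :
    horizontal C.isCompl x (C.cov (fun y => J s y (X y)) x v)
      = J s x (horizontal C.isCompl x (C.cov (fun y => X y) x v))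
        + P.phi η J x (C.cov (ξ s) x v) (X x) := by
  have h := hF.horizontal_cov_phi hWU hW ((hF.reeb.smooth s).mono hWU)
    (fun y hy => hF.xi_mem (hWU hy) s) hX hx v
  rw [hF.phi_xi (hWU hx)] at h
  rw [← h, cov_congr C.cov hW (hF.gauge.smooth_end s W hW hWU X hX)
    (B := fun y => P.phi η J y (ξ s y) (X y)) (fun y hy => by rw [hF.phi_xi (hWU hy)]) hx]

end IsReebFrame

end Frame
end PQC

/-! ### Algebra of the units, skewness of the connection coefficients, and the torsion on H. -/

namespace PQC

/-- The pointwise paraquaternionic structure: a nondegenerate metric with compatible imaginary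
units. -/
structure IsUnits {E : Type*} [AddCommGroup E] [Module ℝ E] (g : LinearMap.BilinForm ℝ E)
    (J : Fin 3 → Module.End ℝ E) : Prop where
  symm : ∀ u v, g u v = g v u
  nondeg : ∀ u, (∀ v, g u v = 0) → u = 0
  sq : ∀ s, J s * J s = eps s • (1 : Module.End ℝ E)
  mul01 : J 0 * J 1 = J 2
  mul10 : J 1 * J 0 = -J 2
  skew : ∀ s u v, g (J s u) v = -g u (J s v)

namespace IsUnits
variable {E : Type*} [AddCommGroup E] [Module ℝ E] {g : LinearMap.BilinForm ℝ E}
    {J : Fin 3 → Module.End ℝ E} (hJ : IsUnits g J)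
include hJ

lemma mul00 : J 0 * J 0 = 1 := by simpa [eps] using hJ.sq 0
lemma mul11 : J 1 * J 1 = 1 := by simpa [eps] using hJ.sq 1
lemma mul22 : J 2 * J 2 = -1 := by simpa [eps] using hJ.sq 2
lemma mul02 : J 0 * J 2 = J 1 := by rw [← hJ.mul01, ← mul_assoc, hJ.mul00, one_mul]
lemma mul21 : J 2 * J 1 = J 0 := by rw [← hJ.mul01, mul_assoc, hJ.mul11, mul_one]
lemma mul20 : J 2 * J 0 = -J 1 := by
  rw [← neg_neg (J 2), ← hJ.mul10, neg_mul, mul_assoc, hJ.mul00, mul_one]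
lemma mul12 : J 1 * J 2 = -J 0 := by
  rw [← neg_neg (J 2), ← hJ.mul10, mul_neg, ← mul_assoc, hJ.mul11, one_mul]

lemma anticomm (r s : Fin 3) :
    J r * J s + J s * J r = if r = s then (2 * eps s) • (1 : Module.End ℝ E) else 0 := by
  by_cases h : r = s
  · subst h
    rw [if_pos rfl, hJ.sq, ← two_smul ℝ, smul_smul]
  · rw [if_neg h]
    fin_cases r <;> fin_cases s <;>
      simp [hJ.mul01, hJ.mul10, hJ.mul02, hJ.mul20, hJ.mul12, hJ.mul21] at h ⊢

/-- A family of coefficients of a derivation that preserves the span of the units is skew. -/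
lemma skew_of_derivation [Nontrivial E] {a : Fin 3 → Fin 3 → ℝ}
    (h : ∀ s t, ∑ r, (a r s • (J t * J r + J r * J t) + a r t • (J r * J s + J s * J r)) = 0)
    (r s : Fin 3) : eps r * a r s + eps s * a s r = 0 := by
  have h1 := h s r
  simp only [hJ.anticomm, Finset.sum_add_distrib, smul_ite, smul_zero, Finset.sum_ite_eq,
    Finset.sum_ite_eq', Finset.mem_univ, if_true, smul_smul, ← add_smul] at h1
  have h2 := (smul_eq_zero.1 h1).resolve_right one_ne_zero
  linarith

end IsUnits

section Frame
variable {n : ℕ} {M : Type*} [TopologicalSpace M] [ChartedSpace (Model n) M]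
  [IsManifold 𝓘(ℝ, Model n) ∞ M] {P : Structure n M} {C : CanonicalConnection P}
  {U : Set M} {η : Fin 3 → ∀ x : M, TangentSpace 𝓘(ℝ, Model n) x →L[ℝ] ℝ}
  {J : Fin 3 → ∀ x : M, Module.End ℝ (P.H x)}
  {ξ : Fin 3 → ∀ x : M, TangentSpace 𝓘(ℝ, Model n) x} {x : M} {W : Set M}

lemma IsGauge.isUnits (h : IsGauge P.H P.g P.PQ U η J) (hx : x ∈ U) :
    IsUnits (P.g x) (fun s => J s x) where
  symm := P.g_comm x
  nondeg _ := P.g_nondegenerate x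
  sq := h.sq_eq x hx
  mul01 := h.mul_eq x hx
  mul10 := h.mul_eq_neg x hx
  skew s u v := by
    -- Compatibility applied to (u, J_s v), together with J_s² = ε_s, is skewness of J_s.
    have h1 := h.compatible x hx s u (J s x v)
    have h2 : J s x (J s x v) = eps s • v := congr($(h.sq_eq x hx s) v)
    rw [h2, map_smul, smul_eq_mul] at h1
    have h3 := eps_mul_self s
    linear_combination (eps s) * h1 - (P.g x (J s x u) v + P.g x u (J s x v)) * h3

lemma Structure.nontrivial (P : Structure n M) (hn : 1 ≤ n) (x : M) : Nontrivial (P.H x) := by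
  obtain ⟨b, -⟩ := P.exists_orthonormal x
  exact ⟨b (Sum.inl ⟨0, by omega⟩), 0, b.ne_zero _⟩

/-- The torsion endomorphism `T(v, ·)` of the horizontal space. -/
def CanonicalConnection.torEnd (C : CanonicalConnection P) (x : M)
    (v : TangentSpace 𝓘(ℝ, Model n) x) : Module.End ℝ (P.H x) :=
  horizontal C.isCompl x ∘ₗ (C.cov.torsion x v).toLinearMap ∘ₗ (P.H x).subtype

lemma coe_torEnd {v : TangentSpace 𝓘(ℝ, Model n) x} (hv : v ∈ C.V x) (u : P.H x) :
    (C.torEnd x v u : TangentSpace 𝓘(ℝ, Model n) x) = C.cov.torsion x v u :=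
  coe_horizontal (C.torsion_mem x v hv u)

lemma cov_metric_section {X Y : ∀ x : M, P.H x} (hW : IsOpen W) (hX : SmoothSectionOn P.H W X)
    (hY : SmoothSectionOn P.H W Y) (hx : x ∈ W) (v : TangentSpace 𝓘(ℝ, Model n) x) :
    mvfderiv 𝓘(ℝ, Model n) (fun y => P.g y (X y) (Y y)) x v
        = P.g x (horizontal C.isCompl x (C.cov (fun y => X y) x v)) (Y x)
          + P.g x (X x) (horizontal C.isCompl x (C.cov (fun y => Y y) x v)) :=
  C.cov_metric W hW X Y hX hY x hx v

namespace IsReebFrame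

variable (hF : IsReebFrame P C.V U η J ξ)
include hF

omit hF in
lemma phi_eq (v : TangentSpace 𝓘(ℝ, Model n) x) (u : P.H x) :
    P.phi η J x v u = ∑ s, η s x v • J s x u := by
  simp [Structure.phi, LinearMap.sum_apply]

variable [T2Space M]

omit [T2Space M] in
lemma cov_xi_eq (hx : x ∈ U) (s : Fin 3) (v : TangentSpace 𝓘(ℝ, Model n) x) :
    C.cov (ξ s) x v = ∑ r, η r x (C.cov (ξ s) x v) • ξ r x :=
  hF.eq_sum_of_mem_V (C := C) hx (cov_mem_V hF.gauge.isOpen (hF.reeb.smooth s)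
    (fun _ hy => hF.xi_mem hy s) hx v)

/-- The connection coefficients of the Reeb fields are skew. -/
lemma connection_skew (hn : 1 ≤ n) (hx : x ∈ U) (v : TangentSpace 𝓘(ℝ, Model n) x)
    (r s : Fin 3) :
    eps r * η r x (C.cov (ξ s) x v) + eps s * η s x (C.cov (ξ r) x v) = 0 := by
  have := P.nontrivial hn x
  have hU := hF.gauge.isOpen
  have hu := hF.gauge.isUnits hx
  refine hu.skew_of_derivation (a := fun r s => η r x (C.cov (ξ s) x v)) (fun s t => ?_) r s
  ext1 u
  obtain ⟨X, hX, rfl⟩ := hF.exists_section (C := C) subset_rfl hU u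
  have key : ∀ s t, horizontal C.isCompl x (C.cov (fun y => J t y (J s y (X y))) x v)
      = J t x (J s x (horizontal C.isCompl x (C.cov (fun y => X y) x v)))
        + J t x (P.phi η J x (C.cov (ξ s) x v) (X x))
        + P.phi η J x (C.cov (ξ t) x v) (J s x (X x)) := by
    intro s t
    rw [hF.horizontal_cov_J subset_rfl hU (hF.gauge.smooth_end s U hU subset_rfl X hX) hx,
      hF.horizontal_cov_J subset_rfl hU hX hx, map_add]
  have sm := fun s t => hF.gauge.smooth_end t U hU subset_rfl _
    (hF.gauge.smooth_end s U hU subset_rfl X hX)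
  have key2 := congrArg (fun f => horizontal C.isCompl x (f v)) (cov_add (cov := C.cov)
    ((sm s t).mdifferentiableAt hU hx) ((sm t s).mdifferentiableAt hU hx))
  simp only [add_apply, map_add, key] at key2
  -- The anticommutator of two units is a constant multiple of the identity, so differentiating it
  -- by the Leibniz rule leaves exactly the relation required by `skew_of_derivation`.
  obtain ⟨c, hc⟩ : ∃ c : ℝ, ∀ y ∈ U, ∀ w : P.H y,
      J t y (J s y w) + J s y (J t y w) = c • w := by
    refine ⟨if t = s then 2 * eps s else 0, fun y hy w => ?_⟩
    have := congr($((hF.gauge.isUnits hy).anticomm t s) w)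
    simp only [LinearMap.add_apply, Module.End.mul_apply] at this
    rw [this]; split_ifs <;> simp
  have key3 : horizontal C.isCompl x (C.cov (fun y => (J t y (J s y (X y)) :
      TangentSpace 𝓘(ℝ, Model n) y) + J s y (J t y (X y))) x v)
      = c • horizontal C.isCompl x (C.cov (fun y => X y) x v) := by
    rw [cov_congr C.cov hU ((sm s t).add (sm t s))
      (B := fun y => c • (X y : TangentSpace 𝓘(ℝ, Model n) y))
      (fun y hy => congrArg Subtype.val (hc y hy (X y))) hx,
      cov_const_smul _ (SmoothFieldOn.mdifferentiableAt hX hU hx)]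
    rw [smul_apply, map_smul]
  rw [key3, ← hc x hx] at key2
  simp only [phi_eq, map_sum, map_smul] at key2
  simp only [LinearMap.sum_apply, LinearMap.add_apply, LinearMap.smul_apply, Module.End.mul_apply,
    Finset.sum_add_distrib, smul_add, LinearMap.zero_apply]
  rw [← sub_eq_zero, ← neg_eq_zero] at key2
  rw [← key2]
  abel

/-- The forms η_s vanish on H, so dη_s(X,Y) = -η_s([X,Y]) there; the contact condition identifies
the vertical part of the bracket. -/
lemma torsion_horizontal (hx : x ∈ U) (u v : P.H x) :
    C.cov.torsion x u v = ∑ s, (-2 * eps s * P.g x (J s x u) v) • ξ s x := by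
  have hU := hF.gauge.isOpen
  obtain ⟨X, hX, rfl⟩ := hF.exists_section (C := C) subset_rfl hU u
  obtain ⟨Y, hY, rfl⟩ := hF.exists_section (C := C) subset_rfl hU v
  rw [C.torsion_horizontal U hU X Y hX hY x hx]
  have h0 := hF.eq_sum_of_mem_V (C := C) hx (C.vertical x (VectorField.mlieBracket
    𝓘(ℝ, Model n) (fun y => (X y : TangentSpace 𝓘(ℝ, Model n) y)) (fun y => Y y) x)).2
  have h1 : ∀ w : TangentSpace 𝓘(ℝ, Model n) x, ∀ s, η s x (C.vertical x w) = η s x w := by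
    intro w s
    conv_rhs => rw [hF.sum_eta_smul_xi (C := C) hx w]
    have h2 : C.vertical x w = C.vertical x (∑ s, η s x w • ξ s x) := by
      conv_lhs => rw [hF.sum_eta_smul_xi (C := C) hx w, map_add]
      rw [add_eq_right]
      simp [CanonicalConnection.vertical]
    rw [h2, coe_vertical (Submodule.sum_mem _ fun s _ => Submodule.smul_mem _ _ (hF.xi_mem hx s)),
      map_add, hF.eta_coe hx, zero_add]
  change -(C.vertical x _ : TangentSpace 𝓘(ℝ, Model n) x) = _
  rw [h0, ← Finset.sum_neg_distrib]
  refine Finset.sum_congr rfl fun s _ => ?_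
  rw [h1, ← neg_smul]
  congr 1
  rw [hF.gauge.contact s U hU subset_rfl X Y hX hY x hx, dOneForm,
    mvfderiv_congr_on hU (g := fun _ => 0) (fun y hy => hF.eta_coe hy s (Y y)) hx,
    mvfderiv_congr_on hU (g := fun _ => 0) (fun y hy => hF.eta_coe hy s (X y)) hx, mvfderiv_const]
  simp

end IsReebFrame
end Frame
end PQC

/-! ### The curvature as an endomorphism of H. -/

namespace PQC
section Curv
variable {n : ℕ} {M : Type*} [TopologicalSpace M] [ChartedSpace (Model n) M]
  [IsManifold 𝓘(ℝ, Model n) ∞ M] {P : Structure n M} {C : CanonicalConnection P}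
  {U : Set M} {η : Fin 3 → ∀ x : M, TangentSpace 𝓘(ℝ, Model n) x →L[ℝ] ℝ}
  {J : Fin 3 → ∀ x : M, Module.End ℝ (P.H x)}
  {ξ : Fin 3 → ∀ x : M, TangentSpace 𝓘(ℝ, Model n) x} {x : M} {W : Set M}
  {A B D : ∀ x : M, TangentSpace 𝓘(ℝ, Model n) x} {X Y : ∀ x : M, P.H x}

omit [IsManifold 𝓘(ℝ, Model n) ∞ M] in
lemma mvfderiv_add {f g : M → ℝ} (hW : IsOpen W) (hf : SmoothFunOn (n := n) W f)
    (hg : SmoothFunOn (n := n) W g) (hx : x ∈ W) (v : TangentSpace 𝓘(ℝ, Model n) x) :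
    mvfderiv 𝓘(ℝ, Model n) (fun y => f y + g y) x v
      = mvfderiv 𝓘(ℝ, Model n) f x v + mvfderiv 𝓘(ℝ, Model n) g x v := by
  have := (hf.mdifferentiableAt hW hx).hasMFDerivAt.add (hg.mdifferentiableAt hW hx).hasMFDerivAt
  have h2 := this.mfderiv
  exact congr($h2 v)

omit [IsManifold 𝓘(ℝ, Model n) ∞ M] in
lemma mvfderiv_const_mul {f : M → ℝ} (c : ℝ) (hW : IsOpen W) (hf : SmoothFunOn (n := n) W f)
    (hx : x ∈ W) (v : TangentSpace 𝓘(ℝ, Model n) x) :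
    mvfderiv 𝓘(ℝ, Model n) (fun y => c * f y) x v = c * mvfderiv 𝓘(ℝ, Model n) f x v := by
  have := (hf.mdifferentiableAt hW hx).hasMFDerivAt.const_smul c
  have h2 := this.mfderiv
  exact congr($h2 v)

lemma coe_horizontal_cov (hW : IsOpen W) (hX : SmoothSectionOn P.H W X) (hx : x ∈ W)
    (v : TangentSpace 𝓘(ℝ, Model n) x) :
    (horizontal C.isCompl x (C.cov (fun y => X y) x v) : TangentSpace 𝓘(ℝ, Model n) x)
      = C.cov (fun y => X y) x v :=
  coe_horizontal (C.cov_mem_horizontal W hW X hX x hx v)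

variable [T2Space M]

lemma smooth_horizontal_cov (hW : IsOpen W) (hX : SmoothSectionOn P.H W X)
    (hA : SmoothFieldOn W A) :
    SmoothSectionOn P.H W (fun y => horizontal C.isCompl y (C.cov (fun z => X z) y (A y))) :=
  (SmoothFieldOn.covariant C.cov C.smooth hW hX hA).congr
    fun _ hy => coe_horizontal_cov hW hX hy _

lemma cov_cov_section (hW : IsOpen W) (hX : SmoothSectionOn P.H W X)
    (hA : SmoothFieldOn W A) (hx : x ∈ W) (v : TangentSpace 𝓘(ℝ, Model n) x) :
    C.cov (fun y => C.cov (fun z => X z) y (A y)) x v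
      = C.cov (fun y => horizontal C.isCompl y (C.cov (fun z => X z) y (A y))) x v := by
  rw [cov_congr C.cov hW (SmoothFieldOn.covariant C.cov C.smooth hW hX hA)
    (fun y hy => (coe_horizontal_cov hW hX hy _).symm) hx]

lemma curvatureField_mem_H (hW : IsOpen W) (hA : SmoothFieldOn W A) (hB : SmoothFieldOn W B)
    (hX : SmoothSectionOn P.H W X) (hx : x ∈ W) :
    curvatureField C.cov A B (fun y => X y) x ∈ P.H x := by
  unfold curvatureField
  rw [cov_cov_section hW hX hA hx, cov_cov_section hW hX hB hx]
  exact sub_mem (sub_mem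
    (C.cov_mem_horizontal W hW _ (smooth_horizontal_cov hW hX hB) x hx _)
    (C.cov_mem_horizontal W hW _ (smooth_horizontal_cov hW hX hA) x hx _))
    (C.cov_mem_horizontal W hW X hX x hx _)

lemma curvatureField_mem_V (hW : IsOpen W) (hA : SmoothFieldOn W A) (hB : SmoothFieldOn W B)
    (hD : SmoothFieldOn W D) (hDV : ∀ y ∈ W, D y ∈ C.V y) (hx : x ∈ W) :
    curvatureField C.cov A B D x ∈ C.V x := by
  unfold curvatureField
  have h1 : ∀ y ∈ W, ∀ v, C.cov D y v ∈ C.V y := fun y hy v =>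
    IsReebFrame.cov_mem_V hW hD hDV hy v
  exact sub_mem (sub_mem
    (IsReebFrame.cov_mem_V hW (hD.covariant C.cov C.smooth hW hB) (fun y hy => h1 y hy _) hx _)
    (IsReebFrame.cov_mem_V hW (hD.covariant C.cov C.smooth hW hA) (fun y hy => h1 y hy _) hx _))
    (h1 x hx _)

/-- The curvature of the canonical connection as an endomorphism of `H`. -/
def CanonicalConnection.curvEnd (C : CanonicalConnection P) (x : M)
    (u v : TangentSpace 𝓘(ℝ, Model n) x) : Module.End ℝ (P.H x) where
  toFun w := horizontal C.isCompl x (curvature C.cov x u v w)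
  map_add' w w' := by rw [Submodule.coe_add, curvature_add_right C.smooth, map_add]
  map_smul' c w := by
    rw [Submodule.coe_smul, curvature_smul_right C.smooth, map_smul, RingHom.id_apply]

lemma curvEnd_apply (u v : TangentSpace 𝓘(ℝ, Model n) x) (w : P.H x) :
    C.curvEnd x u v w = horizontal C.isCompl x (curvature C.cov x u v w) := rfl

lemma curvEnd_section (hW : IsOpen W) (hA : SmoothFieldOn W A) (hB : SmoothFieldOn W B)
    (hX : SmoothSectionOn P.H W X) (hx : x ∈ W) :
    C.curvEnd x (A x) (B x) (X x)
      = horizontal C.isCompl x (curvatureField C.cov A B (fun y => X y) x) := by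
  rw [curvEnd_apply, curvature_apply C.smooth hW hA hB hX hx]

lemma curvEnd_section' (hW : IsOpen W) (hA : SmoothFieldOn W A) (hB : SmoothFieldOn W B)
    (hX : SmoothSectionOn P.H W X) (hx : x ∈ W) :
    C.curvEnd x (A x) (B x) (X x)
      = horizontal C.isCompl x (C.cov (fun y => horizontal C.isCompl y
          (C.cov (fun z => X z) y (B y))) x (A x))
        - horizontal C.isCompl x (C.cov (fun y => horizontal C.isCompl y
          (C.cov (fun z => X z) y (A y))) x (B x))
        - horizontal C.isCompl x (C.cov (fun y => X y) x
          (VectorField.mlieBracket 𝓘(ℝ, Model n) A B x)) := by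
  rw [curvEnd_section hW hA hB hX hx, curvatureField, cov_cov_section hW hX hA hx,
    cov_cov_section hW hX hB hx, map_sub, map_sub]

/-- The curvature of a metric connection is skew. -/
lemma curvEnd_skew_field (hW : IsOpen W) (hA : SmoothFieldOn W A) (hB : SmoothFieldOn W B)
    (hX : SmoothSectionOn P.H W X) (hY : SmoothSectionOn P.H W Y) (hx : x ∈ W) :
    P.g x (C.curvEnd x (A x) (B x) (X x)) (Y x)
      = - P.g x (X x) (C.curvEnd x (A x) (B x) (Y x)) := by
  have key : ∀ {A B : ∀ x : M, TangentSpace 𝓘(ℝ, Model n) x}, SmoothFieldOn W A →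
      SmoothFieldOn W B →
      mvfderiv 𝓘(ℝ, Model n) (fun y => mvfderiv 𝓘(ℝ, Model n)
        (fun z => P.g z (X z) (Y z)) y (B y)) x (A x)
      = P.g x (horizontal C.isCompl x (C.cov (fun y => horizontal C.isCompl y
          (C.cov (fun z => X z) y (B y))) x (A x))) (Y x)
        + P.g x (horizontal C.isCompl x (C.cov (fun y => X y) x (B x)))
          (horizontal C.isCompl x (C.cov (fun y => Y y) x (A x)))
        + (P.g x (horizontal C.isCompl x (C.cov (fun y => X y) x (A x)))
          (horizontal C.isCompl x (C.cov (fun y => Y y) x (B x)))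
        + P.g x (X x) (horizontal C.isCompl x (C.cov (fun y => horizontal C.isCompl y
          (C.cov (fun z => Y z) y (B y))) x (A x)))) := by
    intro A B hA hB
    have hX' := smooth_horizontal_cov (C := C) hW hX hB
    have hY' := smooth_horizontal_cov (C := C) hW hY hB
    rw [mvfderiv_congr_on hW (fun y hy => cov_metric_section (C := C) hW hX hY hy (B y)) hx,
      mvfderiv_add hW (P.smooth_metric W hW _ _ hX' hY) (P.smooth_metric W hW _ _ hX hY') hx,
      cov_metric_section hW hX' hY hx, cov_metric_section hW hX hY' hx]
  -- The mixed terms g(∇_A X, ∇_B Y) + g(∇_B X, ∇_A Y) are symmetric in A and B, so the commutator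
  -- of the second derivatives of g(X,Y) contains the curvature terms only.
  have h := mvfderiv_mlieBracket hW (P.smooth_metric W hW _ _ hX hY) hA hB hx
  rw [key hA hB, key hB hA, cov_metric_section (C := C) hW hX hY hx] at h
  rw [curvEnd_section' hW hA hB hX hx, curvEnd_section' hW hA hB hY hx]
  simp only [map_sub, LinearMap.sub_apply]
  linarith

namespace IsReebFrame

variable (hF : IsReebFrame P C.V U η J ξ)
include hF

lemma curvEnd_skew (hx : x ∈ U) (u v : TangentSpace 𝓘(ℝ, Model n) x) (a b : P.H x) :
    P.g x (C.curvEnd x u v a) b = - P.g x a (C.curvEnd x u v b) := by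
  have hU := hF.gauge.isOpen
  obtain ⟨A, hA, rfl⟩ := exists_smooth_extension u
  obtain ⟨B, hB, rfl⟩ := exists_smooth_extension v
  obtain ⟨X, hX, rfl⟩ := hF.exists_section (C := C) subset_rfl hU a
  obtain ⟨Y, hY, rfl⟩ := hF.exists_section (C := C) subset_rfl hU b
  exact curvEnd_skew_field hU (hA.mono (Set.subset_univ _)) (hB.mono (Set.subset_univ _)) hX hY hx

lemma coe_curvEnd (hx : x ∈ U) (u v : TangentSpace 𝓘(ℝ, Model n) x) (a : P.H x) :
    (C.curvEnd x u v a : TangentSpace 𝓘(ℝ, Model n) x) = curvature C.cov x u v a := by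
  have hU := hF.gauge.isOpen
  obtain ⟨A, hA, rfl⟩ := exists_smooth_extension u
  obtain ⟨B, hB, rfl⟩ := exists_smooth_extension v
  obtain ⟨X, hX, rfl⟩ := hF.exists_section (C := C) subset_rfl hU a
  replace hA := hA.mono (Set.subset_univ U)
  replace hB := hB.mono (Set.subset_univ U)
  rw [curvEnd_section hU hA hB hX hx, curvature_apply C.smooth hU hA hB hX hx]
  exact coe_horizontal (curvatureField_mem_H hU hA hB hX hx)

lemma curvature_xi_mem_V (hx : x ∈ U) (u v : TangentSpace 𝓘(ℝ, Model n) x) (s : Fin 3) :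
    curvature C.cov x u v (ξ s x) ∈ C.V x := by
  have hU := hF.gauge.isOpen
  obtain ⟨A, hA, rfl⟩ := exists_smooth_extension u
  obtain ⟨B, hB, rfl⟩ := exists_smooth_extension v
  replace hA := hA.mono (Set.subset_univ U)
  replace hB := hB.mono (Set.subset_univ U)
  rw [curvature_apply C.smooth hU hA hB (hF.reeb.smooth s) hx]
  exact curvatureField_mem_V hU hA hB (hF.reeb.smooth s) (fun y hy => hF.xi_mem hy s) hx

omit hF [T2Space M] in
lemma phi_sub (u v : TangentSpace 𝓘(ℝ, Model n) x) : P.phi η J x (u - v)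
    = P.phi η J x u - P.phi η J x v := by
  rw [Structure.phi, Structure.phi, Structure.phi, ← Finset.sum_sub_distrib]
  exact Finset.sum_congr rfl fun s _ => by rw [map_sub]; exact sub_smul (η s x u) (η s x v) (J s x)

set_option maxHeartbeats 1000000 in
-- This is ∇φ = 0 differentiated once more: the commutator of R(u,v) with J_s is φ(R(u,v)ξ_s). Terms
-- with one derivative on ξ_s and one on X are symmetric and cancel.
lemma curvEnd_J (hx : x ∈ U) (u v : TangentSpace 𝓘(ℝ, Model n) x) (s : Fin 3) (a : P.H x) :
    C.curvEnd x u v (J s x a) = J s x (C.curvEnd x u v a)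
      + ∑ r, η r x (curvature C.cov x u v (ξ s x)) • J r x a := by
  have hU := hF.gauge.isOpen
  obtain ⟨A, hA, rfl⟩ := exists_smooth_extension u
  obtain ⟨B, hB, rfl⟩ := exists_smooth_extension v
  obtain ⟨X, hX, rfl⟩ := hF.exists_section (C := C) subset_rfl hU a
  replace hA := hA.mono (Set.subset_univ U)
  replace hB := hB.mono (Set.subset_univ U)
  have hJX := hF.gauge.smooth_end s U hU subset_rfl X hX
  have hξ := hF.reeb.smooth s
  have hV : ∀ y ∈ U, ξ s y ∈ C.V y := fun y hy => hF.xi_mem hy s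
  have key : ∀ {A B : ∀ x : M, TangentSpace 𝓘(ℝ, Model n) x}, SmoothFieldOn U A →
      SmoothFieldOn U B →
      horizontal C.isCompl x (C.cov (fun y => horizontal C.isCompl y
          (C.cov (fun z => J s z (X z)) y (B y))) x (A x))
      = J s x (horizontal C.isCompl x (C.cov (fun y => horizontal C.isCompl y
          (C.cov (fun z => X z) y (B y))) x (A x)))
        + P.phi η J x (C.cov (ξ s) x (A x)) (horizontal C.isCompl x (C.cov (fun z => X z) x (B x)))
        + (P.phi η J x (C.cov (ξ s) x (B x)) (horizontal C.isCompl x (C.cov (fun z => X z) x (A x)))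
        + P.phi η J x (C.cov (fun y => C.cov (ξ s) y (B y)) x (A x)) (X x)) := by
    intro A B hA hB
    have hX' := smooth_horizontal_cov (C := C) hU hX hB
    have hξ' := hξ.covariant C.cov C.smooth hU hB
    have e1 := hF.gauge.smooth_end s U hU subset_rfl _ hX'
    have e2 := hF.smooth_phi subset_rfl hU hξ' hX
    rw [cov_congr C.cov hU (smooth_horizontal_cov (C := C) hU hJX hB)
      (B := fun y => (J s y (horizontal C.isCompl y (C.cov (fun z => X z) y (B y))) :
          TangentSpace 𝓘(ℝ, Model n) y)
          + (P.phi η J y (C.cov (ξ s) y (B y)) (X y) : TangentSpace 𝓘(ℝ, Model n) y))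
      (fun y hy => congrArg Subtype.val (hF.horizontal_cov_J subset_rfl hU hX hy s (B y))) hx,
      cov_add (SmoothFieldOn.mdifferentiableAt e1 hU hx)
        (SmoothFieldOn.mdifferentiableAt e2 hU hx), add_apply, map_add,
      hF.horizontal_cov_J subset_rfl hU hX' hx,
      hF.horizontal_cov_phi subset_rfl hU hξ' (fun y hy => cov_mem_V hU hξ hV hy _) hX hx]
  rw [curvEnd_section' hU hA hB hX hx, curvEnd_section' hU hA hB hJX hx, key hA hB, key hB hA,
    hF.horizontal_cov_J subset_rfl hU hX hx,
    ← phi_eq (η := η) (J := J) (curvature C.cov x (A x) (B x) (ξ s x)) (X x),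
    curvature_apply C.smooth hU hA hB hξ hx, curvatureField, phi_sub, phi_sub]
  simp only [map_sub, LinearMap.sub_apply]
  abel

/-- The curvature coefficients of the Reeb fields are skew. -/
lemma curvature_xi_skew (hn : 1 ≤ n) (hx : x ∈ U) (u v : TangentSpace 𝓘(ℝ, Model n) x)
    (r s : Fin 3) :
    eps r * η r x (curvature C.cov x u v (ξ s x))
      + eps s * η s x (curvature C.cov x u v (ξ r x)) = 0 := by
  have := P.nontrivial hn x
  have hu := hF.gauge.isUnits hx
  refine hu.skew_of_derivation (a := fun r s => η r x (curvature C.cov x u v (ξ s x)))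
    (fun s t => ?_) r s
  ext1 a
  have h1 : ∀ s t, C.curvEnd x u v (J t x (J s x a)) = J t x (J s x (C.curvEnd x u v a))
      + J t x (∑ r, η r x (curvature C.cov x u v (ξ s x)) • J r x a)
      + ∑ r, η r x (curvature C.cov x u v (ξ t x)) • J r x (J s x a) := by
    intro s t
    rw [hF.curvEnd_J hx, hF.curvEnd_J hx, map_add]
  obtain ⟨c, hc⟩ : ∃ c : ℝ, ∀ w : P.H x, J t x (J s x w) + J s x (J t x w) = c • w := by
    refine ⟨if t = s then 2 * eps s else 0, fun w => ?_⟩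
    have := congr($(hu.anticomm t s) w)
    simp only [LinearMap.add_apply, Module.End.mul_apply] at this
    rw [this]; split_ifs <;> simp
  -- R(u,v) acts on the units as a derivation and commutes with scalars; applied to the
  -- anticommutator it gives the hypothesis of `skew_of_derivation`.
  have h2 := congrArg (C.curvEnd x u v) (hc a)
  rw [map_add, map_smul, ← hc, h1, h1] at h2
  simp only [map_sum, map_smul] at h2
  simp only [LinearMap.sum_apply, LinearMap.add_apply, LinearMap.smul_apply, Module.End.mul_apply,
    Finset.sum_add_distrib, smul_add, LinearMap.zero_apply]
  rw [← sub_eq_zero] at h2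
  rw [← h2]
  abel

end IsReebFrame
end Curv
end PQC

/-! ### The first Bianchi identity of the canonical connection. -/

namespace PQC
section Bianchi
variable {n : ℕ} {M : Type*} [TopologicalSpace M] [ChartedSpace (Model n) M]
  [IsManifold 𝓘(ℝ, Model n) ∞ M] {P : Structure n M} {C : CanonicalConnection P}
  {U : Set M} {η : Fin 3 → ∀ x : M, TangentSpace 𝓘(ℝ, Model n) x →L[ℝ] ℝ}
  {J : Fin 3 → ∀ x : M, Module.End ℝ (P.H x)}
  {ξ : Fin 3 → ∀ x : M, TangentSpace 𝓘(ℝ, Model n) x} {x : M} {W : Set M}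
  {A B D : ∀ x : M, TangentSpace 𝓘(ℝ, Model n) x} {X Y Z : ∀ x : M, P.H x}

lemma torsion_swap {n : ℕ} {M : Type*} [TopologicalSpace M] [ChartedSpace (Model n) M]
    [IsManifold 𝓘(ℝ, Model n) ∞ M] [T2Space M]
    {cov : CovariantDerivative 𝓘(ℝ, Model n) (Model n)
      (TangentSpace 𝓘(ℝ, Model n) : M → Type _)} {x : M}
    (u v : TangentSpace 𝓘(ℝ, Model n) x) : cov.torsion x u v = - cov.torsion x v u := by
  obtain ⟨A, hA, rfl⟩ := exists_smooth_extension u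
  obtain ⟨B, hB, rfl⟩ := exists_smooth_extension v
  rw [torsion_field isOpen_univ hA hB (Set.mem_univ _),
    torsion_field isOpen_univ hB hA (Set.mem_univ _),
    VectorField.mlieBracket_swap_apply (V := A) (W := B)]
  abel

lemma first_bianchi {n : ℕ} {M : Type*} [TopologicalSpace M] [ChartedSpace (Model n) M]
    [IsManifold 𝓘(ℝ, Model n) ∞ M] [T2Space M]
    {cov : CovariantDerivative 𝓘(ℝ, Model n) (Model n)
      (TangentSpace 𝓘(ℝ, Model n) : M → Type _)} (hc : cov.ContMDiffCovariantDerivative ∞)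
    {x : M} {W : Set M} {A B C : ∀ x : M, TangentSpace 𝓘(ℝ, Model n) x} (hW : IsOpen W)
    (hA : SmoothFieldOn W A) (hB : SmoothFieldOn W B) (hC : SmoothFieldOn W C) (hx : x ∈ W) :
    curvature cov x (A x) (B x) (C x) + curvature cov x (B x) (C x) (A x)
        + curvature cov x (C x) (A x) (B x)
      = (covTorsion cov A B C x + cov.torsion x (cov.torsion x (A x) (B x)) (C x))
        + (covTorsion cov B C A x + cov.torsion x (cov.torsion x (B x) (C x)) (A x))
        + (covTorsion cov C A B x + cov.torsion x (cov.torsion x (C x) (A x)) (B x)) := by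
  rw [← first_bianchi_field hc hW hA hB hC hx, curvature_apply hc hW hA hB hC hx,
    curvature_apply hc hW hB hC hA hx, curvature_apply hc hW hC hA hB hx]

variable [T2Space M]

lemma curvEnd_swap (u v : TangentSpace 𝓘(ℝ, Model n) x) :
    C.curvEnd x u v = - C.curvEnd x v u := by
  ext1 a
  rw [LinearMap.neg_apply, curvEnd_apply, curvEnd_apply, curvature_swap C.smooth, map_neg]

lemma torsion_mem_H {v : TangentSpace 𝓘(ℝ, Model n) x} (hv : v ∈ C.V x)
    {u : TangentSpace 𝓘(ℝ, Model n) x} (hu : u ∈ P.H x) : C.cov.torsion x u v ∈ P.H x := by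
  rw [torsion_swap]
  exact neg_mem (C.torsion_mem x v hv ⟨u, hu⟩)

namespace IsReebFrame

variable (hF : IsReebFrame P C.V U η J ξ)
include hF

/-- The horizontal torsion is parallel. -/
lemma covTorsion_horizontal (hn : 1 ≤ n)
    (hX : SmoothSectionOn P.H U X) (hY : SmoothSectionOn P.H U Y) (hx : x ∈ U) :
    covTorsion C.cov A (fun y => X y) (fun y => Y y) x = 0 := by
  have hU := hF.gauge.isOpen
  have hJX := fun s => hF.gauge.smooth_end s U hU subset_rfl X hX
  have hg : ∀ s, SmoothFunOn (n := n) U (fun y => P.g y (J s y (X y)) (Y y)) := fun s =>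
    P.smooth_metric U hU _ _ (hJX s) hY
  have hc : ∀ s, SmoothFunOn (n := n) U (fun y => -2 * eps s * P.g y (J s y (X y)) (Y y)) :=
    fun s => ContMDiffOn.mul contMDiffOn_const (hg s)
  have hs : ∀ s, SmoothFieldOn U (fun y => (-2 * eps s * P.g y (J s y (X y)) (Y y)) • ξ s y) :=
    fun s => (hF.reeb.smooth s).smul (hc s)
  have hd : ∀ s, mvfderiv 𝓘(ℝ, Model n) (fun y => -2 * eps s * P.g y (J s y (X y)) (Y y)) x (A x)
      = -2 * eps s * (P.g x (J s x (horizontal C.isCompl x (C.cov (fun y => X y) x (A x)))) (Y x)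
        + ∑ r, η r x (C.cov (ξ s) x (A x)) * P.g x (J r x (X x)) (Y x)
        + P.g x (J s x (X x)) (horizontal C.isCompl x (C.cov (fun y => Y y) x (A x)))) := by
    intro s
    rw [mvfderiv_const_mul _ hU (hg s) hx, cov_metric_section (C := C) hU (hJX s) hY hx,
      hF.horizontal_cov_J subset_rfl hU hX hx, phi_eq]
    simp only [map_add, LinearMap.add_apply, map_sum, LinearMap.sum_apply, map_smul,
      LinearMap.smul_apply, smul_eq_mul]
  unfold covTorsion
  rw [cov_congr C.cov hU (SmoothFieldOn.torsion C.smooth hU hX hY)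
    (fun y hy => hF.torsion_horizontal hy (X y) (Y y)) hx, cov_sum hU hs hx,
    ← coe_horizontal_cov hU hX hx, ← coe_horizontal_cov hU hY hx,
    hF.torsion_horizontal hx, hF.torsion_horizontal hx, sum_apply]
  simp only [cov_smul ((hc _).mdifferentiableAt hU hx)
    ((hF.reeb.smooth _).mdifferentiableAt hU hx), hd]
  have hα := hF.connection_skew hn hx (A x)
  have hξ := fun s => hF.cov_xi_eq hx s (A x)
  obtain ⟨a, ha⟩ : ∃ a : Fin 3 → Fin 3 → ℝ, ∀ r s, η r x (C.cov (ξ s) x (A x)) = a r s :=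
    ⟨_, fun _ _ => rfl⟩
  simp only [ha] at hα hξ
  simp only [ha]
  simp only [hξ]
  -- What remains is the invariance of Σ ε_s ω_s ⊗ ξ_s under ε-skew rotations. Skewness leaves three
  -- free coefficients, and the sum is checked with them.
  have h00 : a 0 0 = 0 := by have := hα 0 0; simp [eps] at this; linarith
  have h11 : a 1 1 = 0 := by have := hα 1 1; simp [eps] at this; linarith
  have h22 : a 2 2 = 0 := by have := hα 2 2; simp [eps] at this; linarith
  have h10 : a 1 0 = - a 0 1 := by have := hα 1 0; simp [eps] at this; linarith
  have h20 : a 2 0 = a 0 2 := by have := hα 2 0; simp [eps] at this; linarith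
  have h21 : a 2 1 = a 1 2 := by have := hα 2 1; simp [eps] at this; linarith
  simp only [Fin.sum_univ_three, h00, h11, h22, h10, h20, h21]
  simp only [eps, Matrix.cons_val_zero, Matrix.cons_val_one, Matrix.cons_val]
  module

lemma torsion_torsion_horizontal (hx : x ∈ U) (u v : P.H x) (w : TangentSpace 𝓘(ℝ, Model n) x) :
    C.cov.torsion x (C.cov.torsion x u v) w
      = ∑ s, (-2 * eps s * P.g x (J s x u) v) • C.cov.torsion x (ξ s x) w := by
  rw [hF.torsion_horizontal hx, map_sum, sum_apply]
  simp

/-- The first Bianchi identity on `H`. -/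
lemma bianchi_horizontal (hn : 1 ≤ n) (hx : x ∈ U) (u v w : P.H x) :
    C.curvEnd x u v w + C.curvEnd x v w u + C.curvEnd x w u v
      = ∑ s, ((-2 * eps s * P.g x (J s x u) v) • C.torEnd x (ξ s x) w
        + (-2 * eps s * P.g x (J s x v) w) • C.torEnd x (ξ s x) u
        + (-2 * eps s * P.g x (J s x w) u) • C.torEnd x (ξ s x) v) := by
  have hU := hF.gauge.isOpen
  obtain ⟨X, hX, rfl⟩ := hF.exists_section (C := C) subset_rfl hU u
  obtain ⟨Y, hY, rfl⟩ := hF.exists_section (C := C) subset_rfl hU v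
  obtain ⟨Z, hZ, rfl⟩ := hF.exists_section (C := C) subset_rfl hU w
  have h := first_bianchi C.smooth hU hX hY hZ hx
  rw [hF.covTorsion_horizontal hn hY hZ hx, hF.covTorsion_horizontal hn hZ hX hx,
    hF.covTorsion_horizontal hn hX hY hx, hF.torsion_torsion_horizontal hx,
    hF.torsion_torsion_horizontal hx, hF.torsion_torsion_horizontal hx] at h
  refine Subtype.ext ?_
  simp only [Submodule.coe_add, hF.coe_curvEnd hx, AddSubmonoidClass.coe_finsetSum,
    Submodule.coe_smul, coe_torEnd (hF.xi_mem hx _)]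
  rw [h, Finset.sum_add_distrib, Finset.sum_add_distrib]
  abel

set_option maxHeartbeats 1000000 in
/-- The first Bianchi identity with one Reeb field. -/
lemma bianchi_mixed (hn : 1 ≤ n) (hx : x ∈ U) (u v : P.H x) (s : Fin 3) :
    ∃ q : P.H x, (C.TorsionEndVanish → q = 0) ∧
    curvature C.cov x u v (ξ s x) + C.curvEnd x v (ξ s x) u + C.curvEnd x (ξ s x) u v
      = (q : TangentSpace 𝓘(ℝ, Model n) x)
        + ∑ t, (-2 * eps t * P.g x (J t x u) v) • C.cov.torsion x (ξ t x) (ξ s x)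
        + ∑ t, (-2 * eps t * (P.g x (J t x (C.torEnd x (ξ s x) u)) v
            + P.g x (J t x u) (C.torEnd x (ξ s x) v))) • ξ t x := by
  have hU := hF.gauge.isOpen
  obtain ⟨X, hX, rfl⟩ := hF.exists_section (C := C) subset_rfl hU u
  obtain ⟨Y, hY, rfl⟩ := hF.exists_section (C := C) subset_rfl hU v
  have hξ := hF.reeb.smooth s
  have hV : ∀ y ∈ U, ξ s y ∈ C.V y := fun y hy => hF.xi_mem hy s
  have h := first_bianchi C.smooth hU hX hY hξ hx
  -- T maps H × V into H and ∇ preserves H and V, so ∇T with one horizontal and one vertical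
  -- argument stays horizontal.
  have hm1 : ∀ {X Y : ∀ x : M, P.H x}, SmoothSectionOn P.H U X → SmoothSectionOn P.H U Y →
      covTorsion C.cov (fun y => X y) (fun y => Y y) (ξ s) x ∈ P.H x ∧
      (C.TorsionEndVanish → covTorsion C.cov (fun y => X y) (fun y => Y y) (ξ s) x = 0) := by
    intro X Y hX hY
    have hT : ∀ y ∈ U, (horizontal C.isCompl y (C.cov.torsion y (Y y) (ξ s y)) :
        TangentSpace 𝓘(ℝ, Model n) y) = C.cov.torsion y (Y y) (ξ s y) := fun y hy =>
      coe_horizontal (torsion_mem_H (hV y hy) (Y y).2)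
    have hTs : SmoothSectionOn P.H U (fun y => horizontal C.isCompl y
        (C.cov.torsion y (Y y) (ξ s y))) :=
      (SmoothFieldOn.torsion C.smooth hU hY hξ).congr hT
    unfold covTorsion
    rw [← cov_congr C.cov hU hTs hT hx]
    refine ⟨sub_mem (sub_mem (C.cov_mem_horizontal U hU _ hTs x hx _)
      (torsion_mem_H (hV x hx) (C.cov_mem_horizontal U hU _ hY x hx _)))
      (torsion_mem_H (cov_mem_V hU hξ hV hx _) (Y x).2), fun h0 => ?_⟩
    rw [cov_congr C.cov hU hTs (B := fun _ => 0) (fun y hy => by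
      rw [hT y hy, torsion_swap, h0 y _ (hV y hy) _ (Y y).2, neg_zero]) hx, cov_zero,
      torsion_swap, h0 x _ (hV x hx) _ (C.cov_mem_horizontal U hU _ hY x hx _),
      torsion_swap, h0 x _ (cov_mem_V hU hξ hV hx _) _ (Y x).2]
    simp
  have hsw : covTorsion C.cov (fun y => Y y) (ξ s) (fun y => X y) x
      = - covTorsion C.cov (fun y => Y y) (fun y => X y) (ξ s) x := by
    unfold covTorsion
    rw [cov_congr C.cov hU (SmoothFieldOn.torsion C.smooth hU hξ hX)
      (B := fun y => (-1 : ℝ) • C.cov.torsion y (X y) (ξ s y))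
      (fun y _ => by rw [torsion_swap, neg_one_smul]) hx, cov_const_smul _
      ((SmoothFieldOn.torsion C.smooth hU hX hξ).mdifferentiableAt hU hx), torsion_swap (ξ s x),
      torsion_swap (C.cov (ξ s) x (Y x))]
    simp only [smul_apply]
    module
  rw [hsw, hF.covTorsion_horizontal hn hX hY hx, hF.torsion_torsion_horizontal hx,
    torsion_swap (Y x : TangentSpace 𝓘(ℝ, Model n) x) (ξ s x),
    ← coe_torEnd (hV x hx), ← coe_torEnd (hV x hx), map_neg, neg_apply,
    hF.torsion_horizontal hx, hF.torsion_horizontal hx] at h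
  -- The witness is q = (∇_X T)(Y, ξ_s) - (∇_Y T)(X, ξ_s). Only its horizontality matters for the
  -- vertical part, and it vanishes with the torsion endomorphism.
  refine ⟨⟨_, sub_mem (hm1 hX hY).1 (hm1 hY hX).1⟩, fun h0 => Subtype.ext ?_, ?_⟩
  · simp [(hm1 hX hY).2 h0, (hm1 hY hX).2 h0]
  rw [hF.coe_curvEnd hx, hF.coe_curvEnd hx, h]
  have e : ∀ t, P.g x (J t x (C.torEnd x (ξ s x) (Y x))) (X x)
      = - P.g x (J t x (X x)) (C.torEnd x (ξ s x) (Y x)) := fun t => by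
    rw [(hF.gauge.isUnits hx).skew, P.g_comm]
  simp only [e, mul_add, add_smul, Finset.sum_add_distrib, mul_neg, neg_smul, Finset.sum_neg_distrib]
  abel

omit [T2Space M] in
lemma eta_xi (hx : x ∈ U) (s t : Fin 3) : η s x (ξ t x) = if s = t then 1 else 0 :=
  hF.reeb.dual x hx s t

omit [T2Space M] in
lemma eta_sum_xi (hx : x ∈ U) (r : Fin 3) (a : Fin 3 → ℝ) :
    η r x (∑ t, a t • ξ t x) = a r := by
  simp [hF.eta_xi hx]

set_option maxHeartbeats 1000000 in
/-- The vertical part of the first Bianchi identity with one Reeb field. -/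
lemma bianchi_vertical (hn : 1 ≤ n) (hx : x ∈ U) (u v : P.H x) (r s : Fin 3) :
    η r x (curvature C.cov x u v (ξ s x))
      = -2 * (eps r * (P.g x (J r x (C.torEnd x (ξ s x) u)) v
            + P.g x (J r x u) (C.torEnd x (ξ s x) v))
        + ∑ t, eps t * P.g x (J t x u) v * η r x (C.cov.torsion x (ξ t x) (ξ s x))) := by
  obtain ⟨q, -, h⟩ := hF.bianchi_mixed hn hx u v s
  have h1 := congrArg (η r x) h
  rw [map_add, map_add, map_add, map_add, hF.eta_coe hx, hF.eta_coe hx, hF.eta_coe hx,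
    hF.eta_sum_xi hx, map_sum] at h1
  simp only [map_smul, smul_eq_mul] at h1
  rw [add_zero, add_zero, zero_add] at h1
  rw [h1]
  simp only [Fin.sum_univ_three]
  ring

set_option maxHeartbeats 1000000 in
/-- The horizontal part of the first Bianchi identity with one Reeb field, when the torsion
endomorphism vanishes. -/
lemma bianchi_mixed_horizontal (h0 : C.TorsionEndVanish) (hn : 1 ≤ n) (hx : x ∈ U) (u v : P.H x)
    (s : Fin 3) :
    C.curvEnd x (ξ s x) u v - C.curvEnd x (ξ s x) v u
      = ∑ t, (-2 * eps t * P.g x (J t x u) v) •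
          horizontal C.isCompl x (C.cov.torsion x (ξ t x) (ξ s x)) := by
  obtain ⟨q, hq, h⟩ := hF.bianchi_mixed hn hx u v s
  have h1 := congrArg (horizontal C.isCompl x) h
  rw [hq h0, map_add, map_add, map_add, map_add, map_sum, map_sum, horizontal_coe, horizontal_coe,
    horizontal_coe, horizontal_eq_zero (hF.curvature_xi_mem_V hx _ _ _), zero_add, zero_add] at h1
  simp only [map_smul, horizontal_eq_zero (hF.xi_mem hx _), smul_zero, Finset.sum_const_zero,
    add_zero] at h1
  have h2 : C.curvEnd x v (ξ s x) u = - C.curvEnd x (ξ s x) v u :=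
    congrArg (fun f => f u) (curvEnd_swap (C := C) (v : TangentSpace 𝓘(ℝ, Model n) x) (ξ s x))
  rw [← h1, h2]
  abel

end IsReebFrame
end Bianchi
end PQC

/-! ### Traces for an indefinite metric and the commutant of the units. -/

namespace PQC

/-- A basis that is orthonormal for an indefinite metric. -/
structure IsOrthonormalBasis {E : Type*} [AddCommGroup E] [Module ℝ E]
    (g : LinearMap.BilinForm ℝ E) {ι : Type*} (b : Module.Basis ι ℝ E) : Prop where
  orth : ∀ a c, a ≠ c → g (b a) (b c) = 0
  unit : ∀ a, g (b a) (b a) * g (b a) (b a) = 1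

namespace IsOrthonormalBasis
variable {E : Type*} [AddCommGroup E] [Module ℝ E] {g : LinearMap.BilinForm ℝ E}
    {ι : Type*} [Fintype ι] {b : Module.Basis ι ℝ E} (hb : IsOrthonormalBasis g b)
include hb

lemma repr_eq (u : E) (a : ι) : b.repr u a = g (b a) (b a) * g u (b a) := by
  conv_rhs => rw [← b.sum_repr u]
  rw [map_sum, LinearMap.sum_apply, Finset.sum_eq_single a]
  · rw [map_smul, LinearMap.smul_apply, smul_eq_mul]
    linear_combination - b.repr u a * hb.unit a
  · intro c _ hc
    rw [map_smul, LinearMap.smul_apply, hb.orth c a hc, smul_zero]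
  · simp

lemma sum_smul (u : E) : ∑ a, (g (b a) (b a) * g u (b a)) • b a = u := by
  conv_rhs => rw [← b.sum_repr u]
  simp only [hb.repr_eq]

lemma sum_apply (u : E) (f : E →ₗ[ℝ] ℝ) : ∑ a, g (b a) (b a) * g u (b a) * f (b a) = f u := by
  conv_rhs => rw [← hb.sum_smul u]
  simp

lemma trace_eq (f : Module.End ℝ E) :
    LinearMap.trace ℝ E f = ∑ a, g (b a) (b a) * g (f (b a)) (b a) := by
  classical
  rw [LinearMap.trace_eq_matrix_trace ℝ b, Matrix.trace]
  exact Finset.sum_congr rfl fun a _ => by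
    rw [Matrix.diag_apply, LinearMap.toMatrix_apply, hb.repr_eq]

lemma exists_adjoint (f : Module.End ℝ E) :
    ∃ f' : Module.End ℝ E, ∀ u v, g (f u) v = g u (f' v) := by
  refine ⟨∑ a, (g (b a) (b a) • g (f (b a))).smulRight (b a), fun u v => ?_⟩
  rw [LinearMap.sum_apply, map_sum]
  have := hb.sum_apply u (g.flip v ∘ₗ f)
  simp only [LinearMap.comp_apply] at this
  rw [← show g.flip v (f u) = g (f u) v from rfl, ← this]
  refine Finset.sum_congr rfl fun a _ => ?_
  simp
  ring

lemma trace_adjoint {f f' : Module.End ℝ E} (h : ∀ u v, g (f u) v = g u (f' v))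
    (hs : ∀ u v, g u v = g v u) : LinearMap.trace ℝ E f' = LinearMap.trace ℝ E f := by
  rw [hb.trace_eq, hb.trace_eq]
  exact Finset.sum_congr rfl fun a _ => by rw [h, hs (f' _)]

lemma trace_skew {f : Module.End ℝ E} (h : ∀ u v, g (f u) v = - g u (f v))
    (hs : ∀ u v, g u v = g v u) : LinearMap.trace ℝ E f = 0 := by
  have := hb.trace_adjoint (f := f) (f' := -f) (fun u v => by rw [h]; simp) hs
  rw [map_neg] at this
  linarith

lemma trace_one : LinearMap.trace ℝ E 1 = Fintype.card ι := by
  rw [hb.trace_eq]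
  simp [hb.unit]

lemma trace_smulRight (f : E →ₗ[ℝ] ℝ) (u : E) :
    ∑ a, g (b a) (b a) * g (f (b a) • u) (b a) = f u := by
  rw [← hb.sum_apply u f]
  refine Finset.sum_congr rfl fun a _ => ?_
  rw [map_smul, LinearMap.smul_apply, smul_eq_mul]
  ring

/-- Rank one endomorphisms F = g(v,·) u suffice: tr(F f) = g(v, f u), and g is nondegenerate. -/
lemma eq_zero_of_trace {f : Module.End ℝ E} (hnd : ∀ u, (∀ v, g u v = 0) → u = 0)
    (hs : ∀ u v, g u v = g v u)
    (h : ∀ F : Module.End ℝ E, LinearMap.trace ℝ E (F * f) = 0) : f = 0 := by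
  ext1 u
  refine hnd _ fun v => ?_
  have h1 := h ((g v).smulRight u)
  rw [LinearMap.trace_mul_comm, hb.trace_eq] at h1
  have h2 := hb.trace_smulRight (g v) (f u)
  rw [hs, ← h2, ← h1]
  refine Finset.sum_congr rfl fun a _ => ?_
  simp

end IsOrthonormalBasis

/-- The endomorphism `A` commutes with the units. -/
def CommutesWith {E : Type*} [AddCommGroup E] [Module ℝ E] (J : Fin 3 → Module.End ℝ E)
    (A : Module.End ℝ E) : Prop := ∀ s u, A (J s u) = J s (A u)

namespace IsUnits
variable {E : Type*} [AddCommGroup E] [Module ℝ E] {g : LinearMap.BilinForm ℝ E}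
    {J : Fin 3 → Module.End ℝ E} (hJ : IsUnits g J)
include hJ

lemma app00 (u : E) : J 0 (J 0 u) = u := congr($(hJ.mul00) u)
lemma app11 (u : E) : J 1 (J 1 u) = u := congr($(hJ.mul11) u)
lemma app22 (u : E) : J 2 (J 2 u) = -u := congr($(hJ.mul22) u)
lemma app01 (u : E) : J 0 (J 1 u) = J 2 u := congr($(hJ.mul01) u)
lemma app10 (u : E) : J 1 (J 0 u) = -J 2 u := congr($(hJ.mul10) u)
lemma app02 (u : E) : J 0 (J 2 u) = J 1 u := congr($(hJ.mul02) u)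
lemma app20 (u : E) : J 2 (J 0 u) = -J 1 u := congr($(hJ.mul20) u)
lemma app12 (u : E) : J 1 (J 2 u) = -J 0 u := congr($(hJ.mul12) u)
lemma app21 (u : E) : J 2 (J 1 u) = J 0 u := congr($(hJ.mul21) u)

lemma app_self (s : Fin 3) (u : E) : J s (J s u) = eps s • u := congr($(hJ.sq s) u)

omit hJ in
lemma _root_.PQC.CommutesWith.add {A B : Module.End ℝ E} (hA : CommutesWith J A)
    (hB : CommutesWith J B) : CommutesWith J (A + B) := fun s u => by
  simp [hA s u, hB s u]

omit hJ in
lemma _root_.PQC.CommutesWith.smul {A : Module.End ℝ E} (hA : CommutesWith J A) (c : ℝ) :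
    CommutesWith J (c • A) := fun s u => by simp [hA s u]

omit hJ in
lemma _root_.PQC.CommutesWith.one : CommutesWith J 1 := fun _ _ => rfl

lemma commutesWith_adjoint {A A' : Module.End ℝ E} (hA : CommutesWith J A)
    (h : ∀ u v, g (A u) v = g u (A' v)) : CommutesWith J A' := fun s u => by
  rw [← sub_eq_zero]
  refine hJ.nondeg _ fun v => ?_
  rw [hJ.symm, map_sub, ← h, ← neg_eq_zero, neg_sub]
  have h2 : g v (J s (A' u)) = - g (J s v) (A' u) := by rw [hJ.skew, neg_neg]
  rw [h2, ← h, hA, hJ.skew]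
  ring

/-- Endomorphisms that commute with the units are linearly independent over the units. -/
lemma components_eq_zero {A B C D : Module.End ℝ E} (hA : CommutesWith J A)
    (hB : CommutesWith J B) (hC : CommutesWith J C) (hD : CommutesWith J D)
    (h : ∀ u, A u + J 0 (B u) + J 1 (C u) + J 2 (D u) = 0) : A = 0 ∧ B = 0 ∧ C = 0 ∧ D = 0 := by
  have h0 := fun u => congrArg (J 0) (h (J 0 u))
  have h1 := fun u => congrArg (J 1) (h (J 1 u))
  have h2 := fun u => congrArg (J 2) (h (J 2 u))
  simp only [hA _ _, hB _ _, hC _ _, hD _ _, map_add, hJ.app00, hJ.app11, hJ.app22, hJ.app01,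
    hJ.app10, hJ.app02, hJ.app20, hJ.app12, hJ.app21, map_neg, map_zero] at h0 h1 h2
  -- Conjugation by each unit multiplies the four summands by signs; the signed averages of the
  -- relation and its three conjugates isolate one summand each.
  have e0 : ∀ u, A u = 0 := fun u => by
    linear_combination (norm := module) (1 / 4 : ℝ) • (h u + h0 u + h1 u - h2 u)
  have e1 : ∀ u, J 0 (B u) = 0 := fun u => by
    linear_combination (norm := module) (1 / 4 : ℝ) • (h u + h0 u - h1 u + h2 u)
  have e2 : ∀ u, J 1 (C u) = 0 := fun u => by
    linear_combination (norm := module) (1 / 4 : ℝ) • (h u - h0 u + h1 u + h2 u)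
  have e3 : ∀ u, J 2 (D u) = 0 := fun u => by
    linear_combination (norm := module) (1 / 4 : ℝ) • (h u - h0 u - h1 u - h2 u)
  refine ⟨LinearMap.ext e0, LinearMap.ext fun u => ?_, LinearMap.ext fun u => ?_,
    LinearMap.ext fun u => ?_⟩
  · rw [← hJ.app00 (B u), e1, map_zero]; rfl
  · rw [← hJ.app11 (C u), e2, map_zero]; rfl
  · rw [← neg_neg (D u), ← hJ.app22 (D u), e3, map_zero, neg_zero]; rfl

/-- The component of an endomorphism that commutes with the units. -/
lemma exists_commuting_part (F : Module.End ℝ E) :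
    CommutesWith J ((1 / 4 : ℝ) • (F + J 0 * F * J 0 + J 1 * F * J 1 - J 2 * F * J 2)) := by
  intro s u
  fin_cases s <;>
  simp only [Fin.zero_eta, Fin.mk_one, Fin.reduceFinMk, LinearMap.smul_apply, LinearMap.add_apply,
    LinearMap.sub_apply, Module.End.mul_apply, map_smul, map_add, map_sub,
    hJ.app00, hJ.app11, hJ.app22, hJ.app01,
    hJ.app10, hJ.app02, hJ.app20, hJ.app12, hJ.app21, map_neg] <;> module

/-- Averaging over conjugation by the units projects onto their commutant. The average of F is A,
and that of J_q F is the coefficient of J_q up to the sign ε_q. -/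
lemma exists_components (F : Module.End ℝ E) : ∃ (A : Module.End ℝ E) (B : Fin 3 → Module.End ℝ E),
    CommutesWith J A ∧ (∀ q, CommutesWith J (B q)) ∧
      ∀ u, F u = A u + J 0 (B 0 u) + J 1 (B 1 u) + J 2 (B 2 u) := by
  refine ⟨_, fun q => eps q • _, hJ.exists_commuting_part F,
    fun q => (hJ.exists_commuting_part (J q * F)).smul (eps q), fun u => ?_⟩
  simp only [LinearMap.smul_apply, LinearMap.add_apply,
    LinearMap.sub_apply, Module.End.mul_apply, map_smul, map_add, map_sub,
    hJ.app00, hJ.app11, hJ.app22, hJ.app01,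
    hJ.app10, hJ.app02, hJ.app20, hJ.app12, hJ.app21, map_neg,
    eps, Matrix.cons_val_zero, Matrix.cons_val_one, Matrix.cons_val]
  module

/-- Conjugation by a unit that anticommutes with J_r sends J_r A to its negative, because A commutes
with the units, but it preserves traces. -/
lemma trace_unit_mul {A : Module.End ℝ E} (hA : CommutesWith J A) (r : Fin 3) :
    LinearMap.trace ℝ E (J r * A) = 0 := by
  have key : ∀ q, (∀ u, J q (J r (J q u)) = - eps q • J r u) → LinearMap.trace ℝ E (J r * A) = 0 := by
    intro q h
    have h1 : J r * A = - eps q • (J q * (J r * A * J q)) := by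
      ext1 u
      simp only [LinearMap.smul_apply, Module.End.mul_apply, hA _ _, h, smul_smul]
      rw [neg_mul_neg, eps_mul_self, one_smul]
    have h2 : J r * A * J q * J q = eps q • (J r * A) := by
      rw [mul_assoc, hJ.sq, mul_smul_comm, mul_one]
    have h3 := congrArg (LinearMap.trace ℝ E) h1
    rw [map_smul, LinearMap.trace_mul_comm ℝ (J q), h2, map_smul, smul_smul, neg_mul, eps_mul_self,
      neg_one_smul] at h3
    linarith
  fin_cases r
  · exact key 1 fun u => by simp [hJ.app01, hJ.app12, eps]
  · exact key 0 fun u => by simp [hJ.app10, hJ.app02, eps]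
  · exact key 0 fun u => by simp [hJ.app20, hJ.app01, eps]

end IsUnits
end PQC

/-! ### Normal form of the torsion endomorphisms. -/

namespace PQC

/-- The Levi-Civita symbol. -/
def levi (r s t : Fin 3) : ℝ :=
  ![![![0, 0, 0], ![0, 0, 1], ![0, -1, 0]], ![![0, 0, -1], ![0, 0, 0], ![1, 0, 0]],
    ![![0, 1, 0], ![-1, 0, 0], ![0, 0, 0]]] r s t

/-- The normal form of the torsion endomorphisms `T_s` and of the coefficients
`Λ r t s = η_r(T(ξ_t, ξ_s))`. -/
structure TorsionNormalForm {E : Type*} [AddCommGroup E] [Module ℝ E]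
    (g : LinearMap.BilinForm ℝ E) (J : Fin 3 → Module.End ℝ E) (T : Fin 3 → Module.End ℝ E)
    (Λ : Fin 3 → Fin 3 → Fin 3 → ℝ) (A : Fin 3 → Fin 3 → Module.End ℝ E) (l : ℝ) : Prop where
  comm : ∀ s q, CommutesWith J (A s q)
  tor : ∀ s u, T s u = ∑ q, J q (A s q u)
  skew : ∀ s q, s ≠ q → ∀ u v, g (A s q u) v = - g u (A s q v)
  symm : ∀ s u v, g (A s s u) v = g u (A s s v)
  diag : ∀ s, A s s = A 0 0
  trace_zero : LinearMap.trace ℝ E (A 0 0) = 0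
  anti : ∀ s r, s ≠ r → eps r • A s r = - eps s • A r s
  lam : ∀ r t s, eps r * Λ r t s = l * levi r t s

section
variable {E : Type*} [AddCommGroup E] [Module ℝ E] {g : LinearMap.BilinForm ℝ E}
    {J : Fin 3 → Module.End ℝ E} {ι : Type*} [Fintype ι] {b : Module.Basis ι ℝ E}

/-- An endomorphism commuting with the units, skew and trace-orthogonal to `sp`, vanishes. -/
lemma IsUnits.eq_zero_of_orthogonal (hJ : IsUnits g J) (hb : IsOrthonormalBasis g b)
    {T : Module.End ℝ E} (hT : CommutesWith J T) (hsk : ∀ u v, g (T u) v = - g u (T v))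
    (h : ∀ B, CommutesWith J B → (∀ u v, g (B u) v = - g u (B v)) →
      LinearMap.trace ℝ E (B * T) = 0) : T = 0 := by
  refine hb.eq_zero_of_trace hJ.nondeg hJ.symm fun F => ?_
  have hc := hJ.exists_commuting_part F
  set c := (1 / 4 : ℝ) • (F + J 0 * F * J 0 + J 1 * F * J 1 - J 2 * F * J 2) with hcdef
  obtain ⟨c', hc'⟩ := hb.exists_adjoint c
  have hcc' := hJ.commutesWith_adjoint hc hc'
  -- Here c is the averaged F and c' its adjoint, so c - c' lies in sp. As T is skew, tr(c' T) =
  -- -tr(c T), and orthogonality gives 2 tr(c T) = 0; finally tr(c T) = tr(F T) since T commutes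
  -- with the units.
  have h1 := h (c + (-1 : ℝ) • c') (hc.add (hcc'.smul _)) (fun u v => by
    have := hc' v u
    simp only [LinearMap.add_apply, LinearMap.smul_apply, map_add, map_smul, smul_eq_mul, hc' u v]
    rw [hJ.symm (c' u), ← this, hJ.symm (c v)]
    ring)
  have h2 : LinearMap.trace ℝ E (c' * T) = LinearMap.trace ℝ E (-(T * c)) :=
    hb.trace_adjoint (fun u v => by
      simp only [LinearMap.neg_apply, Module.End.mul_apply, map_neg, hsk, ← hc', neg_neg]) hJ.symm
  have h3 : ∀ q, LinearMap.trace ℝ E (J q * F * J q * T) = eps q * LinearMap.trace ℝ E (F * T) := by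
    intro q
    have e : F * J q * T * J q = eps q • (F * T) := by
      ext1 u
      simp [hT q u, hJ.app_self]
    rw [mul_assoc, mul_assoc, LinearMap.trace_mul_comm, ← mul_assoc, e, map_smul, smul_eq_mul]
  have h4 : LinearMap.trace ℝ E (c * T) = LinearMap.trace ℝ E (F * T) := by
    rw [hcdef, smul_mul_assoc, map_smul, sub_mul, add_mul, add_mul, map_sub, map_add, map_add, h3,
      h3, h3]
    simp [eps]
    ring
  clear_value c
  rw [add_mul, smul_mul_assoc, map_add, map_smul, h2, map_neg, LinearMap.trace_mul_comm ℝ T,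
    smul_eq_mul] at h1
  rw [← h4]
  linarith

/-- The Bianchi identity and the orthogonality condition determine the shape of the torsion. -/
theorem IsUnits.exists_torsionNormalForm [Nontrivial E] (hJ : IsUnits g J)
    (hb : IsOrthonormalBasis g b) {T : Fin 3 → Module.End ℝ E}
    {Λ : Fin 3 → Fin 3 → Fin 3 → ℝ} (hΛ : ∀ r t s, Λ r t s = - Λ r s t)
    (hρ : ∀ r s u v,
      eps r * (eps r * (g (J r (T s u)) v + g (J r u) (T s v)) + ∑ t, eps t * g (J t u) v * Λ r t s)
      + eps s * (eps s * (g (J s (T r u)) v + g (J s u) (T r v))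
        + ∑ t, eps t * g (J t u) v * Λ s t r) = 0)
    (hsp : ∀ s B, CommutesWith J B → (∀ u v, g (B u) v = - g u (B v)) →
      LinearMap.trace ℝ E (B * T s) = 0)
    (hPQ : ∀ s r, LinearMap.trace ℝ E (J r * T s) = 0) :
    ∃ A l, TorsionNormalForm g J T Λ A l := by
  -- T_s = T0_s + Σ J_q A_{s,q} with all coefficients in the commutant; primes denote adjoints. The
  -- claim is that T0 = 0 and that the A_{s,q} have the stated symmetries.
  choose T0 A hT0 hA hT using fun s => hJ.exists_components (T s)
  choose T0' hT0' using fun s => hb.exists_adjoint (T0 s)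
  choose A' hA' using fun s q => hb.exists_adjoint (A s q)
  have cT0' : ∀ s, CommutesWith J (T0' s) := fun s => hJ.commutesWith_adjoint (hT0 s) (hT0' s)
  have cA' : ∀ s q, CommutesWith J (A' s q) := fun s q => hJ.commutesWith_adjoint (hA s q) (hA' s q)
  have adj : ∀ s u v, g u (T s v)
      = g (T0' s u - J 0 (A' s 0 u) - J 1 (A' s 1 u) - J 2 (A' s 2 u)) v := by
    intro s u v
    have e : ∀ q, g (J q (A' s q u)) v = - g u (J q (A s q v)) := fun q => by
      rw [hJ.skew, hJ.symm, ← hA', hA, hJ.symm]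
    rw [hT]
    simp only [map_add, map_sub, LinearMap.sub_apply, e]
    rw [hJ.symm (T0' s u), ← hT0', hJ.symm u (T0 s v)]
    ring
  have hE : ∀ r s u, (J r (T s u)
        + (T0' s (J r u) - J 0 (A' s 0 (J r u)) - J 1 (A' s 1 (J r u)) - J 2 (A' s 2 (J r u))))
      + (J s (T r u)
        + (T0' r (J s u) - J 0 (A' r 0 (J s u)) - J 1 (A' r 1 (J s u)) - J 2 (A' r 2 (J s u))))
      + ∑ t, (eps t * (eps r * Λ r t s + eps s * Λ s t r)) • J t u = 0 := by
    intro r s u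
    refine hJ.nondeg _ fun v => ?_
    have h := hρ r s u v
    rw [adj, adj] at h
    have e1 := eps_mul_self r
    have e2 := eps_mul_self s
    simp only [map_add, LinearMap.add_apply, map_smul, LinearMap.smul_apply,
      smul_eq_mul, Fin.sum_univ_three] at h ⊢
    generalize g (J r (T s u)) v = p1 at *
    generalize g (J s (T r u)) v = p2 at *
    generalize g (T0' s (J r u) - J 0 (A' s 0 (J r u)) - J 1 (A' s 1 (J r u))
      - J 2 (A' s 2 (J r u))) v = p3 at *
    generalize g (T0' r (J s u) - J 0 (A' r 0 (J s u)) - J 1 (A' r 1 (J s u))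
      - J 2 (A' r 2 (J s u))) v = p4 at *
    linear_combination h - (p1 + p3) * e1 - (p2 + p4) * e2
  -- X and Y are twice the symmetric parts of T0 and A, and Z is twice the skew part of A. `N0` and
  -- `N q` are the components, along 1 and J_q, of the endomorphism representing g(J_r T_s u, v) +
  -- g(J_r u, T_s v).
  let X : Fin 3 → Module.End ℝ E := fun s => T0 s + T0' s
  let Y : Fin 3 → Fin 3 → Module.End ℝ E := fun s q => A s q + A' s q
  let Z : Fin 3 → Fin 3 → Module.End ℝ E := fun s q => A s q + (-1 : ℝ) • A' s q
  let N0 : Fin 3 → Fin 3 → Module.End ℝ E := fun r s => eps r • Z s r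
  let N : Fin 3 → Fin 3 → Fin 3 → Module.End ℝ E := fun q r s =>
    ![![X s, (-1 : ℝ) • Y s 2, Y s 1], ![Y s 2, X s, (-1 : ℝ) • Y s 0],
      ![Y s 1, (-1 : ℝ) • Y s 0, X s]] q r
  have hN : ∀ r s u, J r (T s u)
        + (T0' s (J r u) - J 0 (A' s 0 (J r u)) - J 1 (A' s 1 (J r u)) - J 2 (A' s 2 (J r u)))
      = N0 r s u + J 0 (N 0 r s u) + J 1 (N 1 r s u) + J 2 (N 2 r s u) := by
    intro r s u
    rw [hT]
    fin_cases r <;>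
    simp only [Fin.zero_eta, Fin.mk_one, Fin.reduceFinMk, N0, N, Z, X, Y, cT0' _ _ _, cA' _ _ _ _,
      map_add, hJ.app00, hJ.app11, hJ.app22, hJ.app01,
      hJ.app10, hJ.app02, hJ.app20, hJ.app12, hJ.app21, eps, Matrix.cons_val_zero,
      Matrix.cons_val_one, Matrix.cons_val, LinearMap.add_apply, LinearMap.smul_apply, map_smul] <;>
    module
  have cX : ∀ s, CommutesWith J (X s) := fun s => (hT0 s).add (cT0' s)
  have cY : ∀ s q, CommutesWith J (Y s q) := fun s q => (hA s q).add (cA' s q)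
  have cZ : ∀ s q, CommutesWith J (Z s q) := fun s q => (hA s q).add ((cA' s q).smul _)
  have cN0 : ∀ r s, CommutesWith J (N0 r s) := fun r s => (cZ s r).smul _
  have cN : ∀ q r s, CommutesWith J (N q r s) := by
    intro q r s
    fin_cases q <;> fin_cases r <;> first
      | exact cX s | exact cY s _ | exact (cY s _).smul _
  let e : Fin 3 → Fin 3 → Fin 3 → ℝ := fun t r s => eps t * (eps r * Λ r t s + eps s * Λ s t r)
  have hcomp : ∀ r s, N0 r s + N0 s r = 0 ∧ ∀ q, N q r s + N q s r + e q r s • 1 = 0 := by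
    intro r s
    obtain ⟨h0, h1, h2, h3⟩ := hJ.components_eq_zero ((cN0 r s).add (cN0 s r))
      (((cN 0 r s).add (cN 0 s r)).add (CommutesWith.one.smul (e 0 r s)))
      (((cN 1 r s).add (cN 1 s r)).add (CommutesWith.one.smul (e 1 r s)))
      (((cN 2 r s).add (cN 2 s r)).add (CommutesWith.one.smul (e 2 r s))) (fun u => by
        have h := hE r s u
        rw [hN, hN, Fin.sum_univ_three] at h
        simp only [LinearMap.add_apply, map_add, LinearMap.smul_apply, map_smul,
          Module.End.one_apply, e]
        linear_combination (norm := module) h)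
    refine ⟨h0, fun q => ?_⟩
    fin_cases q
    exacts [h1, h2, h3]
  -- Antisymmetry of Λ removes the scalar from the J_s component with r = s, and this component is
  -- then a multiple of X_s.
  have hss : ∀ s, e s s s = 0 := fun s => by
    have := hΛ s s s
    have : Λ s s s = 0 := by linarith
    simp [e, this]
  have hX : ∀ s, X s = 0 := by
    intro s
    have h := (hcomp s s).2 s
    rw [hss, zero_smul, add_zero, ← two_smul ℝ] at h
    have h2 := (smul_eq_zero.1 h).resolve_left two_ne_zero
    fin_cases s <;> exact h2
  -- Orthogonality to PQ is used here: the component of J_q T_s along the identity is ε_q A_{s,q},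
  -- and the other components are traceless.
  have tA : ∀ s q, LinearMap.trace ℝ E (A s q) = 0 := by
    intro s q
    have h := hPQ s q
    have e1 : ∃ c0 c1 c2 : ℝ, ∃ B0 B1 B2, CommutesWith J B0 ∧ CommutesWith J B1 ∧ CommutesWith J B2 ∧
        J q * T s = eps q • A s q + c0 • (J 0 * B0) + c1 • (J 1 * B1) + c2 • (J 2 * B2) := by
      fin_cases q
      · refine ⟨1, 1, 1, T0 s, A s 2, A s 1, hT0 s, hA s 2, hA s 1, ?_⟩
        ext1 u
        simp [hT, hJ.app00, hJ.app01, hJ.app02, eps]; abel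
      · refine ⟨-1, 1, -1, A s 2, T0 s, A s 0, hA s 2, hT0 s, hA s 0, ?_⟩
        ext1 u
        simp [hT, hJ.app10, hJ.app11, hJ.app12, eps]; abel
      · refine ⟨1, -1, 1, A s 1, A s 0, T0 s, hA s 1, hA s 0, hT0 s, ?_⟩
        ext1 u
        simp [hT, hJ.app20, hJ.app21, hJ.app22, eps]; abel
    obtain ⟨c0, c1, c2, B0, B1, B2, h0, h1, h2, e1⟩ := e1
    rw [e1] at h
    simp only [map_add, map_smul, hJ.trace_unit_mul h0, hJ.trace_unit_mul h1,
      hJ.trace_unit_mul h2, smul_zero, add_zero] at h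
    exact (smul_eq_zero.1 h).resolve_left (eps_ne_zero q)
  have tA' : ∀ s q, LinearMap.trace ℝ E (A' s q) = 0 := fun s q => by
    rw [hb.trace_adjoint (hA' s q) hJ.symm, tA]
  have tN : ∀ q r s, LinearMap.trace ℝ E (N q r s) = 0 := by
    intro q r s
    have tY : ∀ s q, LinearMap.trace ℝ E (Y s q) = 0 := fun s q => by
      simp only [Y, map_add, tA, tA', add_zero]
    have tX : ∀ s, LinearMap.trace ℝ E (X s) = 0 := fun s => by rw [hX, map_zero]
    have tY' : ∀ s q, LinearMap.trace ℝ E ((-1 : ℝ) • Y s q) = 0 := fun s q => by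
      rw [map_smul, tY, smul_zero]
    fin_cases q <;> fin_cases r <;> first
      | exact tX s | exact tY s _ | exact tY' s _
  have hι : (Fintype.card ι : ℝ) ≠ 0 := by
    have : Nonempty ι := b.index_nonempty
    exact_mod_cast Fintype.card_ne_zero
  -- Since all components N are traceless, the trace of the relation isolates the scalar e times dim
  -- E. The equations for the vertical torsion thus decouple from those for T_s.
  have he : ∀ q r s, e q r s = 0 := by
    intro q r s
    have h := congrArg (LinearMap.trace ℝ E) ((hcomp r s).2 q)
    rw [map_add, map_add, tN, tN, map_smul, hb.trace_one, map_zero, zero_add, zero_add,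
      smul_eq_mul] at h
    exact (mul_eq_zero.1 h).resolve_right hι
  have hNN : ∀ q r s, N q r s + N q s r = 0 := fun q r s => by
    have h := (hcomp r s).2 q
    rwa [he, zero_smul, add_zero] at h
  -- The J_q component with r = s ≠ q is the symmetric part of A with the third index, up to sign.
  -- Hence the off-diagonal A are skew.
  have hY : ∀ s q, s ≠ q → Y s q = 0 := by
    have k : ∀ {B : Module.End ℝ E}, B + B = 0 → B = 0 := fun {B} h => by
      rw [← two_smul ℝ] at h
      exact (smul_eq_zero.1 h).resolve_left two_ne_zero
    have k' : ∀ {B : Module.End ℝ E}, (-1 : ℝ) • B = 0 → B = 0 := fun {B} h =>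
      (smul_eq_zero.1 h).resolve_left (by norm_num)
    intro s q hsq
    fin_cases s <;> fin_cases q
    · exact absurd rfl hsq
    · exact k (hNN 2 0 0)
    · exact k (hNN 1 0 0)
    · exact k' (k (hNN 2 1 1))
    · exact absurd rfl hsq
    · exact k' (k (hNN 0 1 1))
    · exact k' (k (hNN 1 2 2))
    · exact k (hNN 0 2 2)
    · exact absurd rfl hsq
  have hZ : ∀ s, A' s s = A s s := by
    intro s
    have h : eps s • Z s s + eps s • Z s s = 0 := (hcomp s s).1
    rw [← two_smul ℝ] at h
    have h2 := (smul_eq_zero.1 ((smul_eq_zero.1 h).resolve_left two_ne_zero)).resolve_left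
      (eps_ne_zero s)
    simp only [Z, neg_one_smul] at h2
    exact (eq_of_sub_eq_zero (by rw [sub_eq_add_neg]; exact h2)).symm
  have hsk : ∀ s q, s ≠ q → A' s q = - A s q := fun s q h =>
    eq_neg_of_add_eq_zero_right (hY s q h)
  -- X_s = 0 says that T0 is skew; it commutes with the units and the other summands of T_s are
  -- invisible to sp, so orthogonality to sp kills it.
  have hT0z : ∀ s, T0 s = 0 := by
    intro s
    have e1 : T0' s = - T0 s := eq_neg_of_add_eq_zero_right (hX s)
    refine hJ.eq_zero_of_orthogonal hb (hT0 s) (fun u v => by rw [hT0', e1]; simp)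
      fun B hB hBs => ?_
    have h := hsp s B hB hBs
    have e2 : B * T s = B * T0 s + J 0 * (B * A s 0) + J 1 * (B * A s 1) + J 2 * (B * A s 2) := by
      ext1 u
      simp [hT, hB _ _]
    have cB : ∀ q, CommutesWith J (B * A s q) := fun q r u => by
      simp [hA s q r u, hB r _]
    rw [e2, map_add, map_add, map_add, hJ.trace_unit_mul (cB 0), hJ.trace_unit_mul (cB 1),
      hJ.trace_unit_mul (cB 2), add_zero, add_zero, add_zero] at h
    exact h
  have two : ∀ B : Module.End ℝ E, B + B = (2 : ℝ) • B := fun B => (two_smul ℝ B).symm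
  -- The component along J_2 of the relation for (r,s) = (0,1) compares the symmetric parts of the
  -- two diagonal entries, which are symmetric already.
  have d1 : A 1 1 = A 0 0 := by
    have h : (Y 1 1) + (-1 : ℝ) • Y 0 0 = 0 := hNN 2 0 1
    simp only [Y, hZ, two, neg_one_smul, ← sub_eq_add_neg, ← smul_sub] at h
    exact eq_of_sub_eq_zero ((smul_eq_zero.1 h).resolve_left two_ne_zero)
  have d2 : A 2 2 = A 0 0 := by
    have h : (Y 2 2) + (-1 : ℝ) • Y 0 0 = 0 := hNN 1 0 2
    simp only [Y, hZ, two, neg_one_smul, ← sub_eq_add_neg, ← smul_sub] at h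
    exact eq_of_sub_eq_zero ((smul_eq_zero.1 h).resolve_left two_ne_zero)
  refine ⟨A, eps 0 * Λ 0 1 2, hA, fun s u => ?_, fun s q h u v => ?_, fun s u v => ?_, fun s => ?_,
    tA 0 0, fun s r h => ?_, fun r t s => ?_⟩
  · rw [hT, hT0z, Fin.sum_univ_three]; simp
  · rw [hA', hsk s q h]; simp
  · rw [hA', hZ]
  · fin_cases s
    exacts [rfl, d1, d2]
  · have h1 : eps r • Z s r + eps s • Z r s = 0 := (hcomp r s).1
    simp only [Z, hsk s r h, hsk r s h.symm] at h1
    ext1 u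
    have h2 := congr($h1 u)
    simp only [LinearMap.add_apply, LinearMap.smul_apply, LinearMap.neg_apply,
      LinearMap.zero_apply] at h2 ⊢
    linear_combination (norm := module) (1 / 2 : ℝ) • h2
  -- ε_r Λ_{rts} is antisymmetric in (t,s) by hypothesis and in (r,s) by `he`, hence totally
  -- antisymmetric: a multiple of the Levi-Civita symbol.
  · have h1 : ∀ r t s, eps r * Λ r t s = - (eps s * Λ s t r) := fun r t s => by
      have := (mul_eq_zero.1 (he t r s)).resolve_left (eps_ne_zero t)
      linarith
    have h2 : ∀ r t s, eps r * Λ r t s = - (eps r * Λ r s t) := fun r t s => by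
      rw [hΛ r t s]; ring
    generalize hL : (fun r t s => eps r * Λ r t s) = L
    have hL' : ∀ r t s, eps r * Λ r t s = L r t s := fun r t s => by rw [← hL]
    simp only [hL'] at h1 h2 ⊢
    have a1 := h1 0 1 2; have a2 := h2 0 1 2; have a3 := h1 1 0 2; have a4 := h2 1 0 2
    have a5 := h2 2 1 0; have a6 := h1 0 2 1
    have z1 := fun r t => h1 r t r
    have z2 := fun r t => h2 r t t
    have z3 := fun r t => h2 r r t
    fin_cases r <;> fin_cases t <;> fin_cases s <;> simp [levi] <;>
      first
        | linarith [z1 0 0, z1 0 1, z1 0 2, z1 1 0, z1 1 1, z1 1 2, z1 2 0, z1 2 1, z1 2 2]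
        | linarith [z2 0 0, z2 0 1, z2 0 2, z2 1 0, z2 1 1, z2 1 2, z2 2 0, z2 2 1, z2 2 2]
        | linarith [h2 0 0 1, h2 0 0 2, h2 1 1 0, h2 1 1 2, h2 2 2 0, h2 2 2 1,
            z1 0 1, z1 0 2, z1 1 0, z1 1 2, z1 2 0, z1 2 1]
end
end PQC

/-! ### Explicit torsion, curvature coefficients and the contracted Bianchi identity. -/

namespace PQC
section

/-- The explicit shape of the torsion endomorphisms. -/
structure TorsionForm {E : Type*} [AddCommGroup E] [Module ℝ E]
    (g : LinearMap.BilinForm ℝ E) (J : Fin 3 → Module.End ℝ E) (T : Fin 3 → Module.End ℝ E)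
    (Λ : Fin 3 → Fin 3 → Fin 3 → ℝ) (m p q r : Module.End ℝ E) (l : ℝ) : Prop where
  cm : CommutesWith J m
  cp : CommutesWith J p
  cq : CommutesWith J q
  cr : CommutesWith J r
  sm : ∀ u v, g (m u) v = g u (m v)
  sp : ∀ u v, g (p u) v = - g u (p v)
  sq : ∀ u v, g (q u) v = - g u (q v)
  sr : ∀ u v, g (r u) v = - g u (r v)
  tm : LinearMap.trace ℝ E m = 0
  t0 : ∀ u, T 0 u = J 0 (m u) + J 1 (p u) + J 2 (q u)
  t1 : ∀ u, T 1 u = J 1 (m u) - J 0 (p u) + J 2 (r u)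
  t2 : ∀ u, T 2 u = J 2 (m u) + J 0 (q u) + J 1 (r u)
  lam : ∀ r t s, eps r * Λ r t s = l * levi r t s

variable {E : Type*} [AddCommGroup E] [Module ℝ E] {g : LinearMap.BilinForm ℝ E}
    {J : Fin 3 → Module.End ℝ E} {ι : Type*} [Fintype ι] {b : Module.Basis ι ℝ E}
    {T : Fin 3 → Module.End ℝ E} {Λ : Fin 3 → Fin 3 → Fin 3 → ℝ} {m p q r : Module.End ℝ E} {l : ℝ}

lemma TorsionNormalForm.torsionForm {A : Fin 3 → Fin 3 → Module.End ℝ E}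
    (h : TorsionNormalForm g J T Λ A l) :
    TorsionForm g J T Λ (A 0 0) (A 0 1) (A 0 2) (A 1 2) l := by
  have h10 : A 1 0 = - A 0 1 := by have := h.anti 1 0 (by decide); simpa [eps] using this
  have h20 : A 2 0 = A 0 2 := by have := h.anti 2 0 (by decide); simpa [eps] using this
  have h21 : A 2 1 = A 1 2 := by have := h.anti 2 1 (by decide); simpa [eps] using this
  refine ⟨h.comm _ _, h.comm _ _, h.comm _ _, h.comm _ _, h.symm 0, h.skew _ _ (by decide),
    h.skew _ _ (by decide), h.skew _ _ (by decide), h.trace_zero, fun u => ?_, fun u => ?_,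
    fun u => ?_, h.lam⟩
  · rw [h.tor, Fin.sum_univ_three]
  · rw [h.tor, Fin.sum_univ_three, h10, h.diag 1]; simp; abel
  · rw [h.tor, Fin.sum_univ_three, h20, h21, h.diag 2]; abel

/-- The curvature coefficients as endomorphisms: `ρ_{rs} = g(M_{rs} ·, ·)`. -/
def curvCoeff (J : Fin 3 → Module.End ℝ E) (m p q r : Module.End ℝ E) (l : ℝ) :
    Fin 3 → Fin 3 → Module.End ℝ E :=
  let K₂ := (-4 : ℝ) • (J 2 * m) + (4 : ℝ) • p + (-2 * l) • J 2
  let K₁ := (-4 : ℝ) • (J 1 * m) + (-4 : ℝ) • q + (-2 * l) • J 1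
  let K₀ := (4 : ℝ) • (J 0 * m) + (-4 : ℝ) • r + (2 * l) • J 0
  ![![0, K₂, K₁], ![(-1 : ℝ) • K₂, 0, K₀], ![K₁, K₀, 0]]

namespace TorsionForm
variable (h : TorsionForm g J T Λ m p q r l) (hJ : IsUnits g J)
include h hJ

/-- A unit times the symmetric m is skew, while a unit times a skew p or q is symmetric. Only the
sign of the m-term changes under the adjoint, so m carries the skew part of the torsion and p, q, r
the symmetric part. -/
lemma adj0 (u v : E) : g u (T 0 v) = g (-J 0 (m u) + J 1 (p u) + J 2 (q u)) v := by
  simp only [h.t0, map_add, map_neg, LinearMap.add_apply, LinearMap.neg_apply, hJ.skew,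
    h.sm, h.sp, h.sq, h.cm _ _, h.cp _ _, h.cq _ _]
  ring

lemma adj1 (u v : E) : g u (T 1 v) = g (-J 1 (m u) - J 0 (p u) + J 2 (r u)) v := by
  simp only [h.t1, map_add, map_sub, map_neg, LinearMap.add_apply, LinearMap.neg_apply, hJ.skew,
    h.sm, h.sp, h.sr, h.cm _ _, h.cp _ _, h.cr _ _, LinearMap.sub_apply]
  ring

lemma adj2 (u v : E) : g u (T 2 v) = g (-J 2 (m u) + J 0 (q u) + J 1 (r u)) v := by
  simp only [h.t2, map_add, map_neg, LinearMap.add_apply, LinearMap.neg_apply, hJ.skew,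
    h.sm, h.sr, h.sq, h.cm _ _, h.cr _ _, h.cq _ _]
  ring

/-- The left side is the expression that the vertical Bianchi identity gives for η_a(R(u,v)ξ_s);
inserting the normal form produces the matrix `curvCoeff`. -/
lemma curvCoeff_eq (a s : Fin 3) (u v : E) :
    -2 * (eps a * (g (J a (T s u)) v + g (J a u) (T s v)) + ∑ t, eps t * g (J t u) v * Λ a t s)
      = g (curvCoeff J m p q r l a s u) v := by
  have hl : ∀ t, Λ a t s = eps a * (l * levi a t s) := fun t => by
    rw [← h.lam, ← mul_assoc, eps_mul_self, one_mul]
  simp only [hl]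
  fin_cases s <;> fin_cases a <;>
  simp only [Fin.zero_eta, Fin.mk_one, Fin.reduceFinMk, h.adj0 hJ, h.adj1 hJ, h.adj2 hJ] <;>
  simp only [h.t0, h.t1, h.t2, curvCoeff, levi, eps, Matrix.cons_val_zero, Matrix.cons_val_one, Matrix.cons_val,
    Fin.sum_univ_three, map_add, map_sub, map_neg, map_smul, LinearMap.add_apply,
    LinearMap.sub_apply, LinearMap.neg_apply, LinearMap.smul_apply, LinearMap.zero_apply, map_zero,
    Module.End.mul_apply, smul_eq_mul, h.cm _ _, h.cp _ _, h.cq _ _, h.cr _ _,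
    hJ.app00, hJ.app11, hJ.app22, hJ.app01, hJ.app10, hJ.app02, hJ.app20, hJ.app12, hJ.app21] <;>
  ring

lemma curvCoeff_skew (a s : Fin 3) (u v : E) :
    g (curvCoeff J m p q r l a s u) v = - g u (curvCoeff J m p q r l a s v) := by
  fin_cases s <;> fin_cases a <;>
  simp only [Fin.zero_eta, Fin.mk_one, Fin.reduceFinMk, 
    curvCoeff, Matrix.cons_val_zero, Matrix.cons_val_one, Matrix.cons_val,
    map_add, map_smul, LinearMap.add_apply, LinearMap.smul_apply, LinearMap.zero_apply, map_zero,
    Module.End.mul_apply, smul_eq_mul, h.cm _ _, hJ.skew, h.sm, h.sp, h.sq, h.sr] <;>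
  ring

/-- The torsion vanishes if its invariant components do. -/
lemma eq_zero_of_tau_mu
    (hμ : ∀ s u v, g (T s (J s u)) v - g (T s v) (J s u) = 0)
    (hτ : ∀ u v, ∑ s, eps s * (g (T s (J s u)) v + g (T s v) (J s u)) = 0) :
    m = 0 ∧ p = 0 ∧ q = 0 ∧ r = 0 := by
  -- The skew part of T_0 J_0 is m itself.
  have h0 : m = 0 := by
    ext1 u
    refine hJ.nondeg _ fun v => ?_
    have h1 := hμ 0 u v
    rw [hJ.symm (T 0 v), h.adj0 hJ] at h1
    simp only [h.t0, h.cm _ _, h.cp _ _, h.cq _ _, map_add, map_neg, LinearMap.add_apply,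
      LinearMap.neg_apply, hJ.app00] at h1
    linarith
  have z : CommutesWith J (0 : Module.End ℝ E) := fun s u => by simp
  -- The components of τ along J_0, J_1, J_2 are common multiples of r, -q, -p, and its component
  -- along the identity is zero.
  have h1 := hJ.components_eq_zero z h.cr (h.cq.smul (-1)) (h.cp.smul (-1)) (fun u => by
    refine hJ.nondeg _ fun v => ?_
    have h1 := hτ u v
    rw [Fin.sum_univ_three, hJ.symm (T 0 v), hJ.symm (T 1 v), hJ.symm (T 2 v), h.adj0 hJ,
      h.adj1 hJ, h.adj2 hJ] at h1
    simp only [h.t0, h.t1, h.t2, h.cm _ _, h.cp _ _, h.cq _ _, h.cr _ _, map_add, map_sub, map_neg,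
      LinearMap.add_apply, LinearMap.neg_apply, LinearMap.sub_apply, LinearMap.smul_apply,
      LinearMap.zero_apply, map_smul, smul_eq_mul, map_zero, eps, Matrix.cons_val_zero,
      Matrix.cons_val_one, Matrix.cons_val, hJ.app00, hJ.app11, hJ.app22, hJ.app01, hJ.app10,
      hJ.app02, hJ.app20, hJ.app12, hJ.app21] at h1 ⊢
    linarith)
  refine ⟨h0, ?_, ?_, h1.2.1⟩
  · simpa using h1.2.2.2
  · simpa using h1.2.2.1

omit hJ in
lemma torsion_eq_zero (h0 : m = 0 ∧ p = 0 ∧ q = 0 ∧ r = 0) (s : Fin 3) : T s = 0 := by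
  obtain ⟨rfl, rfl, rfl, rfl⟩ := h0
  ext1 u
  fin_cases s
  · simpa using h.t0 u
  · simpa using h.t1 u
  · simpa using h.t2 u

lemma eq_zero_of_torsion (hT : ∀ s, T s = 0) : m = 0 ∧ p = 0 ∧ q = 0 ∧ r = 0 := by
  have z : CommutesWith J (0 : Module.End ℝ E) := fun s u => by simp
  have h0 := hJ.components_eq_zero z h.cm h.cp h.cq (fun u => by
    rw [LinearMap.zero_apply, zero_add, ← h.t0, hT]; rfl)
  have h2 := hJ.components_eq_zero z h.cq h.cr h.cm (fun u => by
    have := h.t2 u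
    rw [hT, LinearMap.zero_apply] at this
    rw [LinearMap.zero_apply, zero_add, this]; abel)
  exact ⟨h0.2.1, h0.2.2.1, h0.2.2.2, h2.2.2.1⟩

end TorsionForm

/-- Pointwise curvature data on `H`: an algebraic curvature tensor with the symmetries of the
canonical connection. -/
structure IsHorizontalCurvature (g : LinearMap.BilinForm ℝ E) (J : Fin 3 → Module.End ℝ E)
    (T : Fin 3 → Module.End ℝ E) (K : Fin 3 → Fin 3 → Module.End ℝ E)
    (R : E → E → Module.End ℝ E) : Prop where
  swap : ∀ u v, R u v = - R v u
  skew : ∀ u v a c, g (R u v a) c = - g a (R u v c)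
  unit : ∀ u v s a, R u v (J s a) = J s (R u v a) + ∑ r, g (K r s u) v • J r a
  bianchi : ∀ u v w, R u v w + R v w u + R w u v
    = ∑ s, ((-2 * eps s * g (J s u) v) • T s w + (-2 * eps s * g (J s v) w) • T s u
      + (-2 * eps s * g (J s w) u) • T s v)

/-- The Ricci contraction. -/
def ricciForm (g : LinearMap.BilinForm ℝ E) (b : Module.Basis ι ℝ E) (R : E → E → Module.End ℝ E)
    (u v : E) : ℝ := ∑ a, g (b a) (b a) * g (R (b a) u v) (b a)

/-- The trace of a curvature endomorphism against a unit. -/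
lemma IsUnits.trace_mul_curvature {F : Module.End ℝ E} {κ : Fin 3 → Fin 3 → ℝ}
    (hJ : IsUnits g J) (hb : IsOrthonormalBasis g b)
    (hF : ∀ s a, F (J s a) = J s (F a) + ∑ r, κ r s • J r a) :
    LinearMap.trace ℝ E (J 0 * F) = Fintype.card ι / 2 * κ 2 1 ∧
    LinearMap.trace ℝ E (J 1 * F) = - (Fintype.card ι / 2 * κ 2 0) ∧
    LinearMap.trace ℝ E (J 2 * F) = Fintype.card ι / 2 * κ 1 0 := by
  have tJ : ∀ s, LinearMap.trace ℝ E (J s) = 0 := fun s => by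
    have := hJ.trace_unit_mul (A := 1) CommutesWith.one s
    rwa [mul_one] at this
  have key : ∀ t a, a ≠ t → LinearMap.trace ℝ E (J t * F) = eps a * LinearMap.trace ℝ E
      (J a * J t * (F * J a)) := by
    intro t a _
    rw [← mul_assoc, LinearMap.trace_mul_comm ℝ _ (J a), ← mul_assoc, ← mul_assoc, hJ.sq,
      smul_mul_assoc, smul_mul_assoc, one_mul, map_smul, smul_eq_mul, ← mul_assoc, eps_mul_self,
      one_mul]
  have e0 : J 1 * J 0 * (F * J 1) = (-1 : ℝ) • (J 0 * F)
      + (κ 0 1 • (-1 : ℝ) • (-1 : ℝ) • J 1 + κ 1 1 • (-1 : ℝ) • J 0 + κ 2 1 • 1) := by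
    ext1 u
    simp [hF, Fin.sum_univ_three, hJ.app00, hJ.app11, hJ.app22, hJ.app01, hJ.app10,
      hJ.app02, hJ.app20, hJ.app12, hJ.app21]
  have e1 : J 0 * J 1 * (F * J 0) = (-1 : ℝ) • (J 1 * F)
      + (κ 0 0 • (-1 : ℝ) • J 1 + κ 1 0 • J 0 + κ 2 0 • (-1 : ℝ) • 1) := by
    ext1 u
    simp [hF, Fin.sum_univ_three, hJ.app00, hJ.app11, hJ.app22, hJ.app01, hJ.app10,
      hJ.app02, hJ.app20, hJ.app12, hJ.app21]
  have e2 : J 0 * J 2 * (F * J 0) = (-1 : ℝ) • (J 2 * F)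
      + (κ 0 0 • (-1 : ℝ) • J 2 + κ 1 0 • 1 + κ 2 0 • (-1 : ℝ) • J 0) := by
    ext1 u
    simp [hF, Fin.sum_univ_three, hJ.app00, hJ.app11, hJ.app22, hJ.app01, hJ.app10,
      hJ.app02, hJ.app20, hJ.app12, hJ.app21]
  have h0 := key 0 1 (by decide)
  have h1 := key 1 0 (by decide)
  have h2 := key 2 0 (by decide)
  rw [e0] at h0
  rw [e1] at h1
  rw [e2] at h2
  simp only [map_add, map_smul, tJ, hb.trace_one, smul_eq_mul, mul_zero, eps,
    Matrix.cons_val_zero, Matrix.cons_val_one] at h0 h1 h2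
  exact ⟨by linarith, by linarith, by linarith⟩

namespace IsHorizontalCurvature
variable {K : Fin 3 → Fin 3 → Module.End ℝ E}
  {R : E → E → Module.End ℝ E} (hR : IsHorizontalCurvature g J T K R) (hJ : IsUnits g J)
  (hb : IsOrthonormalBasis g b)
include hR hJ hb

omit hJ in
/-- The trace of the Bianchi identity against an endomorphism. -/
lemma trace_bianchi (t : Fin 3) (hT : ∀ s, LinearMap.trace ℝ E (J t * T s) = 0) (u v : E) :
    ricciForm g b R u (J t v) - ∑ r, g (K r t (J r v)) u - ricciForm g b R v (J t u)
        + ∑ r, g (K r t (J r u)) v + LinearMap.trace ℝ E (J t * R u v)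
      = ∑ s, -2 * eps s * (g (J s (J t (T s v))) u + g (J t (T s u)) (J s v)) := by
  -- Moving J_t inside the curvature gives a Ricci term with J_t v, at the cost of the coefficients
  -- K.
  have h1 : ∀ u v, ∑ a, g (b a) (b a) * g (J t (R (b a) u v)) (b a)
      = ricciForm g b R u (J t v) - ∑ r, g (K r t (J r v)) u := by
    intro u v
    have e : ∀ r, g (K r t (J r v)) u
        = ∑ a, g (b a) (b a) * g (J r v) (b a) * g (K r t (b a)) u := fun r => by
      have := hb.sum_apply (J r v) (g.flip u ∘ₗ K r t)
      exact this.symm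
    simp only [e]
    rw [Finset.sum_comm, ricciForm, ← Finset.sum_sub_distrib]
    refine Finset.sum_congr rfl fun a _ => ?_
    rw [hR.unit, map_add, LinearMap.add_apply, map_sum, LinearMap.sum_apply, mul_add,
      Finset.mul_sum, ← sub_eq_zero]
    simp only [map_smul, LinearMap.smul_apply, smul_eq_mul, Fin.sum_univ_three]
    ring
  have h2 : ∑ a, g (b a) (b a) * g (J t (R (b a) u v + R u v (b a) + R v (b a) u)) (b a)
      = ricciForm g b R u (J t v) - ∑ r, g (K r t (J r v)) u - ricciForm g b R v (J t u)
        + ∑ r, g (K r t (J r u)) v + LinearMap.trace ℝ E (J t * R u v) := by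
    have e : ∀ a, R v (b a) u = - R (b a) v u := fun a => by rw [hR.swap]; rfl
    simp only [e, map_add, map_neg, LinearMap.add_apply, LinearMap.neg_apply, mul_add,
      Finset.sum_add_distrib, mul_neg, Finset.sum_neg_distrib, h1]
    rw [hb.trace_eq]
    simp only [Module.End.mul_apply]
    ring
  have h3 : ∀ s (w z : E), ∑ a, g (b a) (b a) * ((-2 * eps s * g (J s (b a)) w) * g (J t z) (b a))
      = -2 * eps s * g (J s (J t z)) w := fun s w z => by
    have := hb.sum_apply (J t z) (g.flip w ∘ₗ J s)
    rw [show g (J s (J t z)) w = (g.flip w ∘ₗ J s) (J t z) from rfl, ← this, Finset.mul_sum]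
    refine Finset.sum_congr rfl fun a _ => ?_
    change _ = -2 * eps s * (g (b a) (b a) * g (J t z) (b a) * g (J s (b a)) w)
    ring
  have h4 : ∀ s (w z : E), ∑ a, g (b a) (b a) * ((-2 * eps s * g (J s w) (b a)) * g (J t z) (b a))
      = -2 * eps s * g (J t z) (J s w) := fun s w z => by
    have := hb.sum_apply (J s w) (g (J t z))
    rw [← this, Finset.mul_sum]
    exact Finset.sum_congr rfl fun a _ => by ring
  rw [← h2]
  simp only [hR.bianchi, map_sum, map_add, map_smul, LinearMap.sum_apply, LinearMap.add_apply,
    LinearMap.smul_apply, smul_eq_mul]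
  simp only [Finset.mul_sum]
  rw [Finset.sum_comm]
  refine Finset.sum_congr rfl fun s _ => ?_
  simp only [mul_add, Finset.sum_add_distrib, h3, h4]
  -- The summand in which u and v are paired by ω_s is a multiple of tr(J_t T_s) and drops out.
  have h5 : ∑ a, g (b a) (b a) * (-2 * eps s * g (J s u) v * g (J t (T s (b a))) (b a)) = 0 := by
    have := hT s
    rw [hb.trace_eq] at this
    rw [show (0 : ℝ) = (-2 * eps s * g (J s u) v) * 0 by ring, ← this, Finset.mul_sum]
    exact Finset.sum_congr rfl fun a _ => by rw [Module.End.mul_apply]; ring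
  rw [h5]
  ring

/-- The Ricci form is symmetric if the torsion endomorphisms vanish. -/
lemma ricci_symm (hT : ∀ s, T s = 0) (u v : E) : ricciForm g b R u v = ricciForm g b R v u := by
  have h : ∑ a, g (b a) (b a) * g (R (b a) u v + R u v (b a) + R v (b a) u) (b a) = 0 := by
    refine Finset.sum_eq_zero fun a _ => ?_
    rw [hR.bianchi]
    simp [hT]
  have e : ∀ a, R v (b a) u = - R (b a) v u := fun a => by rw [hR.swap]; rfl
  have h2 := hb.trace_skew (hR.skew u v) hJ.symm
  rw [hb.trace_eq] at h2
  simp only [e, map_add, map_neg, LinearMap.add_apply, LinearMap.neg_apply, mul_add,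
      Finset.sum_add_distrib, mul_neg, Finset.sum_neg_distrib, h2] at h
  simp only [ricciForm]
  linarith

end IsHorizontalCurvature
end
end PQC

/-! ### The Ricci tensor and the Einstein condition. -/

namespace PQC
section

set_option linter.unusedSimpArgs false

variable {E : Type*} [AddCommGroup E] [Module ℝ E] {g : LinearMap.BilinForm ℝ E}
    {J : Fin 3 → Module.End ℝ E} {ι : Type*} [Fintype ι] {b : Module.Basis ι ℝ E}
    {T : Fin 3 → Module.End ℝ E} {Λ : Fin 3 → Fin 3 → Fin 3 → ℝ} {m p q r : Module.End ℝ E} {l : ℝ}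

lemma IsUnits.adj_right (hJ : IsUnits g J) (s : Fin 3) (u v : E) :
    g u (J s v) = g (-J s u) v := by
  rw [map_neg, LinearMap.neg_apply, hJ.skew, neg_neg]

/-- The component of J_t T_s along the identity is ±m, ±p, ±q or ±r: m is trace-free by
normalization and the others are skew. Components along the units never contribute. -/
lemma TorsionForm.trace_unit_torsion (h : TorsionForm g J T Λ m p q r l) (hJ : IsUnits g J)
    (hb : IsOrthonormalBasis g b) (t s : Fin 3) : LinearMap.trace ℝ E (J t * T s) = 0 := by
  have hp := hb.trace_skew h.sp hJ.symm
  have hq := hb.trace_skew h.sq hJ.symm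
  have hr := hb.trace_skew h.sr hJ.symm
  have key : ∀ {A₀ A₁ A₂ : Module.End ℝ E} (c₀ c₁ c₂ : ℝ) (a : ℝ), CommutesWith J A₀ →
      CommutesWith J A₁ → CommutesWith J A₂ → ∀ {B : Module.End ℝ E}, LinearMap.trace ℝ E B = 0 →
      (∀ u, J t (T s u) = a • B u + c₀ • J 0 (A₀ u) + c₁ • J 1 (A₁ u) + c₂ • J 2 (A₂ u)) →
      LinearMap.trace ℝ E (J t * T s) = 0 := by
    intro A₀ A₁ A₂ c₀ c₁ c₂ a h₀ h₁ h₂ B hB he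
    have : J t * T s = a • B + c₀ • (J 0 * A₀) + c₁ • (J 1 * A₁) + c₂ • (J 2 * A₂) :=
      LinearMap.ext he
    rw [this]
    simp [hB, hJ.trace_unit_mul h₀, hJ.trace_unit_mul h₁, hJ.trace_unit_mul h₂]
  fin_cases t <;> fin_cases s
  · refine key 0 1 1 1 h.cm h.cq h.cp h.tm fun u => ?_
    simp [h.t0, hJ.app00, hJ.app01, hJ.app02]; abel
  · refine key 0 1 1 (-1) h.cm h.cr h.cm hp fun u => ?_
    simp [h.t1, hJ.app00, hJ.app01, hJ.app02]; abel
  · refine key 0 1 1 1 h.cm h.cm h.cr hq fun u => ?_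
    simp [h.t2, hJ.app00, hJ.app01, hJ.app02]; abel
  · refine key (-1) 0 (-1) 1 h.cq h.cm h.cm hp fun u => ?_
    simp [h.t0, hJ.app10, hJ.app11, hJ.app12]; abel
  · refine key (-1) 0 1 1 h.cr h.cm h.cp h.tm fun u => ?_
    simp [h.t1, hJ.app10, hJ.app11, hJ.app12]; abel
  · refine key (-1) 0 (-1) 1 h.cm h.cm h.cq hr fun u => ?_
    simp [h.t2, hJ.app10, hJ.app11, hJ.app12]; abel
  · refine key 1 (-1) 0 (-1) h.cp h.cm h.cm hq fun u => ?_
    simp [h.t0, hJ.app20, hJ.app21, hJ.app22]; abel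
  · refine key 1 1 0 (-1) h.cm h.cp h.cm hr fun u => ?_
    simp [h.t1, hJ.app20, hJ.app21, hJ.app22]; abel
  · refine key 1 (-1) 0 (-1) h.cr h.cq h.cm h.tm fun u => ?_
    simp [h.t2, hJ.app20, hJ.app21, hJ.app22]; abel

variable {R : E → E → Module.End ℝ E}

/-- With tr(J_t R(u,v)) known from `trace_mul_curvature`, the only unknown in this identity is the
Ricci form. It serves both directions of the Einstein criterion. -/
lemma TorsionForm.trace_equation (h : TorsionForm g J T Λ m p q r l) (hJ : IsUnits g J)
    (hb : IsOrthonormalBasis g b)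
    (hR : IsHorizontalCurvature g J T (curvCoeff J m p q r l) R) (t : Fin 3) (u v : E) :
    ricciForm g b R u (J t v) - ricciForm g b R v (J t u)
      + ∑ r', (g (curvCoeff J m p q r l r' t (J r' u)) v
      - g (J r' (curvCoeff J m p q r l r' t u)) v) + LinearMap.trace ℝ E (J t * R u v)
      = ∑ s, -2 * eps s * (g (J t (T s u)) (J s v) + g (J t (J s u)) (T s v)) := by
  have h1 := hR.trace_bianchi hb t (h.trace_unit_torsion hJ hb t) u v
  have e1 : ∀ r', g (curvCoeff J m p q r l r' t (J r' v)) u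
      = g (J r' (curvCoeff J m p q r l r' t u)) v := fun r' => by
    rw [h.curvCoeff_skew hJ, hJ.skew r' v, neg_neg, hJ.symm]
  have e2 : ∀ s, g (J s (J t (T s v))) u = g (J t (J s u)) (T s v) := fun s => by
    rw [hJ.skew, hJ.skew, neg_neg, hJ.symm]
  simp only [e1, e2] at h1
  rw [Finset.sum_sub_distrib]
  simp only [add_comm (g (J t (T _ u)) _)]
  linarith

/-- Pointwise Einstein implies that the torsion vanishes. -/
theorem TorsionForm.eq_zero_of_einstein [Nontrivial E] (h : TorsionForm g J T Λ m p q r l)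
    (hJ : IsUnits g J)
    (hb : IsOrthonormalBasis g b)
    (hR : IsHorizontalCurvature g J T (curvCoeff J m p q r l) R) {c : ℝ}
    (hc : ∀ u v, ricciForm g b R u v = c * g u v) : m = 0 ∧ p = 0 ∧ q = 0 ∧ r = 0 := by
  have tr := fun u v => hJ.trace_mul_curvature hb (hR.unit u v)
  have tr0 := fun u v => (tr u v).1
  have tr1 := fun u v => (tr u v).2.1
  have tr2 := fun u v => (tr u v).2.2
  have key := h.trace_equation hJ hb hR
  have hcJ : ∀ t u v, ricciForm g b R u (J t v) - ricciForm g b R v (J t u)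
      = -2 * c * g (J t u) v := fun t u v => by
    rw [hc, hc, hJ.symm v, hJ.adj_right, map_neg, LinearMap.neg_apply]; ring
  simp only [hcJ] at key
  have k0 := key 0
  have k1 := key 1
  have k2 := key 2
  simp only [Fin.sum_univ_three, tr0, tr1, tr2, h.adj0 hJ, h.adj1 hJ, h.adj2 hJ] at k0 k1 k2
  have z : CommutesWith J (0 : Module.End ℝ E) := fun s u => by simp
  let d : ℝ := Fintype.card ι
  have hd : 0 ≤ d := Nat.cast_nonneg _
  -- Call this endomorphism B. The equations for t = 0, 1, 2 read -(2d+8) r + J_0 B = 0, (2d+8) q +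
  -- J_1 B = 0 and -(2d+8) p + J_2 B = 0. Independence over the units separates them, and tr B = 0
  -- removes the scalar part of B.
  have cB : CommutesWith J ((2 * d + 20) • m + (8 * l + d * l - 2 * c) • 1) :=
    (h.cm.smul _).add (CommutesWith.one.smul _)
  have r0 := hJ.components_eq_zero (h.cr.smul (-(2 * d + 8))) cB z z (fun u => by
    refine hJ.nondeg _ fun v => ?_
    have h1 := k0 u v
    simp only [hJ.adj_right, h.t0, h.t1, h.t2, h.cm _ _, h.cp _ _, h.cq _ _, h.cr _ _, map_add,
      map_sub, map_neg, curvCoeff, Module.End.mul_apply, Module.End.one_apply,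
      LinearMap.add_apply, LinearMap.neg_apply, LinearMap.sub_apply, LinearMap.smul_apply,
      LinearMap.zero_apply, map_smul, smul_eq_mul, map_zero, eps, Matrix.cons_val_zero,
      Matrix.cons_val_one, Matrix.cons_val, hJ.app00, hJ.app11, hJ.app22, hJ.app01, hJ.app10,
      hJ.app02, hJ.app20, hJ.app12, hJ.app21] at h1 ⊢
    simp only [d]
    linarith)
  have r1 := hJ.components_eq_zero (h.cq.smul (2 * d + 8)) z cB z (fun u => by
    refine hJ.nondeg _ fun v => ?_
    have h1 := k1 u v
    simp only [hJ.adj_right, h.t0, h.t1, h.t2, h.cm _ _, h.cp _ _, h.cq _ _, h.cr _ _, map_add,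
      map_sub, map_neg, curvCoeff, Module.End.mul_apply, Module.End.one_apply,
      LinearMap.add_apply, LinearMap.neg_apply, LinearMap.sub_apply, LinearMap.smul_apply,
      LinearMap.zero_apply, map_smul, smul_eq_mul, map_zero, eps, Matrix.cons_val_zero,
      Matrix.cons_val_one, Matrix.cons_val, hJ.app00, hJ.app11, hJ.app22, hJ.app01, hJ.app10,
      hJ.app02, hJ.app20, hJ.app12, hJ.app21] at h1 ⊢
    simp only [d]
    linarith)
  have r2 := hJ.components_eq_zero (h.cp.smul (-(2 * d + 8))) z z cB (fun u => by
    refine hJ.nondeg _ fun v => ?_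
    have h1 := k2 u v
    simp only [hJ.adj_right, h.t0, h.t1, h.t2, h.cm _ _, h.cp _ _, h.cq _ _, h.cr _ _, map_add,
      map_sub, map_neg, curvCoeff, Module.End.mul_apply, Module.End.one_apply,
      LinearMap.add_apply, LinearMap.neg_apply, LinearMap.sub_apply, LinearMap.smul_apply,
      LinearMap.zero_apply, map_smul, smul_eq_mul, map_zero, eps, Matrix.cons_val_zero,
      Matrix.cons_val_one, Matrix.cons_val, hJ.app00, hJ.app11, hJ.app22, hJ.app01, hJ.app10,
      hJ.app02, hJ.app20, hJ.app12, hJ.app21] at h1 ⊢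
    simp only [d]
    linarith)
  have hB := r0.2.1
  have hι : (Fintype.card ι : ℝ) ≠ 0 := by
    have : Nonempty ι := b.index_nonempty
    exact_mod_cast Fintype.card_ne_zero
  have ht := congrArg (LinearMap.trace ℝ E) hB
  rw [map_add, map_smul, map_smul, h.tm, hb.trace_one, smul_zero, zero_add, map_zero,
    smul_eq_mul] at ht
  rw [(mul_eq_zero.1 ht).resolve_right hι, zero_smul, add_zero] at hB
  exact ⟨(smul_eq_zero.1 hB).resolve_left (by positivity),
    (smul_eq_zero.1 r2.1).resolve_left (neg_ne_zero.2 (by positivity)),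
    (smul_eq_zero.1 r1.1).resolve_left (by positivity),
    (smul_eq_zero.1 r0.1).resolve_left (neg_ne_zero.2 (by positivity))⟩

/-- The Ricci form of a structure with vanishing torsion endomorphisms. -/
theorem TorsionForm.ricci_eq (h : TorsionForm g J T Λ 0 0 0 0 l)
    (hJ : IsUnits g J) (hb : IsOrthonormalBasis g b)
    (hR : IsHorizontalCurvature g J T (curvCoeff J 0 0 0 0 l) R)
    (hRn : ∀ a u v, R a (-u) v = -R a u v) (u v : E) :
    ricciForm g b R u v = (Fintype.card ι / 2 + 4) * l * g u v := by
  have hT := h.torsion_eq_zero ⟨rfl, rfl, rfl, rfl⟩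
  have tr := fun u v => hJ.trace_mul_curvature hb (hR.unit u v)
  have tr0 := fun u v => (tr u v).1
  have tr1 := fun u v => (tr u v).2.1
  have tr2 := fun u v => (tr u v).2.2
  have key := h.trace_equation hJ hb hR
  -- The contracted identity says that every J_t is self-adjoint for this F. The constant d/2 + 4 is
  -- the one for which g, to which the units are skew, absorbs the inhomogeneous term.
  set F : E → E → ℝ := fun u v => ricciForm g b R u v - (Fintype.card ι / 2 + 4) * l * g u v
  have hFJ : ∀ t u v, F u (J t v) = F (J t u) v := by
    intro t u v
    have h1 := key t u v
    rw [hR.ricci_symm hJ hb hT v] at h1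
    simp only [F]
    revert h1
    fin_cases t <;> intro h1 <;>
    simp only [Fin.zero_eta, Fin.mk_one, Fin.reduceFinMk, Fin.sum_univ_three, tr0, tr1, tr2, hT,
      curvCoeff, Module.End.mul_apply, mul_zero, smul_zero,
      LinearMap.add_apply, LinearMap.smul_apply, add_zero, zero_add, zero_sub,
      LinearMap.zero_apply, map_smul, smul_eq_mul, map_zero, map_neg, LinearMap.neg_apply,
      Matrix.cons_val_zero, Matrix.cons_val_one, Matrix.cons_val, hJ.app00, hJ.app11, hJ.app22,
      hJ.app01, hJ.app10, hJ.app02, hJ.app20, hJ.app12, hJ.app21, hJ.adj_right] at h1 ⊢ <;>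
    linarith
  have hFn : ∀ u v, F (-u) v = - F u v := fun u v => by
    simp only [F, ricciForm, hRn, map_neg, LinearMap.neg_apply, mul_neg, Finset.sum_neg_distrib]
    ring
  -- Passing J_2 = J_0 J_1 across F factor by factor reverses the product to J_1 J_0 = -J_2, while
  -- J_2 itself passes without a sign. Hence F(J_2 u, v) is its own negative.
  have hF2 : ∀ u v, F (J 2 u) v = 0 := by
    intro u v
    have h1 : F (J 2 u) v = - F (J 2 u) v := by
      conv_lhs => rw [← hJ.app01, ← hFJ, ← hFJ, hJ.app10]
      rw [← hFJ]
      simp only [F, ricciForm, map_neg, LinearMap.neg_apply, mul_neg, Finset.sum_neg_distrib]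
      ring
    linarith
  have h1 := hFn u v
  rw [← hJ.app22, hF2] at h1
  have : F u v = 0 := by linarith
  simp only [F] at this
  linarith

end
end PQC

/-! ### Linear algebra of the mixed curvature R(ξ_s, X). -/

namespace PQC
section

set_option linter.unusedSimpArgs false

variable {E : Type*} [AddCommGroup E] [Module ℝ E] {g : LinearMap.BilinForm ℝ E}
    {J : Fin 3 → Module.End ℝ E} {ι : Type*} [Fintype ι] {b : Module.Basis ι ℝ E}
    {T : Fin 3 → Module.End ℝ E} {Λ : Fin 3 → Fin 3 → Fin 3 → ℝ} {m p q r : Module.End ℝ E} {l : ℝ}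

lemma IsOrthonormalBasis.exists_dual (hb : IsOrthonormalBasis g b) (f : E →ₗ[ℝ] ℝ) :
    ∃ k, ∀ u, f u = g k u := by
  refine ⟨∑ a, (g (b a) (b a) * f (b a)) • b a, fun u => ?_⟩
  have h := hb.sum_smul u
  conv_lhs => rw [← h]
  simp only [map_sum, map_smul, LinearMap.sum_apply, LinearMap.smul_apply, smul_eq_mul]
  refine Finset.sum_congr rfl fun a _ => ?_
  have : g u (b a) = g (b a) u := by
    conv_lhs => rw [← h]
    conv_rhs => rw [← h]
    simp only [map_sum, map_smul, LinearMap.sum_apply, LinearMap.smul_apply, smul_eq_mul]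
    rw [Finset.sum_eq_single a, Finset.sum_eq_single a]
    · intro c _ hc; rw [hb.orth a c (Ne.symm hc), mul_zero]
    · simp
    · intro c _ hc; rw [hb.orth c a hc, mul_zero]
    · simp
  rw [this]
  ring

/-- In a full contraction a skew J_t moves from one slot to the other with a sign. -/
lemma IsUnits.sum_unit_left (hJ : IsUnits g J) (hb : IsOrthonormalBasis g b) (t : Fin 3)
    (B : E →ₗ[ℝ] E →ₗ[ℝ] ℝ) :
    ∑ a, g (b a) (b a) * B (J t (b a)) (b a) = - ∑ a, g (b a) (b a) * B (b a) (J t (b a)) := by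
  have h1 : ∀ a, B (J t (b a)) (b a) = ∑ c, g (b c) (b c) * g (J t (b a)) (b c) * B (b c) (b a) :=
    fun a => (hb.sum_apply (J t (b a)) (B.flip (b a))).symm
  have h2 : ∀ a, B (b a) (J t (b a)) = ∑ c, g (b c) (b c) * g (J t (b a)) (b c) * B (b a) (b c) :=
    fun a => (hb.sum_apply (J t (b a)) (B (b a))).symm
  simp only [h1, h2, Finset.mul_sum]
  rw [Finset.sum_comm, ← Finset.sum_neg_distrib]
  refine Finset.sum_congr rfl fun a _ => ?_
  rw [← Finset.sum_neg_distrib]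
  refine Finset.sum_congr rfl fun c _ => ?_
  rw [hJ.skew t (b c), hJ.symm (b c) (J t (b a))]
  ring

lemma IsUnits.sum_unit_unit (hJ : IsUnits g J) (hb : IsOrthonormalBasis g b) (t s : Fin 3) :
    ∑ a, g (b a) (b a) * g (J t (b a)) (J s (b a))
      = if t = s then - eps t * Fintype.card ι else 0 := by
  have h1 := hb.trace_eq (J s * J t)
  have h2 : LinearMap.trace ℝ E (J s * J t) = if t = s then eps t * Fintype.card ι else 0 := by
    have h3 := congrArg (LinearMap.trace ℝ E) (hJ.anticomm s t)
    rw [map_add, LinearMap.trace_mul_comm ℝ (J t)] at h3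
    by_cases h : t = s
    · subst h
      rw [if_pos rfl, map_smul, hb.trace_one, smul_eq_mul] at h3
      rw [if_pos rfl]; linarith
    · rw [if_neg (Ne.symm h), map_zero] at h3
      rw [if_neg h]; linarith
  have h3 : ∑ a, g (b a) (b a) * g (J t (b a)) (J s (b a)) = - LinearMap.trace ℝ E (J s * J t) := by
    rw [h1, ← Finset.sum_neg_distrib]
    refine Finset.sum_congr rfl fun a _ => ?_
    rw [Module.End.mul_apply, hJ.skew s]; ring
  rw [h3, h2]
  split_ifs <;> ring

/-- An algebraic curvature operator `Q_X` with paraquaternionic symmetries whose antisymmetrization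
is spanned by the fundamental forms has vanishing coefficients if `dim E > 4`. -/
theorem IsUnits.mixed_curvature_eq_zero (hJ : IsUnits g J) (hb : IsOrthonormalBasis g b)
    (hd : 4 < Fintype.card ι) {Q : E →ₗ[ℝ] Module.End ℝ E} {k : Fin 3 → Fin 3 → E} {w : Fin 3 → E}
    (hsk : ∀ X u v, g (Q X u) v = - g u (Q X v))
    (hk : ∀ r s, eps r • k r s + eps s • k s r = 0)
    (hQ : ∀ X s u, Q X (J s u) = J s (Q X u) + ∑ r, g (k r s) X • J r u)
    (hB : ∀ X Y, Q X Y - Q Y X = ∑ t, (-2 * eps t * g (J t X) Y) • w t) :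
    (∀ t, w t = 0) ∧ ∀ r s, k r s = 0 := by
  let ρ : E → ℝ := fun Y => ∑ a, g (b a) (b a) * g (Q (b a) Y) (b a)
  let d : ℝ := Fintype.card ι
  have tr := fun X => hJ.trace_mul_curvature hb (F := Q X) (κ := fun r s => g (k r s) X) (hQ X)
  have contr : ∀ (c : ℝ) t (Y z : E), ∑ a, g (b a) (b a) * ((c * g (J t (b a)) Y) * g z (b a))
      = c * g (J t z) Y := fun c t Y z => by
    have := hb.sum_apply z (g.flip Y ∘ₗ J t)
    rw [show g (J t z) Y = (g.flip Y ∘ₗ J t) z from rfl, ← this, Finset.mul_sum]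
    refine Finset.sum_congr rfl fun a _ => ?_
    change _ = c * (g (b a) (b a) * g z (b a) * g (J t (b a)) Y)
    ring
  -- The antisymmetrization is contracted after applying F. The case F = 1 computes ρ because Q_Y is
  -- traceless, and F = J_t brings in tr(J_t Q_Y), which the coefficients k determine.
  have hB' : ∀ F : Module.End ℝ E, ∀ Y, ∑ a, g (b a) (b a) * g (F (Q (b a) Y)) (b a)
      - LinearMap.trace ℝ E (F * Q Y) = ∑ t, (-2 * eps t) * g (J t (F (w t))) Y := by
    intro F Y
    rw [hb.trace_eq, ← Finset.sum_sub_distrib]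
    have : ∀ a, g (b a) (b a) * g (F (Q (b a) Y)) (b a) - g (b a) (b a) * g ((F * Q Y) (b a)) (b a)
        = ∑ t, g (b a) (b a) * ((-2 * eps t * g (J t (b a)) Y) * g (F (w t)) (b a)) := by
      intro a
      rw [Module.End.mul_apply, ← mul_sub, ← LinearMap.sub_apply, ← map_sub, ← map_sub, hB, map_sum,
        map_sum, LinearMap.sum_apply, Finset.mul_sum]
      simp only [map_smul, LinearMap.smul_apply, smul_eq_mul]
    simp only [this]
    rw [Finset.sum_comm]
    exact Finset.sum_congr rfl fun t _ => contr _ _ _ _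
  have hρ : ∀ Y, ρ Y = g ((-2 : ℝ) • (J 0 (w 0) + J 1 (w 1) - J 2 (w 2))) Y := by
    intro Y
    have h1 := hB' 1 Y
    rw [one_mul, hb.trace_skew (hsk Y) hJ.symm, sub_zero] at h1
    refine Eq.trans h1 ?_
    simp [Fin.sum_univ_three, eps]
    ring
  have hJρ : ∀ t Y, ∑ a, g (b a) (b a) * g (J t (Q (b a) Y)) (b a)
      = ρ (J t Y) - ∑ r, g (k r t) (J r Y) := by
    intro t Y
    have e : ∀ r, g (k r t) (J r Y) = ∑ a, g (b a) (b a) * g (J r Y) (b a) * g (k r t) (b a) :=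
      fun r => (hb.sum_apply (J r Y) (g (k r t))).symm
    simp only [e, ρ]
    rw [Finset.sum_comm, ← Finset.sum_sub_distrib]
    refine Finset.sum_congr rfl fun a _ => ?_
    rw [hQ, map_add, LinearMap.add_apply, map_sum, LinearMap.sum_apply]
    simp only [map_smul, LinearMap.smul_apply, smul_eq_mul, Fin.sum_univ_three]
    ring
  have e2 : ∀ t Y, ρ (J t Y) - ∑ r, g (k r t) (J r Y) - LinearMap.trace ℝ E (J t * Q Y)
      = ∑ s, (-2 * eps s) * g (J s (J t (w s))) Y := fun t Y => by
    rw [← hJρ, ← hB' (J t) Y]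
  -- A second, independent contraction: X = b_a and Y = J_t b_a are inserted in the
  -- antisymmetrization and summed.
  have e3 : ∀ t Y, ρ (J t Y) - ∑ r, g (k r t) (J r Y) = d * g (w t) Y := by
    intro t Y
    have h1 : ∑ a, g (b a) (b a) * g (Q (b a) (J t (b a)) - Q (J t (b a)) (b a)) Y
        = 2 * d * g (w t) Y := by
      have : ∀ a, g (b a) (b a) * g (Q (b a) (J t (b a)) - Q (J t (b a)) (b a)) Y
          = ∑ s, (-2 * eps s * g (w s) Y) * (g (b a) (b a) * g (J s (b a)) (J t (b a))) := by
        intro a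
        rw [hB, map_sum, LinearMap.sum_apply, Finset.mul_sum]
        refine Finset.sum_congr rfl fun s _ => ?_
        simp only [map_smul, LinearMap.smul_apply, smul_eq_mul]
        ring
      simp only [this]
      rw [Finset.sum_comm]
      simp only [← Finset.mul_sum, hJ.sum_unit_unit hb, mul_ite, mul_zero, Finset.sum_ite_eq',
        Finset.mem_univ, if_true]
      linear_combination (2 * d * g (w t) Y) * eps_mul_self t
    have h2 : ∑ a, g (b a) (b a) * g (Q (b a) (J t (b a))) Y
        = ρ (J t Y) - ∑ r, g (k r t) (J r Y) := by
      have e : ∀ r, g (k r t) (J r Y) = ∑ a, g (b a) (b a) * g (J r Y) (b a) * g (k r t) (b a) :=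
        fun r => (hb.sum_apply (J r Y) (g (k r t))).symm
      simp only [e, ρ]
      rw [Finset.sum_comm, ← Finset.sum_sub_distrib]
      refine Finset.sum_congr rfl fun a _ => ?_
      rw [hQ, map_add, LinearMap.add_apply, map_sum, LinearMap.sum_apply, hJ.skew, hsk,
        hJ.symm (b a) (Q (b a) (J t Y))]
      simp only [map_smul, LinearMap.smul_apply, smul_eq_mul, Fin.sum_univ_three, hJ.skew,
        hJ.symm (b a) (J _ Y)]
      ring
    have h3 : ∑ a, g (b a) (b a) * g (Q (J t (b a)) (b a)) Y
        = - (ρ (J t Y) - ∑ r, g (k r t) (J r Y)) := by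
      rw [← hJρ]
      have := hJ.sum_unit_left hb t (g ∘ₗ Q.flip Y)
      simp only [LinearMap.comp_apply, LinearMap.flip_apply] at this
      have l1 : ∀ a, g (Q (J t (b a)) (b a)) Y = - g (Q (J t (b a)) Y) (b a) := fun a => by
        rw [hsk, hJ.symm]
      have l2 : ∀ a, g (J t (Q (b a) Y)) (b a) = - g (Q (b a) Y) (J t (b a)) := fun a => by
        rw [hJ.skew]
      simp only [l1, l2, mul_neg, Finset.sum_neg_distrib, this, neg_neg]
    simp only [map_sub, LinearMap.sub_apply, mul_sub, Finset.sum_sub_distrib, h2, h3] at h1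
    linarith
  have k01 : k 0 1 = - k 1 0 := by
    have := hk 0 1; simp [eps] at this; exact eq_neg_of_add_eq_zero_left this
  have k02 : k 0 2 = k 2 0 := by
    have := hk 0 2; simp [eps] at this; exact eq_of_sub_eq_zero (by rw [sub_eq_add_neg]; exact this)
  have k12 : k 1 2 = k 2 1 := by
    have := hk 1 2; simp [eps] at this; exact eq_of_sub_eq_zero (by rw [sub_eq_add_neg]; exact this)
  have k00 : k 0 0 = 0 := by
    have := hk 0 0; rw [← two_smul ℝ] at this; simpa [eps] using this
  have k11 : k 1 1 = 0 := by
    have := hk 1 1; rw [← two_smul ℝ] at this; simpa [eps] using this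
  have k22 : k 2 2 = 0 := by
    have := hk 2 2; rw [← two_smul ℝ] at this; simpa [eps] using this
  have a0 : d • w 0 - (d / 2) • k 2 1 = (-2 : ℝ) • w 0 + (2 : ℝ) • J 2 (w 1) - (2 : ℝ) • J 1 (w 2) := by
    rw [← sub_eq_zero]
    refine hJ.nondeg _ fun Y => ?_
    have h1 := e2 0 Y
    rw [e3, (tr Y).1] at h1
    simp only [Fin.sum_univ_three, hJ.app00, hJ.app10, hJ.app20, eps, Matrix.cons_val_zero,
      Matrix.cons_val_one, Matrix.cons_val, map_neg, LinearMap.neg_apply, map_sub, map_add,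
      map_smul, LinearMap.sub_apply, LinearMap.add_apply, LinearMap.smul_apply,
      smul_eq_mul] at h1 ⊢
    linarith
  have a1 : d • w 1 + (d / 2) • k 2 0 = (-2 : ℝ) • w 1 - (2 : ℝ) • J 2 (w 0) + (2 : ℝ) • J 0 (w 2) := by
    rw [← sub_eq_zero]
    refine hJ.nondeg _ fun Y => ?_
    have h1 := e2 1 Y
    rw [e3, (tr Y).2.1] at h1
    simp only [Fin.sum_univ_three, hJ.app01, hJ.app11, hJ.app21, eps, Matrix.cons_val_zero,
      Matrix.cons_val_one, Matrix.cons_val, map_neg, LinearMap.neg_apply, map_sub, map_add,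
      map_smul, LinearMap.sub_apply, LinearMap.add_apply, LinearMap.smul_apply,
      smul_eq_mul] at h1 ⊢
    linarith
  have a2 : d • w 2 - (d / 2) • k 1 0 = (-2 : ℝ) • w 2 - (2 : ℝ) • J 1 (w 0) + (2 : ℝ) • J 0 (w 1) := by
    rw [← sub_eq_zero]
    refine hJ.nondeg _ fun Y => ?_
    have h1 := e2 2 Y
    rw [e3, (tr Y).2.2] at h1
    simp only [Fin.sum_univ_three, hJ.app02, hJ.app12, hJ.app22, eps, Matrix.cons_val_zero,
      Matrix.cons_val_one, Matrix.cons_val, map_neg, LinearMap.neg_apply, map_sub, map_add,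
      map_smul, LinearMap.sub_apply, LinearMap.add_apply, LinearMap.smul_apply,
      smul_eq_mul] at h1 ⊢
    linarith
  have b3 : ∀ t, (2 : ℝ) • J t (J 0 (w 0) + J 1 (w 1) - J 2 (w 2)) + ∑ r, J r (k r t) = d • w t := by
    intro t
    rw [← sub_eq_zero]
    refine hJ.nondeg _ fun Y => ?_
    have h1 := e3 t Y
    rw [hρ] at h1
    simp only [Fin.sum_univ_three, map_neg, LinearMap.neg_apply, map_sub, map_add,
      map_smul, LinearMap.sub_apply, LinearMap.add_apply, LinearMap.smul_apply,
      smul_eq_mul, hJ.skew _ _ Y] at h1 ⊢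
    have h5 : ∀ s, g (J t (J s (w s))) Y = - g (J s (w s)) (J t Y) := fun s => hJ.skew _ _ _
    simp only [hJ.skew] at h1 ⊢
    linarith
  have b0 := b3 0
  have b1 := b3 1
  have b2 := b3 2
  -- Writing the vectors w_t and k_{rs} as units applied to W_i and P_i removes the units from the
  -- equations and leaves a linear system with scalar coefficients.
  obtain ⟨W0, hW0⟩ : ∃ W, w 0 = J 0 W := ⟨J 0 (w 0), by rw [hJ.app00]⟩
  obtain ⟨W1, hW1⟩ : ∃ W, w 1 = J 1 W := ⟨J 1 (w 1), by rw [hJ.app11]⟩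
  obtain ⟨W2, hW2⟩ : ∃ W, w 2 = J 2 W := ⟨-J 2 (w 2), by rw [map_neg, hJ.app22, neg_neg]⟩
  obtain ⟨P0, hP0⟩ : ∃ P, k 2 1 = J 0 P := ⟨J 0 (k 2 1), by rw [hJ.app00]⟩
  obtain ⟨P1, hP1⟩ : ∃ P, k 2 0 = - J 1 P := ⟨-J 1 (k 2 0), by rw [map_neg, hJ.app11, neg_neg]⟩
  obtain ⟨P2, hP2⟩ : ∃ P, k 1 0 = J 2 P := ⟨-J 2 (k 1 0), by rw [map_neg, hJ.app22, neg_neg]⟩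
  have c0 := congrArg (J 0) a0
  have c1 := congrArg (J 1) a1
  have c2 := congrArg (J 2) a2
  replace b0 := congrArg (J 0) b0
  replace b1 := congrArg (J 1) b1
  replace b2 := congrArg (J 2) b2
  simp only [Fin.sum_univ_three, k01, k02, k12, k00, k11, k22, hW0, hW1, hW2, hP0, hP1, hP2,
    map_neg, map_add, map_sub, map_smul, map_zero, hJ.app00, hJ.app11, hJ.app22, hJ.app01, hJ.app10,
    hJ.app02, hJ.app20, hJ.app12, hJ.app21] at c0 c1 c2 b0 b1 b2
  have hd' : (4 : ℝ) < d := by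
    change (4 : ℝ) < (Fintype.card ι : ℝ)
    exact_mod_cast hd
  -- This factor governs the solvability of the system; it vanishes at d = 4, so the method does not
  -- reach dimension seven.
  have hne : (d - 4) * (d + 2) ≠ 0 := (mul_pos (by linarith) (by linarith)).ne'
  have hW : W0 + W1 + W2 = 0 := by
    refine (smul_eq_zero.1 (?_ : ((d - 4) * (d + 2)) • (W0 + W1 + W2) = 0)).resolve_left hne
    linear_combination (norm := module) (4 : ℝ) • (c0 + c1 - c2) - d • (b0 + b1 - b2)
  have hP : P0 + P1 + P2 = 0 := by
    linear_combination (norm := module) (-1 / 2 : ℝ) • (b0 + b1 - b2) + (1 / 2 * (6 - d)) • hW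
  have hw0 : W0 = 0 := by
    refine (smul_eq_zero.1 (?_ : ((d - 4) * (d + 2)) • W0 = 0)).resolve_left hne
    linear_combination (norm := module) (-2 : ℝ) • c0 - d • b0 + (2 * d - 4) • hW - d • hP
  have hw1 : W1 = 0 := by
    refine (smul_eq_zero.1 (?_ : ((d - 4) * (d + 2)) • W1 = 0)).resolve_left hne
    linear_combination (norm := module) (-2 : ℝ) • c1 - d • b1 + (2 * d - 4) • hW - d • hP
  have hw2 : W2 = 0 := by
    refine (smul_eq_zero.1 (?_ : ((d - 4) * (d + 2)) • W2 = 0)).resolve_left hne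
    linear_combination (norm := module) (2 : ℝ) • c2 + d • b2 + (2 * d - 4) • hW - d • hP
  have hp0 : P0 = 0 := by
    linear_combination (norm := module) b0 + d • hw0 - (2 : ℝ) • hW + hP
  have hp1 : P1 = 0 := by
    linear_combination (norm := module) b1 + d • hw1 - (2 : ℝ) • hW + hP
  have hp2 : P2 = 0 := by
    linear_combination (norm := module) - b2 + d • hw2 - (2 : ℝ) • hW + hP
  have z10 : k 1 0 = 0 := by rw [hP2, hp2, map_zero]
  have z20 : k 2 0 = 0 := by rw [hP1, hp1, map_zero, neg_zero]
  have z21 : k 2 1 = 0 := by rw [hP0, hp0, map_zero]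
  refine ⟨fun t => ?_, fun r s => ?_⟩
  · fin_cases t
    · exact hW0.trans (by rw [hw0, map_zero])
    · exact hW1.trans (by rw [hw1, map_zero])
    · exact hW2.trans (by rw [hw2, map_zero])
  · fin_cases r <;> fin_cases s
    · exact k00
    · exact k01.trans (by rw [z10, neg_zero])
    · exact k02.trans z20
    · exact z10
    · exact k11
    · exact k12.trans z21
    · exact z20
    · exact z21
    · exact k22

end
end PQC

/-! ### Endomorphisms annihilating the fundamental four-form. -/

namespace PQC
section

set_option linter.unusedSimpArgs false

variable {E : Type*} [AddCommGroup E] [Module ℝ E] {g : LinearMap.BilinForm ℝ E}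
    {J : Fin 3 → Module.End ℝ E} {ι : Type*} [Fintype ι] {b : Module.Basis ι ℝ E}
    {T : Fin 3 → Module.End ℝ E} {Λ : Fin 3 → Fin 3 → Fin 3 → ℝ} {m p q r : Module.End ℝ E} {l : ℝ}

/-- Contraction of `∑_r N_r ∧ ω_r = 0` with a unit. -/
lemma IsUnits.contract_wedge (hJ : IsUnits g J) (hb : IsOrthonormalBasis g b)
    {N : Fin 3 → Module.End ℝ E} (hN : ∀ r u v, g (N r u) v = - g u (N r v))
    (h : ∀ X Y Z U, ∑ r, (g (N r X) Y * g (J r Z) U + g (N r Z) U * g (J r X) Y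
      - g (N r X) Z * g (J r Y) U - g (N r Y) U * g (J r X) Z
      + g (N r X) U * g (J r Y) Z + g (N r Y) Z * g (J r X) U) = 0) (t : Fin 3) (X : E) :
    (-eps t * Fintype.card ι) • N t X - ∑ r, LinearMap.trace ℝ E (J t * N r) • J r X
      + (2 : ℝ) • ∑ r, (J r (J t (N r X)) + N r (J t (J r X))) = 0 := by
  refine hJ.nondeg _ fun Y => ?_
  -- The pair (Z, U) = (b_a, J_t b_a) is inserted and summed over the basis.
  have h0 : ∑ a, g (b a) (b a) * ∑ r, (g (N r X) Y * g (J r (b a)) (J t (b a))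
      + g (N r (b a)) (J t (b a)) * g (J r X) Y
      - g (N r X) (b a) * g (J r Y) (J t (b a)) - g (N r Y) (J t (b a)) * g (J r X) (b a)
      + g (N r X) (J t (b a)) * g (J r Y) (b a) + g (N r Y) (b a) * g (J r X) (J t (b a))) = 0 :=
    Finset.sum_eq_zero fun a _ => by rw [h, mul_zero]
  simp only [Finset.mul_sum] at h0
  rw [Finset.sum_comm] at h0
  have key : ∀ r, ∑ a, g (b a) (b a) * (g (N r X) Y * g (J r (b a)) (J t (b a))
      + g (N r (b a)) (J t (b a)) * g (J r X) Y
      - g (N r X) (b a) * g (J r Y) (J t (b a)) - g (N r Y) (J t (b a)) * g (J r X) (b a)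
      + g (N r X) (J t (b a)) * g (J r Y) (b a) + g (N r Y) (b a) * g (J r X) (J t (b a)))
      = g (N r X) Y * (if r = t then - eps r * Fintype.card ι else 0)
        - LinearMap.trace ℝ E (J t * N r) * g (J r X) Y
        + 2 * (g (J r (J t (N r X))) Y + g (N r (J t (J r X))) Y) := by
    intro r
    have s1 := hJ.sum_unit_unit hb r t
    have s2 := hb.trace_eq (J t * N r)
    have s3 := hb.sum_apply (N r X) (g (J r Y) ∘ₗ J t)
    have s4 := hb.sum_apply (J r X) (g (N r Y) ∘ₗ J t)
    have s5 := hb.sum_apply (J r Y) (g (N r X) ∘ₗ J t)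
    have s6 := hb.sum_apply (N r Y) (g (J r X) ∘ₗ J t)
    simp only [LinearMap.comp_apply, Module.End.mul_apply] at s2 s3 s4 s5 s6
    have t3 : g (J r Y) (J t (N r X)) = - g (J r (J t (N r X))) Y := by
      rw [hJ.skew, hJ.symm]
    have t4 : g (N r Y) (J t (J r X)) = - g (N r (J t (J r X))) Y := by
      rw [hN, hJ.symm]
    have t5 : g (N r X) (J t (J r Y)) = g (J r (J t (N r X))) Y := by
      rw [hJ.skew, hJ.skew, neg_neg]
    have t6 : g (J r X) (J t (N r Y)) = g (N r (J t (J r X))) Y := by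
      rw [hN, hJ.skew t, neg_neg]
    rw [← s1, s2]
    have e : ∀ A B C D F G : ℝ, A + B - C - D + F + G = A - (-B) + ((-C) + (-D) + F + G) :=
      fun A B C D F G => by ring
    have : 2 * (g (J r (J t (N r X))) Y + g (N r (J t (J r X))) Y)
        = - g (J r Y) (J t (N r X)) - g (N r Y) (J t (J r X)) + g (N r X) (J t (J r Y))
          + g (J r X) (J t (N r Y)) := by rw [t3, t4, t5, t6]; ring
    rw [this, ← s3, ← s4, ← s5, ← s6]
    simp only [Finset.mul_sum, Finset.sum_mul, ← Finset.sum_add_distrib, ← Finset.sum_sub_distrib,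
      ← Finset.sum_neg_distrib]
    refine Finset.sum_congr rfl fun a _ => ?_
    rw [hJ.skew t]
    ring
  simp only [key] at h0
  simp only [map_add, map_sub, map_smul, map_sum, LinearMap.add_apply, LinearMap.sub_apply,
    LinearMap.smul_apply, LinearMap.sum_apply, smul_eq_mul, Finset.mul_sum]
  rw [← h0]
  simp only [Finset.sum_add_distrib, Finset.sum_sub_distrib, mul_ite, mul_zero,
    Finset.sum_ite_eq', Finset.mem_univ, if_true, Finset.mul_sum, mul_add]
  ring

/-- The torsion vanishes if it annihilates the fundamental four-form. -/
theorem TorsionForm.eq_zero_of_annihilates [Nontrivial E] (h : TorsionForm g J T Λ m p q r l)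
    (hJ : IsUnits g J) (hb : IsOrthonormalBasis g b) (hd : 4 < Fintype.card ι)
    (hΩ : ∀ s X Y Z U, ∑ a, eps a *
      ((g (J a (T s X)) Y + g (J a X) (T s Y)) * g (J a Z) U
        + (g (J a (T s Z)) U + g (J a Z) (T s U)) * g (J a X) Y
        - (g (J a (T s X)) Z + g (J a X) (T s Z)) * g (J a Y) U
        - (g (J a (T s Y)) U + g (J a Y) (T s U)) * g (J a X) Z
        + (g (J a (T s X)) U + g (J a X) (T s U)) * g (J a Y) Z
        + (g (J a (T s Y)) Z + g (J a Y) (T s Z)) * g (J a X) U) = 0) :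
    m = 0 ∧ p = 0 ∧ q = 0 ∧ r = 0 := by
  -- The derivation action does not see the vertical torsion. With Λ = 0 and l = 0 the identity
  -- `curvCoeff_eq` describes exactly the skew forms g(J_a T_s ·,·) + g(J_a ·, T_s ·).
  have h' : TorsionForm g J T (fun _ _ _ => 0) m p q r 0 :=
    ⟨h.cm, h.cp, h.cq, h.cr, h.sm, h.sp, h.sq, h.sr, h.tm, h.t0, h.t1, h.t2, by simp⟩
  have hn : ∀ a s u v, g (J a (T s u)) v + g (J a u) (T s v)
      = -1 / 2 * eps a * g (curvCoeff J m p q r 0 a s u) v := by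
    intro a s u v
    have h1 := h'.curvCoeff_eq hJ a s u v
    simp only [mul_zero, Finset.sum_const_zero, add_zero] at h1
    rw [← h1]
    linear_combination - (g (J a (T s u)) v + g (J a u) (T s v)) * eps_mul_self a
  have key := fun s => hJ.contract_wedge hb (N := fun a => curvCoeff J m p q r 0 a s)
    (fun a u v => h'.curvCoeff_skew hJ a s u v) (fun X Y Z U => by
      have h1 := hΩ s X Y Z U
      simp only [hn] at h1
      have h2 : (-1 / 2 : ℝ) * ∑ a, (g (curvCoeff J m p q r 0 a s X) Y * g (J a Z) U
          + g (curvCoeff J m p q r 0 a s Z) U * g (J a X) Y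
          - g (curvCoeff J m p q r 0 a s X) Z * g (J a Y) U
          - g (curvCoeff J m p q r 0 a s Y) U * g (J a X) Z
          + g (curvCoeff J m p q r 0 a s X) U * g (J a Y) Z
          + g (curvCoeff J m p q r 0 a s Y) Z * g (J a X) U) = 0 := by
        refine Eq.trans ?_ h1
        rw [Finset.mul_sum]
        refine Finset.sum_congr rfl fun a _ => ?_
        have e := eps_mul_self a
        generalize g (curvCoeff J m p q r 0 a s X) Y = x1
        generalize g (curvCoeff J m p q r 0 a s X) Z = x2
        generalize g (curvCoeff J m p q r 0 a s X) U = x3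
        generalize g (curvCoeff J m p q r 0 a s Y) Z = x4
        generalize g (curvCoeff J m p q r 0 a s Y) U = x5
        generalize g (curvCoeff J m p q r 0 a s Z) U = x6
        linear_combination (1 / 2 * (x1 * g (J a Z) U + x6 * g (J a X) Y - x2 * g (J a Y) U
          - x5 * g (J a X) Z + x3 * g (J a Y) Z + x4 * g (J a X) U)) * e
      exact (mul_eq_zero.1 h2).resolve_left (by norm_num))
  let d : ℝ := Fintype.card ι
  have hd' : (4 : ℝ) < d := by
    change (4 : ℝ) < (Fintype.card ι : ℝ)
    exact_mod_cast hd
  -- These traces multiply bare units, so they never enter the identity component and need not be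
  -- evaluated; beside m they disappear on taking the trace, as tr m = 0.
  let ν : Fin 3 → Fin 3 → Fin 3 → ℝ := fun a s t =>
    LinearMap.trace ℝ E (J t * curvCoeff J m p q r 0 a s)
  have hν : ∀ a s t, LinearMap.trace ℝ E (J t * curvCoeff J m p q r 0 a s) = ν a s t :=
    fun _ _ _ => rfl
  simp only [hν] at key
  have cs : ∀ c : ℝ, CommutesWith J (c • 1) := fun c => CommutesWith.one.smul c
  -- The contractions with (s,t) = (0,1), (0,2), (1,2) have identity components (4d-16) p, -(4d-16)
  -- q, -(4d-16) r. The factor vanishes at d = 4, while m comes with ±4d.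
  have r01 := hJ.components_eq_zero (h.cp.smul (4 * d - 16)) (cs (- ν 0 0 1)) (cs (- ν 1 0 1))
    ((h.cm.smul (-4 * d)).add (cs (-ν 2 0 1))) (fun u => by
      have h1 := key 0 1 u
      simp only [Fin.sum_univ_three, h.cm _ _, h.cp _ _, h.cq _ _, h.cr _ _, map_add,
        map_sub, map_neg, curvCoeff, Module.End.mul_apply, Module.End.one_apply,
        LinearMap.add_apply, LinearMap.neg_apply, LinearMap.sub_apply, LinearMap.smul_apply,
        LinearMap.zero_apply, map_smul, map_zero, eps, Matrix.cons_val_zero,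
        Matrix.cons_val_one, Matrix.cons_val, hJ.app00, hJ.app11, hJ.app22, hJ.app01, hJ.app10,
        hJ.app02, hJ.app20, hJ.app12, hJ.app21] at h1 ⊢
      simp only [d]
      linear_combination (norm := module) h1)
  have r02 := hJ.components_eq_zero (h.cq.smul (-(4 * d - 16))) (cs (- ν 0 0 2)) ((h.cm.smul (-4 * d)).add (cs (-ν 1 0 2)))
    (cs (- ν 2 0 2)) (fun u => by
      have h1 := key 0 2 u
      simp only [Fin.sum_univ_three, h.cm _ _, h.cp _ _, h.cq _ _, h.cr _ _, map_add,
        map_sub, map_neg, curvCoeff, Module.End.mul_apply, Module.End.one_apply,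
        LinearMap.add_apply, LinearMap.neg_apply, LinearMap.sub_apply, LinearMap.smul_apply,
        LinearMap.zero_apply, map_smul, map_zero, eps, Matrix.cons_val_zero,
        Matrix.cons_val_one, Matrix.cons_val, hJ.app00, hJ.app11, hJ.app22, hJ.app01, hJ.app10,
        hJ.app02, hJ.app20, hJ.app12, hJ.app21] at h1 ⊢
      simp only [d]
      linear_combination (norm := module) h1)
  have r12 := hJ.components_eq_zero (h.cr.smul (-(4 * d - 16))) ((h.cm.smul (4 * d)).add (cs (-ν 0 1 2)))
    (cs (- ν 1 1 2)) (cs (- ν 2 1 2)) (fun u => by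
      have h1 := key 1 2 u
      simp only [Fin.sum_univ_three, h.cm _ _, h.cp _ _, h.cq _ _, h.cr _ _, map_add,
        map_sub, map_neg, curvCoeff, Module.End.mul_apply, Module.End.one_apply,
        LinearMap.add_apply, LinearMap.neg_apply, LinearMap.sub_apply, LinearMap.smul_apply,
        LinearMap.zero_apply, map_smul, map_zero, eps, Matrix.cons_val_zero,
        Matrix.cons_val_one, Matrix.cons_val, hJ.app00, hJ.app11, hJ.app22, hJ.app01, hJ.app10,
        hJ.app02, hJ.app20, hJ.app12, hJ.app21] at h1 ⊢
      simp only [d]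
      linear_combination (norm := module) h1)
  have hι : (Fintype.card ι : ℝ) ≠ 0 := by
    have : Nonempty ι := b.index_nonempty
    exact_mod_cast Fintype.card_ne_zero
  have hm := r01.2.2.2
  have ht := congrArg (LinearMap.trace ℝ E) hm
  rw [map_add, map_smul, map_smul, h.tm, hb.trace_one, smul_zero, zero_add, map_zero,
    smul_eq_mul] at ht
  rw [(mul_eq_zero.1 ht).resolve_right hι, zero_smul, add_zero] at hm
  have h4 : 4 * d - 16 ≠ 0 := (by linarith : 0 < 4 * d - 16).ne'
  exact ⟨(smul_eq_zero.1 hm).resolve_left (by linarith : -4 * d < 0).ne,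
    (smul_eq_zero.1 r01.1).resolve_left h4,
    (smul_eq_zero.1 r02.1).resolve_left (neg_ne_zero.2 h4),
    (smul_eq_zero.1 r12.1).resolve_left (neg_ne_zero.2 h4)⟩

end
end PQC

/-! ### The pointwise algebra applied to the canonical connection: part (a). -/

namespace PQC
section Pointwise
variable {n : ℕ} {M : Type*} [TopologicalSpace M] [ChartedSpace (Model n) M]
  [IsManifold 𝓘(ℝ, Model n) ∞ M] {P : Structure n M} {C : CanonicalConnection P}
  {U : Set M} {η : Fin 3 → ∀ x : M, TangentSpace 𝓘(ℝ, Model n) x →L[ℝ] ℝ}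
  {J : Fin 3 → ∀ x : M, Module.End ℝ (P.H x)}
  {ξ : Fin 3 → ∀ x : M, TangentSpace 𝓘(ℝ, Model n) x} {x : M}

lemma Structure.isOrthonormalBasis_basis (P : Structure n M) (x : M) :
    IsOrthonormalBasis (P.g x) (P.basis x) := by
  have h := Classical.choose_spec (P.exists_orthonormal x)
  refine ⟨fun a c hac => (h a c).trans (if_neg hac), fun a => ?_⟩
  have h2 : P.g x (P.basis x a) (P.basis x a) = _ := (h a a).trans (if_pos rfl)
  rw [h2]
  rcases a with a | a <;> simp

lemma card_basis (n : ℕ) : (Fintype.card (Fin (2 * n) ⊕ Fin (2 * n)) : ℝ) = 4 * n := by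
  simp; ring

lemma Structure.trace_g (P : Structure n M) (x : M) (c : ℝ) :
    P.trace x (fun u v => c * P.g x u v) = 4 * n * c := by
  unfold Structure.trace
  rw [← card_basis, Finset.sum_congr rfl fun a _ => show _ = c by
    rw [mul_left_comm, (P.isOrthonormalBasis_basis x).unit, mul_one]]
  simp

lemma ric_eq_ricciForm [T2Space M] (u v : P.H x) :
    C.ric x u v = ricciForm (P.g x) (P.basis x) (fun a b => C.curvEnd x a b) u v := rfl

/-- Elements of sp and of PQ are g-skew, so orthogonality for ⟨·,·⟩ becomes the vanishing of traces
of products. -/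
lemma Structure.endInner_of_skew (P : Structure n M) {T B : Module.End ℝ (P.H x)}
    (hB : ∀ u v, P.g x (B u) v = - P.g x u (B v)) :
    P.endInner x T B = - LinearMap.trace ℝ (P.H x) (B * T) := by
  rw [(P.isOrthonormalBasis_basis x).trace_eq, ← Finset.sum_neg_distrib, Structure.endInner,
    Structure.trace]
  refine Finset.sum_congr rfl fun a _ => ?_
  rw [Module.End.mul_apply, hB]
  ring

namespace IsReebFrame
variable (hF : IsReebFrame P C.V U η J ξ)
include hF

lemma trace_sp_torEnd (hx : x ∈ U) (s : Fin 3) {B : Module.End ℝ (P.H x)}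
    (hB : CommutesWith (fun s => J s x) B) (hsk : ∀ u v, P.g x (B u) v = - P.g x u (B v)) :
    LinearMap.trace ℝ _ (B * C.torEnd x (ξ s x)) = 0 := by
  rw [← neg_eq_zero, ← P.endInner_of_skew hsk]
  refine C.torsion_orthogonal x _ (hF.xi_mem hx s) B (Submodule.mem_sup_left ⟨hsk, fun D hD => ?_⟩)
  rw [hF.gauge.span_eq x hx] at hD
  induction hD using Submodule.span_induction with
  | mem D hD => obtain ⟨t, rfl⟩ := hD; exact LinearMap.ext fun u => hB t u
  | zero => simp
  | add D D' _ _ h h' => rw [mul_add, add_mul, h, h']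
  | smul c D _ h => rw [mul_smul_comm, smul_mul_assoc, h]

lemma trace_unit_torEnd (hx : x ∈ U) (s r : Fin 3) :
    LinearMap.trace ℝ _ (J r x * C.torEnd x (ξ s x)) = 0 := by
  rw [← neg_eq_zero, ← P.endInner_of_skew ((hF.gauge.isUnits hx).skew r)]
  refine C.torsion_orthogonal x _ (hF.xi_mem hx s) _ (Submodule.mem_sup_right ?_)
  rw [hF.gauge.span_eq x hx]
  exact Submodule.subset_span ⟨r, rfl⟩

variable [T2Space M]

set_option maxHeartbeats 1000000 in
/-- The algebraic form of the torsion and of the horizontal curvature at a point. -/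
theorem exists_torsionForm (hn : 1 ≤ n) (hx : x ∈ U) : ∃ m p q r l,
    TorsionForm (P.g x) (fun s => J s x) (fun s => C.torEnd x (ξ s x))
      (fun r t s => η r x (C.cov.torsion x (ξ t x) (ξ s x))) m p q r l ∧
    IsHorizontalCurvature (P.g x) (fun s => J s x) (fun s => C.torEnd x (ξ s x))
      (curvCoeff (fun s => J s x) m p q r l) (fun u v => C.curvEnd x u v) := by
  have hJ := hF.gauge.isUnits hx
  have := P.nontrivial hn x
  obtain ⟨A, l, h⟩ := hJ.exists_torsionNormalForm (P.isOrthonormalBasis_basis x)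
    (T := fun s => C.torEnd x (ξ s x))
    (Λ := fun r t s => η r x (C.cov.torsion x (ξ t x) (ξ s x)))
    (fun r t s => by rw [torsion_swap, map_neg])
    -- Skewness of η_r(R(u,v)ξ_s), with each coefficient replaced by its Bianchi value; the common
    -- factor -2 is dropped.
    (fun r s u v => by
      have h := hF.curvature_xi_skew hn hx u v r s
      rw [hF.bianchi_vertical hn hx, hF.bianchi_vertical hn hx] at h
      linarith)
    (fun s B hB hsk => hF.trace_sp_torEnd hx s hB hsk)
    (fun s r => hF.trace_unit_torEnd hx s r)
  refine ⟨_, _, _, _, l, h.torsionForm, fun u v => curvEnd_swap _ _,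
    fun u v a c => hF.curvEnd_skew hx _ _ _ _, fun u v s a => ?_,
    fun u v w => hF.bianchi_horizontal hn hx u v w⟩
  rw [hF.curvEnd_J hx]
  congr 1
  refine Finset.sum_congr rfl fun r _ => ?_
  rw [← h.torsionForm.curvCoeff_eq hJ, ← hF.bianchi_vertical hn hx]

omit hF in
lemma curvEnd_neg_middle (a u : P.H x) :
    C.curvEnd x a ((-u : P.H x) : TangentSpace 𝓘(ℝ, Model n) x) = - C.curvEnd x a u := by
  ext v
  rw [curvEnd_apply, Submodule.coe_neg, ← neg_one_smul ℝ, curvature_smul_middle C.smooth, map_smul,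
    neg_one_smul]
  rfl

/-- This identifies the pointwise constant l with the component η_0(T(ξ_1,ξ_2)), a smooth function
on U that can be differentiated. -/
lemma torsion_xi_components (hn : 1 ≤ n) (hx : x ∈ U) (r t s : Fin 3) :
    η r x (C.cov.torsion x (ξ t x) (ξ s x))
      = eps r * (η 0 x (C.cov.torsion x (ξ 1 x) (ξ 2 x)) * levi r t s) := by
  obtain ⟨m, p, q, r', l, h, -⟩ := hF.exists_torsionForm hn hx
  have h1 := h.lam r t s
  have h2 := h.lam 0 1 2
  simp [eps, levi] at h2
  rw [h2, ← h1, ← mul_assoc, eps_mul_self, one_mul]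

lemma ric_eq (h0 : C.TorsionEndVanish) (hn : 1 ≤ n) (hx : x ∈ U) (u v : P.H x) :
    C.ric x u v
      = (2 * n + 4) * η 0 x (C.cov.torsion x (ξ 1 x) (ξ 2 x)) * P.g x u v := by
  obtain ⟨m, p, q, r, l, h, hR⟩ := hF.exists_torsionForm hn hx
  have hJ := hF.gauge.isUnits hx
  obtain ⟨rfl, rfl, rfl, rfl⟩ := h.eq_zero_of_torsion hJ fun s => LinearMap.ext fun u =>
    Subtype.ext ((coe_torEnd (hF.xi_mem hx s) u).trans (h0 x _ (hF.xi_mem hx s) u u.2))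
  have h2 := h.lam 0 1 2
  simp [eps, levi] at h2
  rw [ric_eq_ricciForm, h.ricci_eq hJ (P.isOrthonormalBasis_basis x) hR
    (fun a u v => congrArg (fun f => f v) (curvEnd_neg_middle a u)), h2, card_basis]
  ring

lemma scal_eq (h0 : C.TorsionEndVanish) (hn : 1 ≤ n) (hx : x ∈ U) :
    C.scal x = 4 * n * ((2 * n + 4) * η 0 x (C.cov.torsion x (ξ 1 x) (ξ 2 x))) := by
  rw [← P.trace_g]
  exact congrArg (P.trace x) (funext₂ fun u v => hF.ric_eq h0 hn hx u v)

omit [T2Space M] in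
lemma torsion_eq_zero_of_torEnd (hx : x ∈ U) (h : ∀ s, C.torEnd x (ξ s x) = 0)
    {v u : TangentSpace 𝓘(ℝ, Model n) x} (hv : v ∈ C.V x) (hu : u ∈ P.H x) :
    C.cov.torsion x v u = 0 := by
  rw [hF.eq_sum_of_mem_V hx hv, map_sum, sum_apply]
  refine Finset.sum_eq_zero fun s _ => ?_
  have h1 := coe_torEnd (hF.xi_mem hx s) ⟨u, hu⟩
  rw [h] at h1
  rw [map_smul, smul_apply, ← h1]
  simp

end IsReebFrame

variable [T2Space M]

theorem einstein_imp_torsionEndVanish (hn : 1 ≤ n) (h : C.IsEinstein) : C.TorsionEndVanish := by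
  intro x v hv u hu
  obtain ⟨U, η, J, ξ, hx, hF⟩ := C.exists_reebFrame x
  have := P.nontrivial hn x
  obtain ⟨m, p, q, r, l, hT, hR⟩ := hF.exists_torsionForm hn hx
  exact hF.torsion_eq_zero_of_torEnd hx (fun s => hT.torsion_eq_zero
    (hT.eq_zero_of_einstein (hF.gauge.isUnits hx) (P.isOrthonormalBasis_basis x) hR (h x)) s) hv hu

theorem torsionEndVanish_imp_einstein (hn : 1 ≤ n) (h : C.TorsionEndVanish) : C.IsEinstein := by
  intro x u v
  obtain ⟨U, η, J, ξ, hx, hF⟩ := C.exists_reebFrame x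
  have hn' : (n : ℝ) ≠ 0 := by positivity
  rw [hF.ric_eq h hn hx, hF.scal_eq h hn hx]
  field_simp

omit [T2Space M] in
lemma torsionEndVanish_imp_tauMuVanish (h : C.TorsionEndVanish) : C.TauMuVanish := by
  intro U η J ξ hF x hx u v
  have h1 : ∀ s a b, C.tor x (ξ s x) a b = 0 := fun s a b => by
    rw [CanonicalConnection.tor, h x _ (hF.xi_mem hx s) a a.2]
    simp
  simp [CanonicalConnection.tau, CanonicalConnection.mu, CanonicalConnection.torSym,
    CanonicalConnection.torSkew, h1]

theorem tauMuVanish_imp_torsionEndVanish (hn : 1 ≤ n) (h : C.TauMuVanish) :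
    C.TorsionEndVanish := by
  intro x v hv u hu
  obtain ⟨U, η, J, ξ, hx, hF⟩ := C.exists_reebFrame x
  have := P.nontrivial hn x
  obtain ⟨m, p, q, r, l, hT, hR⟩ := hF.exists_torsionForm hn hx
  refine hF.torsion_eq_zero_of_torEnd hx (fun s => hT.torsion_eq_zero
    (hT.eq_zero_of_tau_mu (hF.gauge.isUnits hx) (fun s u v => ?_) fun u v => ?_) s) hv hu
  · have h1 := (h U η J ξ hF x hx u v).2 s
    rw [CanonicalConnection.mu, CanonicalConnection.torSkew, mul_eq_zero,
      or_iff_right (eps_ne_zero s), div_eq_zero_iff, or_iff_left two_ne_zero] at h1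
    exact h1
  · have h1 := (h U η J ξ hF x hx u v).1
    simp only [CanonicalConnection.tau, CanonicalConnection.torSym, neg_eq_zero, mul_div_assoc',
      ← Finset.sum_div, div_eq_zero_iff, OfNat.ofNat_ne_zero, or_false] at h1
    exact h1

end Pointwise
end PQC

/-! ### Integrability of V and constancy of the scalar curvature: part (b). -/

namespace PQC
section Vertical
variable {n : ℕ} {M : Type*} [TopologicalSpace M] [ChartedSpace (Model n) M]
  [IsManifold 𝓘(ℝ, Model n) ∞ M] {P : Structure n M} {C : CanonicalConnection P}
  {U : Set M} {η : Fin 3 → ∀ x : M, TangentSpace 𝓘(ℝ, Model n) x →L[ℝ] ℝ}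
  {J : Fin 3 → ∀ x : M, Module.End ℝ (P.H x)}
  {ξ : Fin 3 → ∀ x : M, TangentSpace 𝓘(ℝ, Model n) x} {x : M}

/-- In a chart the derivative vanishes on a ball, which is connected. -/
lemma isLocallyConstant_of_hasMFDerivAt_zero {f : M → ℝ}
    (h : ∀ x, HasMFDerivAt 𝓘(ℝ, Model n) 𝓘(ℝ, ℝ) f x 0) : IsLocallyConstant f := by
  rw [IsLocallyConstant.iff_eventually_eq]
  intro x
  set φ := extChartAt 𝓘(ℝ, Model n) x
  have hopen : IsOpen φ.target := isOpen_extChartAt_target x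
  obtain ⟨ε, hε, hball⟩ := Metric.isOpen_iff.1 hopen (φ x) (mem_extChartAt_target x)
  have hd : ∀ z ∈ φ.target, HasFDerivAt (f ∘ φ.symm) (0 : Model n →L[ℝ] ℝ) z := fun z hz => by
    have h1 : MDifferentiableAt 𝓘(ℝ, Model n) 𝓘(ℝ, Model n) φ.symm z :=
      ((contMDiffOn_extChartAt_symm (n := ∞) x).contMDiffAt (hopen.mem_nhds hz)).mdifferentiableAt
        (by simp)
    have h2 := (h (φ.symm z)).comp z h1.hasMFDerivAt
    have h3 := h2.hasFDerivAt
    rw [ContinuousLinearMap.zero_comp] at h3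
    exact h3
  have hev : ∀ᶠ y in nhds x, y ∈ φ.source ∧ φ y ∈ Metric.ball (φ x) ε :=
    Filter.Eventually.and (extChartAt_source_mem_nhds x)
      ((continuousAt_extChartAt x).eventually (Metric.ball_mem_nhds _ hε))
  filter_upwards [hev] with y hy
  have h1 := Metric.isOpen_ball.is_const_of_fderiv_eq_zero (𝕜 := ℝ) (f := f ∘ φ.symm)
    (convex_ball (φ x) ε).isPreconnected
    (fun z hz => (hd z (hball hz)).differentiableAt.differentiableWithinAt)
    (fun z hz => (hd z (hball hz)).fderiv) hy.2 (Metric.mem_ball_self hε)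
  exact (congrArg f (φ.left_inv hy.1)).symm.trans (h1.trans (congrArg f (extChartAt_to_inv x)))

namespace IsReebFrame
variable [T2Space M] (hF : IsReebFrame P C.V U η J ξ)
include hF

set_option maxHeartbeats 1000000 in
-- The algebraic lemma is applied to Q_u = R(ξ_s, u), with w_t the horizontal part of T(ξ_t, ξ_s)
-- and k the vectors dual to the coefficients of the curvature on V. The restriction n > 1 enters
-- here, as 4n > 4.
lemma mixed_curvature (hn : 1 < n) (h0 : C.TorsionEndVanish) (hx : x ∈ U) (s : Fin 3) :
    (∀ t, horizontal C.isCompl x (C.cov.torsion x (ξ t x) (ξ s x)) = 0) ∧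
      ∀ (r t : Fin 3) (u : P.H x), η r x (curvature C.cov x (ξ s x) u (ξ t x)) = 0 := by
  have hJ := hF.gauge.isUnits hx
  have hb := P.isOrthonormalBasis_basis x
  let f : Fin 3 → Fin 3 → P.H x →ₗ[ℝ] ℝ := fun r t =>
    { toFun := fun u => η r x (curvature C.cov x (ξ s x) u (ξ t x))
      map_add' := fun u v => by rw [Submodule.coe_add, curvature_add_middle C.smooth, map_add]
      map_smul' := fun c u => by
        rw [Submodule.coe_smul, curvature_smul_middle C.smooth, map_smul, RingHom.id_apply] }
  let Q : P.H x →ₗ[ℝ] Module.End ℝ (P.H x) :=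
    { toFun := fun u => C.curvEnd x (ξ s x) u
      map_add' := fun u v => LinearMap.ext fun w => by
        rw [LinearMap.add_apply, curvEnd_apply, curvEnd_apply, curvEnd_apply, Submodule.coe_add,
          curvature_add_middle C.smooth, map_add]
      map_smul' := fun c u => LinearMap.ext fun w => by
        rw [RingHom.id_apply, LinearMap.smul_apply, curvEnd_apply, curvEnd_apply,
          Submodule.coe_smul, curvature_smul_middle C.smooth, map_smul] }
  choose k hk using fun r t => hb.exists_dual (f r t)
  have h := hJ.mixed_curvature_eq_zero hb (by simp; omega) (Q := Q) (k := k)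
    (w := fun t => horizontal C.isCompl x (C.cov.torsion x (ξ t x) (ξ s x)))
    (fun X u v => hF.curvEnd_skew hx _ _ _ _)
    (fun r t => hJ.nondeg _ fun v => by
      rw [map_add, map_smul, map_smul, LinearMap.add_apply, LinearMap.smul_apply,
        LinearMap.smul_apply, ← hk, ← hk]
      exact hF.curvature_xi_skew hn.le hx _ _ _ _)
    (fun X t u => by
      simp only [← hk]
      exact hF.curvEnd_J hx _ _ _ _)
    (fun X Y => hF.bianchi_mixed_horizontal h0 hn.le hx X Y s)
  refine ⟨h.1, fun r t u => ?_⟩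
  have := hk r t u
  rw [h.2] at this
  exact this.trans (by simp)

lemma torsion_xi (hn : 1 < n) (h0 : C.TorsionEndVanish) (hx : x ∈ U) (t s : Fin 3) :
    C.cov.torsion x (ξ t x) (ξ s x)
      = ∑ r, (eps r * (η 0 x (C.cov.torsion x (ξ 1 x) (ξ 2 x)) * levi r t s)) • ξ r x := by
  rw [hF.sum_eta_smul_xi (C := C) hx (C.cov.torsion x (ξ t x) (ξ s x)),
    (hF.mixed_curvature hn h0 hx s).1 t, Submodule.coe_zero, zero_add]
  simp only [← hF.torsion_xi_components hn.le hx]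

lemma torsion_mem_V (hn : 1 < n) (h0 : C.TorsionEndVanish) (hx : x ∈ U)
    {v w : TangentSpace 𝓘(ℝ, Model n) x} (hv : v ∈ C.V x) (hw : w ∈ C.V x) :
    C.cov.torsion x v w ∈ C.V x := by
  rw [hF.eq_sum_of_mem_V hx hv, hF.eq_sum_of_mem_V hx hw]
  simp only [map_sum, map_smul, sum_apply, smul_apply]
  refine sum_mem fun s _ => Submodule.smul_mem _ _ (sum_mem fun t _ => Submodule.smul_mem _ _ ?_)
  rw [hF.torsion_xi hn h0 hx]
  exact sum_mem fun r _ => Submodule.smul_mem _ _ (hF.xi_mem hx r)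

/-- The component `η₁(T(ξ₂, ξ₃))` is constant along `H`. -/
lemma mvfderiv_component_horizontal (hn : 1 < n) (h0 : C.TorsionEndVanish) (hx : x ∈ U)
    (u : P.H x) :
    mvfderiv 𝓘(ℝ, Model n) (fun y => η 0 y (C.cov.torsion y (ξ 1 y) (ξ 2 y))) x u = 0 := by
  have hU := hF.gauge.isOpen
  obtain ⟨X, hX, rfl⟩ := hF.exists_section (C := C) subset_rfl hU u
  have hξ := hF.reeb.smooth
  have hV : ∀ s, ∀ y ∈ U, ξ s y ∈ C.V y := fun s y hy => hF.xi_mem hy s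
  have hT := SmoothFieldOn.torsion C.smooth hU (hξ 1) (hξ 2)
  have hf : SmoothFunOn (n := n) U (fun y => η 0 y (C.cov.torsion y (ξ 1 y) (ξ 2 y))) :=
    hF.gauge.smooth_form 0 U hU subset_rfl _ hT
  have hz : ∀ s t, covTorsion C.cov (ξ s) (ξ t) (fun y => X y) x = 0 := fun s t => by
    unfold covTorsion
    rw [cov_congr C.cov hU (SmoothFieldOn.torsion C.smooth hU (hξ t) hX) (B := fun _ => 0)
      (fun y hy => h0 y _ (hV t y hy) _ (X y).2) hx, cov_zero,
      h0 x _ (cov_mem_V hU (hξ t) (hV t) hx _) _ (X x).2,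
      h0 x _ (hV t x hx) _ (C.cov_mem_horizontal U hU _ hX x hx _)]
    simp
  have hz' : covTorsion C.cov (ξ 2) (fun y => X y) (ξ 1) x = 0 := by
    unfold covTorsion
    rw [cov_congr C.cov hU (SmoothFieldOn.torsion C.smooth hU hX (hξ 1)) (B := fun _ => 0)
      (fun y hy => by rw [torsion_swap, h0 y _ (hV 1 y hy) _ (X y).2, neg_zero]) hx, cov_zero,
      torsion_swap, h0 x _ (hV 1 x hx) _ (C.cov_mem_horizontal U hU _ hX x hx _), torsion_swap,
      h0 x _ (cov_mem_V hU (hξ 1) (hV 1) hx _) _ (X x).2]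
    simp
  -- Of the curvature terms, R(ξ_1,ξ_2)X is horizontal and the other two vanish by
  -- `mixed_curvature`. All torsion terms with a horizontal argument vanish too, which leaves η_0 of
  -- (∇_X T)(ξ_1,ξ_2) = 0.
  have h := congrArg (η 0 x) (first_bianchi C.smooth hU hX (hξ 1) (hξ 2) hx)
  rw [hz, hz', torsion_swap (X x : TangentSpace 𝓘(ℝ, Model n) x) (ξ 1 x),
    h0 x _ (hV 1 x hx) _ (X x).2, h0 x _ (hV 2 x hx) _ (X x).2,
    h0 x _ (hF.torsion_mem_V hn h0 hx (hV 1 x hx) (hV 2 x hx)) _ (X x).2,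
    curvature_swap C.smooth (X x : TangentSpace 𝓘(ℝ, Model n) x) (ξ 1 x) (ξ 2 x),
    map_add, map_add, map_neg, (hF.mixed_curvature hn h0 hx 1).2,
    (hF.mixed_curvature hn h0 hx 2).2, ← hF.coe_curvEnd hx, hF.eta_coe hx] at h
  simp only [neg_zero, map_zero, zero_apply, add_zero] at h
  have hα := hF.connection_skew hn.le hx (X x)
  have h11 : η 1 x (C.cov (ξ 1) x (X x)) = 0 := by
    have := hα 1 1; simp [eps] at this; linarith
  have h22 : η 2 x (C.cov (ξ 2) x (X x)) = 0 := by
    have := hα 2 2; simp [eps] at this; linarith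
  have h00 : η 0 x (C.cov (ξ 0) x (X x)) = 0 := by
    have := hα 0 0; simp [eps] at this; linarith
  have hc := cov_congr C.cov hU hT
    (B := fun y => η 0 y (C.cov.torsion y (ξ 1 y) (ξ 2 y)) • ξ 0 y) (fun y hy => by
      refine (hF.torsion_xi hn h0 hy 1 2).trans ?_
      simp [Fin.sum_univ_three, levi, eps]) hx
  unfold covTorsion at h
  rw [hc, cov_smul (hf.mdifferentiableAt hU hx) ((hξ 0).mdifferentiableAt hU hx),
    hF.cov_xi_eq hx 1, hF.cov_xi_eq hx 2] at h
  obtain ⟨c, hc⟩ : ∃ c, ∀ r t s, η r x (C.cov.torsion x (ξ t x) (ξ s x))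
      = eps r * (c * levi r t s) := ⟨_, hF.torsion_xi_components hn.le hx⟩
  simp only [map_sub, map_add, map_smul, map_sum, sum_apply, smul_apply, hc, hF.eta_xi hx, smul_eq_mul, h00] at h
  -- Each connection term multiplies either a diagonal coefficient, zero by skewness, or a
  -- Levi-Civita symbol with a repeated index. Only the derivative of the component along X
  -- survives.
  have hl : levi 0 0 2 = 0 ∧ levi 0 2 2 = 0 ∧ levi 0 1 0 = 0 ∧ levi 0 1 1 = 0 := by simp [levi]
  rw [Fin.sum_univ_three, Fin.sum_univ_three, h11, h22, hl.1, hl.2.1, hl.2.2.1, hl.2.2.2,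
    if_pos trivial] at h
  linarith

/-- The component `η₁(T(ξ₂, ξ₃))` is constant. -/
lemma mvfderiv_component (hn : 1 < n) (h0 : C.TorsionEndVanish) (hx : x ∈ U)
    (v : TangentSpace 𝓘(ℝ, Model n) x) :
    mvfderiv 𝓘(ℝ, Model n) (fun y => η 0 y (C.cov.torsion y (ξ 1 y) (ξ 2 y))) x v = 0 := by
  have hU := hF.gauge.isOpen
  have hJ := hF.gauge.isUnits hx
  have := P.nontrivial hn.le x
  have hf : SmoothFunOn (n := n) U (fun y => η 0 y (C.cov.torsion y (ξ 1 y) (ξ 2 y))) :=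
    hF.gauge.smooth_form 0 U hU subset_rfl _
      (SmoothFieldOn.torsion C.smooth hU (hF.reeb.smooth 1) (hF.reeb.smooth 2))
  have hH := fun {y} hy u => hF.mvfderiv_component_horizontal hn h0 (x := y) hy u
  generalize (fun y => η 0 y (C.cov.torsion y (ξ 1 y) (ξ 2 y))) = f at *
  -- A function with zero horizontal derivatives is killed by brackets of horizontal fields, hence
  -- by T(X,Y) = ∇_X Y - ∇_Y X - [X,Y].
  have hTor : ∀ u w : P.H x, mvfderiv 𝓘(ℝ, Model n) f x (C.cov.torsion x u w) = 0 := by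
    intro u w
    obtain ⟨X, hX, rfl⟩ := hF.exists_section (C := C) subset_rfl hU u
    obtain ⟨Y, hY, rfl⟩ := hF.exists_section (C := C) subset_rfl hU w
    have hz : ∀ {Z : ∀ x : M, P.H x} (v : TangentSpace 𝓘(ℝ, Model n) x),
        mvfderiv 𝓘(ℝ, Model n) (fun y => mvfderiv 𝓘(ℝ, Model n) f y (Z y)) x v = 0 :=
      fun {Z} v => by
        rw [mvfderiv_congr_on (g := fun _ => 0) hU (fun y hy => hH hy (Z y)) hx, mvfderiv_const]
        rfl
    have h := mvfderiv_mlieBracket hU hf hX hY hx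
    rw [hz, hz, sub_zero] at h
    rw [torsion_field hU hX hY hx, map_sub, map_sub, h, ← coe_horizontal_cov hU hX hx,
      ← coe_horizontal_cov hU hY hx, hH hx, hH hx]
    simp
  -- T(u,w) is a combination of the ξ_s with coefficients ω_s(u,w); nondegeneracy of g and
  -- independence of the units let each ξ_s be reached.
  have hs : ∀ s, mvfderiv 𝓘(ℝ, Model n) f x (ξ s x) = 0 := by
    have hsum : ∀ u : P.H x, ∑ s, (eps s * mvfderiv 𝓘(ℝ, Model n) f x (ξ s x)) • J s x u = 0 :=
      fun u => hJ.nondeg _ fun w => by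
        have h := hTor u w
        rw [hF.torsion_horizontal hx, map_sum] at h
        simp only [map_smul, smul_eq_mul] at h
        simp only [map_sum, map_smul, LinearMap.sum_apply, LinearMap.smul_apply, smul_eq_mul]
        simp only [Fin.sum_univ_three] at h ⊢
        linarith
    obtain ⟨a, ha⟩ : ∃ a : Fin 3 → ℝ, ∀ s, eps s * mvfderiv 𝓘(ℝ, Model n) f x (ξ s x) = a s :=
      ⟨_, fun _ => rfl⟩
    have h := hJ.components_eq_zero (A := (0 : ℝ) • 1) (B := a 0 • 1) (C := a 1 • 1) (D := a 2 • 1)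
      (CommutesWith.one.smul _) (CommutesWith.one.smul _) (CommutesWith.one.smul _)
      (CommutesWith.one.smul _) (fun u => by
        have := hsum u
        simp only [ha, Fin.sum_univ_three] at this
        simpa using this)
    simp only [smul_eq_zero, one_ne_zero, or_false] at h
    have ha0 : ∀ s, a s = 0 := by
      intro s; fin_cases s
      exacts [h.2.1, h.2.2.1, h.2.2.2]
    intro s
    exact (mul_eq_zero.1 ((ha s).trans (ha0 s))).resolve_left (eps_ne_zero s)
  rw [hF.sum_eta_smul_xi (C := C) hx v, map_add, map_sum, hH hx]
  simp [hs]

end IsReebFrame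

/-- [A,B] = ∇_A B - ∇_B A - T(A,B), and all three terms are vertical. -/
theorem verticalIntegrable [T2Space M] (hn : 1 < n) (h0 : C.TorsionEndVanish) :
    C.VerticalIntegrable := by
  intro W hW A B hA hB x hx
  obtain ⟨U, η, J, ξ, hxU, hF⟩ := C.exists_reebFrame x
  have h := torsion_field (cov := C.cov) hW hA hB hx
  rw [eq_sub_iff_add_eq', ← eq_sub_iff_add_eq] at h
  rw [h]
  exact sub_mem (sub_mem (C.cov_mem_vertical W hW _ hB x hx _)
    (C.cov_mem_vertical W hW _ hA x hx _)) (hF.torsion_mem_V hn h0 hxU (A x).2 (B x).2)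

theorem hasMFDerivAt_scal [T2Space M] (hn : 1 < n) (h0 : C.TorsionEndVanish) (x : M) :
    HasMFDerivAt 𝓘(ℝ, Model n) 𝓘(ℝ, ℝ) C.scal x 0 := by
  obtain ⟨U, η, J, ξ, hx, hF⟩ := C.exists_reebFrame x
  have hU := hF.gauge.isOpen
  have hf : SmoothFunOn (n := n) U (fun y => η 0 y (C.cov.torsion y (ξ 1 y) (ξ 2 y))) :=
    hF.gauge.smooth_form 0 U hU subset_rfl _
      (SmoothFieldOn.torsion C.smooth hU (hF.reeb.smooth 1) (hF.reeb.smooth 2))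
  have hs : ∀ y ∈ U, C.scal y = 4 * n * (2 * n + 4) *
      η 0 y (C.cov.torsion y (ξ 1 y) (ξ 2 y)) := fun y hy => by
    rw [hF.scal_eq h0 hn.le hy]; ring
  have hd : SmoothFunOn (n := n) U C.scal :=
    ContMDiffOn.congr (ContMDiffOn.mul contMDiffOn_const hf) hs
  have h := (hd.mdifferentiableAt hU hx).hasMFDerivAt
  have hz : mvfderiv 𝓘(ℝ, Model n) C.scal x = 0 := by
    ext v
    rw [mvfderiv_congr_on hU hs hx, mvfderiv_const_mul _ hU hf hx,
      hF.mvfderiv_component hn h0 hx]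
    simp
  exact h.congr_mfderiv hz

end Vertical
end PQC

/-! ### The fundamental four-form is parallel. -/

namespace PQC

/-- The form `-ω₁ ∧ ω₁ - ω₂ ∧ ω₂ + ω₃ ∧ ω₃` on a space with units. -/
def fourForm {E : Type*} [AddCommGroup E] [Module ℝ E] (g : LinearMap.BilinForm ℝ E)
    (J : Fin 3 → Module.End ℝ E) (a b c d : E) : ℝ :=
  -∑ s, eps s * (2 * (g (J s a) b * g (J s c) d - g (J s a) c * g (J s b) d
    + g (J s a) d * g (J s b) c))

section
variable {E : Type*} [AddCommGroup E] [Module ℝ E] {g : LinearMap.BilinForm ℝ E}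
    {J : Fin 3 → Module.End ℝ E}

lemma fourForm_add (a a' b c d : E) :
    fourForm g J (a + a') b c d = fourForm g J a b c d + fourForm g J a' b c d := by
  simp only [fourForm, Fin.sum_univ_three, map_add, LinearMap.add_apply]
  ring

lemma fourForm_neg (a b c d : E) : fourForm g J (-a) b c d = -fourForm g J a b c d := by
  simp only [fourForm, Fin.sum_univ_three, map_neg, LinearMap.neg_apply]
  ring

lemma fourForm_sub (a a' b c d : E) :
    fourForm g J (a - a') b c d = fourForm g J a b c d - fourForm g J a' b c d := by
  rw [sub_eq_add_neg, fourForm_add, fourForm_neg, sub_eq_add_neg]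

lemma fourForm_zero (b c d : E) : fourForm g J 0 b c d = 0 := by
  simp [fourForm]

lemma IsUnits.skew_swap (hJ : IsUnits g J) (s : Fin 3) (a b : E) : g (J s a) b = - g (J s b) a := by
  rw [hJ.skew, hJ.symm]

lemma fourForm_swap01 (hJ : IsUnits g J) (a b c d : E) :
    fourForm g J a b c d = - fourForm g J b a c d := by
  simp only [fourForm, Fin.sum_univ_three, hJ.skew_swap _ b a]
  ring

lemma fourForm_swap12 (hJ : IsUnits g J) (a b c d : E) :
    fourForm g J a b c d = - fourForm g J a c b d := by
  simp only [fourForm, Fin.sum_univ_three, hJ.skew_swap _ c b]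
  ring

lemma fourForm_swap23 (hJ : IsUnits g J) (a b c d : E) :
    fourForm g J a b c d = - fourForm g J a b d c := by
  simp only [fourForm, Fin.sum_univ_three, hJ.skew_swap _ d c]
  ring

end

section Gauge
variable {n : ℕ} {M : Type*} [TopologicalSpace M] [ChartedSpace (Model n) M]
  [IsManifold 𝓘(ℝ, Model n) ∞ M] {P : Structure n M} {C : CanonicalConnection P}
  {U U' : Set M} {η η' : Fin 3 → ∀ x : M, TangentSpace 𝓘(ℝ, Model n) x →L[ℝ] ℝ}
  {J J' : Fin 3 → ∀ x : M, Module.End ℝ (P.H x)}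
  {ξ : Fin 3 → ∀ x : M, TangentSpace 𝓘(ℝ, Model n) x} {x : M} {W : Set M}

variable [T2Space M]

/-- The units of a gauge are moved by skew coefficients under covariant differentiation. -/
lemma IsReebFrame.exists_unit_derivation (hF : IsReebFrame P C.V U' η' J' ξ) (hn : 1 ≤ n)
    (hG : IsGauge P.H P.g P.PQ U η J) (hWU : W ⊆ U) (hWU' : W ⊆ U') (hW : IsOpen W) (hx : x ∈ W)
    (v : TangentSpace 𝓘(ℝ, Model n) x) : ∃ a : Fin 3 → Fin 3 → ℝ,
    (∀ r s, eps r * a r s + eps s * a s r = 0) ∧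
    ∀ s X, SmoothSectionOn P.H W X →
      horizontal C.isCompl x (C.cov (fun y => J s y (X y)) x v)
        = J s x (horizontal C.isCompl x (C.cov (fun y => X y) x v))
          + ∑ r, a r s • J r x (X x) := by
  have := P.nontrivial hn x
  have hu := hG.isUnits (hWU hx)
  have hE : ∀ s, SmoothEndOn P.H W (J s) := fun s W' hW' h =>
    hG.smooth_end s W' hW' (h.trans hWU)
  -- Ω is tested in arbitrary gauges, which come without Reeb fields. The coefficients are therefore
  -- taken from the invariance of PQ; the Reeb frame serves only to extend vectors to sections.
  choose τ hτ hτX using fun s => C.cov_PQ W hW (J s) (hE s) (fun y hy => by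
    rw [hG.span_eq y (hWU hy)]; exact Submodule.subset_span ⟨s, rfl⟩) x hx v
  simp only [hG.span_eq x (hWU hx), Submodule.mem_span_range_iff_exists_fun] at hτ
  choose a ha using hτ
  have hJX : ∀ s X, SmoothSectionOn P.H W X →
      horizontal C.isCompl x (C.cov (fun y => J s y (X y)) x v)
        = J s x (horizontal C.isCompl x (C.cov (fun y => X y) x v))
          + ∑ r, a s r • J r x (X x) := fun s X hX => by
    rw [← sub_eq_iff_eq_add', hτX s X hX, ← ha]
    simp
  refine ⟨fun r s => a s r, fun r s => ?_, hJX⟩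
  refine hu.skew_of_derivation (a := fun r s => a s r) (fun s t => ?_) r s
  ext1 u
  obtain ⟨X, hX, rfl⟩ := hF.exists_section (C := C) hWU' hW u
  have sm := fun s t => hE t W hW subset_rfl _ (hE s W hW subset_rfl X hX)
  have key2 := congrArg (fun f => horizontal C.isCompl x (f v)) (cov_add (cov := C.cov)
    ((sm s t).mdifferentiableAt hW hx) ((sm t s).mdifferentiableAt hW hx))
  simp only [add_apply, map_add] at key2
  rw [hJX t _ (hE s W hW subset_rfl X hX), hJX s _ (hE t W hW subset_rfl X hX),
    hJX t X hX, hJX s X hX] at key2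
  obtain ⟨c, hc⟩ : ∃ c : ℝ, ∀ y ∈ U, ∀ w : P.H y,
      J t y (J s y w) + J s y (J t y w) = c • w := by
    refine ⟨if t = s then 2 * eps s else 0, fun y hy w => ?_⟩
    have := congr($((hG.isUnits hy).anticomm t s) w)
    simp only [LinearMap.add_apply, Module.End.mul_apply] at this
    rw [this]; split_ifs <;> simp
  have key3 : horizontal C.isCompl x (C.cov (fun y => (J t y (J s y (X y)) :
      TangentSpace 𝓘(ℝ, Model n) y) + J s y (J t y (X y))) x v)
      = c • horizontal C.isCompl x (C.cov (fun y => X y) x v) := by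
    rw [cov_congr C.cov hW ((sm s t).add (sm t s))
      (B := fun y => c • (X y : TangentSpace 𝓘(ℝ, Model n) y))
      (fun y hy => congrArg Subtype.val (hc y (hWU hy) (X y))) hx,
      cov_const_smul _ (SmoothFieldOn.mdifferentiableAt hX hW hx)]
    rw [smul_apply, map_smul]
  rw [key3, ← hc x (hWU hx)] at key2
  simp only [map_add, map_sum, map_smul] at key2
  simp only [LinearMap.sum_apply, LinearMap.add_apply, LinearMap.smul_apply, Module.End.mul_apply,
    Finset.sum_add_distrib, smul_add, LinearMap.zero_apply]
  rw [← sub_eq_zero, ← neg_eq_zero] at key2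
  rw [← key2]
  abel

omit [IsManifold 𝓘(ℝ, Model n) ∞ M] [T2Space M] in
lemma mvfderiv_mul_apply {f g : M → ℝ} (hW : IsOpen W) (hf : SmoothFunOn (n := n) W f)
    (hg : SmoothFunOn (n := n) W g) (hx : x ∈ W) (v : TangentSpace 𝓘(ℝ, Model n) x) :
    mvfderiv 𝓘(ℝ, Model n) (fun y => f y * g y) x v
      = f x * mvfderiv 𝓘(ℝ, Model n) g x v + g x * mvfderiv 𝓘(ℝ, Model n) f x v := by
  rw [mvfderiv_fun_mul (hf.mdifferentiableAt hW hx) (hg.mdifferentiableAt hW hx)]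
  simp

omit [IsManifold 𝓘(ℝ, Model n) ∞ M] [T2Space M] in
lemma mvfderiv_sum_mul {ι : Type*} [Fintype ι] {f g : ι → M → ℝ} (hW : IsOpen W)
    (hf : ∀ i, SmoothFunOn (n := n) W (f i)) (hg : ∀ i, SmoothFunOn (n := n) W (g i)) (hx : x ∈ W)
    (v : TangentSpace 𝓘(ℝ, Model n) x) :
    mvfderiv 𝓘(ℝ, Model n) (fun y => ∑ i, f i y * g i y) x v
      = ∑ i, (f i x * mvfderiv 𝓘(ℝ, Model n) (g i) x v
        + g i x * mvfderiv 𝓘(ℝ, Model n) (f i) x v) := by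
  simp only [← mvfderiv_mul_apply hW (hf _) (hg _) hx]
  have h : ∀ s : Finset ι, SmoothFunOn (n := n) W (fun y => ∑ i ∈ s, f i y * g i y) ∧
      mvfderiv 𝓘(ℝ, Model n) (fun y => ∑ i ∈ s, f i y * g i y) x v
        = ∑ i ∈ s, mvfderiv 𝓘(ℝ, Model n) (fun y => f i y * g i y) x v := by
    classical
    intro s
    induction s using Finset.induction_on with
    | empty =>
      simp only [Finset.sum_empty]
      exact ⟨contMDiffOn_const, by rw [mvfderiv_const]; rfl⟩
    | insert i s hi ih =>
      have hm : SmoothFunOn (n := n) W (fun y => f i y * g i y) := ContMDiffOn.mul (hf i) (hg i)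
      simp only [Finset.sum_insert hi, ← ih.2]
      exact ⟨ContMDiffOn.add hm ih.1, PQC.mvfderiv_add hW hm ih.1 hx v⟩
  exact (h Finset.univ).2

omit [IsManifold 𝓘(ℝ, Model n) ∞ M] [T2Space M] in
lemma mvfderiv_wedge_squares {w : Fin 3 → Fin 4 → Fin 4 → M → ℝ} (hW : IsOpen W)
    (hw : ∀ s i j, SmoothFunOn (n := n) W (w s i j)) (hx : x ∈ W)
    (v : TangentSpace 𝓘(ℝ, Model n) x) {d : Fin 3 → Fin 4 → Fin 4 → ℝ}
    (hd : ∀ s i j, mvfderiv 𝓘(ℝ, Model n) (w s i j) x v = d s i j) :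
    mvfderiv 𝓘(ℝ, Model n) (fun y => -∑ s, eps s * (2 * (w s 0 1 y * w s 2 3 y
        - w s 0 2 y * w s 1 3 y + w s 0 3 y * w s 1 2 y))) x v
      = -∑ s, eps s * (2 * (d s 0 1 * w s 2 3 x + w s 0 1 x * d s 2 3
        - (d s 0 2 * w s 1 3 x + w s 0 2 x * d s 1 3)
        + (d s 0 3 * w s 1 2 x + w s 0 3 x * d s 1 2))) := by
  -- The second component of k runs over the three splittings of {0,1,2,3} into pairs, with their
  -- signs, so that a single sum of products is differentiated.
  have hfh : (fun y => -∑ s, eps s * (2 * (w s 0 1 y * w s 2 3 y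
        - w s 0 2 y * w s 1 3 y + w s 0 3 y * w s 1 2 y)))
      = fun y => ∑ k : Fin 3 × Fin 3, (-2 * eps k.1 * ![1, -1, 1] k.2 *
        w k.1 0 (![1, 2, 3] k.2) y) * w k.1 (![2, 1, 1] k.2) (![3, 3, 2] k.2) y := by
    funext y
    simp only [Fintype.sum_prod_type, Fin.sum_univ_three, Matrix.cons_val_zero,
      Matrix.cons_val_one, Matrix.cons_val]
    ring
  rw [hfh, mvfderiv_sum_mul (f := fun (k : Fin 3 × Fin 3) y => -2 * eps k.1 * ![1, -1, 1] k.2 *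
        w k.1 0 (![1, 2, 3] k.2) y) (g := fun (k : Fin 3 × Fin 3) y =>
        w k.1 (![2, 1, 1] k.2) (![3, 3, 2] k.2) y) hW
    (fun k => ContMDiffOn.mul contMDiffOn_const (hw _ _ _)) (fun k => hw _ _ _) hx]
  simp only [mvfderiv_const_mul _ hW (hw _ _ _) hx, hd]
  simp only [Fintype.sum_prod_type, Fin.sum_univ_three, Matrix.cons_val_zero,
      Matrix.cons_val_one, Matrix.cons_val]
  ring

/-- The matrix ε_s a_{rs} is skew, while w_r w'_s + w_s w'_r is symmetric in (r,s). Thus the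
rotation of the units under ∇ does not affect Σ ε_s ω_s ∧ ω_s. -/
lemma wedge_squares_invariant {a : Fin 3 → Fin 3 → ℝ}
    (ha : ∀ r s, eps r * a r s + eps s * a s r = 0) (w w' : Fin 3 → ℝ) :
    ∑ s, eps s * ((∑ r, a r s * w r) * w' s + w s * ∑ r, a r s * w' r) = 0 := by
  have h00 : a 0 0 = 0 := by have := ha 0 0; simp [eps] at this; linarith
  have h11 : a 1 1 = 0 := by have := ha 1 1; simp [eps] at this; linarith
  have h22 : a 2 2 = 0 := by have := ha 2 2; simp [eps] at this; linarith
  have h10 : a 1 0 = - a 0 1 := by have := ha 1 0; simp [eps] at this; linarith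
  have h20 : a 2 0 = a 0 2 := by have := ha 2 0; simp [eps] at this; linarith
  have h21 : a 2 1 = a 1 2 := by have := ha 2 1; simp [eps] at this; linarith
  have e0 : eps 0 = 1 := rfl
  have e1 : eps 1 = 1 := rfl
  have e2 : eps 2 = -1 := rfl
  simp only [Fin.sum_univ_three, h00, h11, h22, h10, h20, h21, e0, e1, e2]
  ring

/-- Here p and q hold the terms in which the derivative falls on the first or the second argument of
ω_s. The rotation terms cancel by invariance, and the rest is regrouped by the differentiated
argument. -/
lemma wedge_squares_derivation {a : Fin 3 → Fin 3 → ℝ}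
    (ha : ∀ r s, eps r * a r s + eps s * a s r = 0) (w p q : Fin 3 → Fin 4 → Fin 4 → ℝ) :
    -∑ s, eps s * (2 * ((p s 0 1 + q s 0 1 + ∑ r, a r s * w r 0 1) * w s 2 3
        + w s 0 1 * (p s 2 3 + q s 2 3 + ∑ r, a r s * w r 2 3)
        - ((p s 0 2 + q s 0 2 + ∑ r, a r s * w r 0 2) * w s 1 3
        + w s 0 2 * (p s 1 3 + q s 1 3 + ∑ r, a r s * w r 1 3))
        + ((p s 0 3 + q s 0 3 + ∑ r, a r s * w r 0 3) * w s 1 2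
        + w s 0 3 * (p s 1 2 + q s 1 2 + ∑ r, a r s * w r 1 2))))
      = -∑ s, eps s * (2 * (p s 0 1 * w s 2 3 - p s 0 2 * w s 1 3 + p s 0 3 * w s 1 2))
        + -∑ s, eps s * (2 * (q s 0 1 * w s 2 3 - w s 0 2 * p s 1 3 + w s 0 3 * p s 1 2))
        + -∑ s, eps s * (2 * (w s 0 1 * p s 2 3 - q s 0 2 * w s 1 3 + w s 0 3 * q s 1 2))
        + -∑ s, eps s * (2 * (w s 0 1 * q s 2 3 - w s 0 2 * q s 1 3 + q s 0 3 * w s 1 2)) := by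
  have h1 := wedge_squares_invariant ha (fun r => w r 0 1) (fun r => w r 2 3)
  have h2 := wedge_squares_invariant ha (fun r => w r 0 2) (fun r => w r 1 3)
  have h3 := wedge_squares_invariant ha (fun r => w r 0 3) (fun r => w r 1 2)
  obtain ⟨y, hy⟩ : ∃ y : Fin 3 → Fin 4 → Fin 4 → ℝ, ∀ s i j, ∑ r, a r s * w r i j = y s i j :=
    ⟨_, fun _ _ _ => rfl⟩
  simp only [hy] at h1 h2 h3 ⊢
  simp only [Fin.sum_univ_three] at h1 h2 h3 ⊢
  linear_combination -2 * h1 + 2 * h2 - 2 * h3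

/-- The fundamental four-form is parallel. -/
lemma IsReebFrame.mvfderiv_fourForm (hF : IsReebFrame P C.V U' η' J' ξ) (hn : 1 ≤ n)
    (hG : IsGauge P.H P.g P.PQ U η J) (hWU : W ⊆ U) (hWU' : W ⊆ U') (hW : IsOpen W) (hx : x ∈ W)
    {X : Fin 4 → ∀ x : M, P.H x} (hX : ∀ i, SmoothSectionOn P.H W (X i))
    (v : TangentSpace 𝓘(ℝ, Model n) x) {D : Fin 4 → P.H x}
    (hD : ∀ i, horizontal C.isCompl x (C.cov (fun y => X i y) x v) = D i) :
    mvfderiv 𝓘(ℝ, Model n) (fun y => fourForm (P.g y) (fun s => J s y) (X 0 y) (X 1 y) (X 2 y)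
        (X 3 y)) x v
      = fourForm (P.g x) (fun s => J s x) (D 0) (X 1 x) (X 2 x) (X 3 x)
        + fourForm (P.g x) (fun s => J s x) (X 0 x) (D 1) (X 2 x) (X 3 x)
        + fourForm (P.g x) (fun s => J s x) (X 0 x) (X 1 x) (D 2) (X 3 x)
        + fourForm (P.g x) (fun s => J s x) (X 0 x) (X 1 x) (X 2 x) (D 3) := by
  obtain ⟨a, ha, hJX⟩ := hF.exists_unit_derivation hn hG hWU hWU' hW hx v
  have hE : ∀ s i, SmoothSectionOn P.H W (fun y => J s y (X i y)) := fun s i =>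
    hG.smooth_end s W hW hWU _ (hX i)
  have hdω : ∀ s i j, mvfderiv 𝓘(ℝ, Model n) (fun y => P.g y (J s y (X i y)) (X j y)) x v
      = P.g x (J s x (D i)) (X j x) + P.g x (J s x (X i x)) (D j)
        + ∑ r, a r s * P.g x (J r x (X i x)) (X j x) := fun s i j => by
    rw [cov_metric_section (C := C) hW (hE s i) (hX j) hx, hJX s _ (hX i), hD, hD]
    simp only [map_add, LinearMap.add_apply, map_sum, LinearMap.sum_apply, map_smul,
      LinearMap.smul_apply, smul_eq_mul]
    ring
  exact (mvfderiv_wedge_squares (w := fun s i j y => P.g y (J s y (X i y)) (X j y)) hW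
    (fun s i j => P.smooth_metric W hW _ _ (hE s i) (hX j)) hx v hdω).trans
    (wedge_squares_derivation ha (fun s i j => P.g x (J s x (X i x)) (X j x))
      (fun s i j => P.g x (J s x (D i)) (X j x)) (fun s i j => P.g x (J s x (X i x)) (D j)))

omit [T2Space M] in
-- ∇ preserves V, so the vertical part of A contributes nothing horizontal.
lemma IsReebFrame.horizontal_cov_horizontal (hF : IsReebFrame P C.V U η J ξ) (hWU : W ⊆ U)
    (hW : IsOpen W) {A : ∀ x : M, TangentSpace 𝓘(ℝ, Model n) x} (hA : SmoothFieldOn W A)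
    (hx : x ∈ W) (v : TangentSpace 𝓘(ℝ, Model n) x) :
    horizontal C.isCompl x (C.cov (fun y => horizontal C.isCompl y (A y)) x v)
      = horizontal C.isCompl x (C.cov A x v) := by
  have hX := hF.smooth_horizontal (C := C) hWU hW hA
  have hs : SmoothFieldOn W (fun y => A y -
      ((horizontal C.isCompl y (A y) : P.H y) : TangentSpace 𝓘(ℝ, Model n) y)) := hA.sub hX
  have hm := cov_mem_V hW hs (C := C) (fun y hy => by
    have h := hF.sum_eta_smul_xi (C := C) (hWU hy) (A y)
    rw [← sub_eq_iff_eq_add'] at h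
    rw [h]
    exact sum_mem fun s _ => Submodule.smul_mem _ _ (hF.xi_mem (hWU hy) s)) hx v
  rw [cov_sub (hA.mdifferentiableAt hW hx) (SmoothFieldOn.mdifferentiableAt hX hW hx),
    sub_apply] at hm
  have h := horizontal_eq_zero hm
  rw [map_sub, sub_eq_zero] at h
  exact h.symm

end Gauge
end PQC

/-! ### The exterior derivative of the fundamental four-form: part (c). -/

namespace PQC

/-- This matches the action of F on the four-form as a derivation with the expression in
`TorsionForm.eq_zero_of_annihilates`. -/
lemma fourForm_derivation {E : Type*} [AddCommGroup E] [Module ℝ E] {g : LinearMap.BilinForm ℝ E}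
    {J : Fin 3 → Module.End ℝ E} (hJ : IsUnits g J) (F : Module.End ℝ E) (X Y Z U : E) :
    fourForm g J (F X) Y Z U - fourForm g J (F Y) X Z U + fourForm g J (F Z) X Y U
      - fourForm g J (F U) X Y Z = -2 * ∑ a, eps a *
      ((g (J a (F X)) Y + g (J a X) (F Y)) * g (J a Z) U
        + (g (J a (F Z)) U + g (J a Z) (F U)) * g (J a X) Y
        - (g (J a (F X)) Z + g (J a X) (F Z)) * g (J a Y) U
        - (g (J a (F Y)) U + g (J a Y) (F U)) * g (J a X) Z
        + (g (J a (F X)) U + g (J a X) (F U)) * g (J a Y) Z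
        + (g (J a (F Y)) Z + g (J a Y) (F Z)) * g (J a X) U) := by
  have e : ∀ s a b, g (J s a) (F b) = - g (J s (F b)) a := fun s a b => hJ.skew_swap s a (F b)
  simp only [fourForm, e, Fin.sum_univ_three]
  ring

section Closed
variable {n : ℕ} {M : Type*} [TopologicalSpace M] [ChartedSpace (Model n) M]
  [IsManifold 𝓘(ℝ, Model n) ∞ M] {P : Structure n M} {C : CanonicalConnection P}
  {U U' : Set M} {η η' : Fin 3 → ∀ x : M, TangentSpace 𝓘(ℝ, Model n) x →L[ℝ] ℝ}
  {J J' : Fin 3 → ∀ x : M, Module.End ℝ (P.H x)}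
  {ξ : Fin 3 → ∀ x : M, TangentSpace 𝓘(ℝ, Model n) x} {x : M} {W : Set M}

variable [T2Space M]

/-- Differentiated arguments are moved to the first slot, where bracket terms will appear as well. O
is kept as an opaque name so that later cancellations are plain ring identities. -/
lemma IsReebFrame.mvfderiv_Omega (hF : IsReebFrame P C.V U' η' J' ξ) (hn : 1 ≤ n)
    (hG : IsGauge P.H P.g P.PQ U η J) (hWU : W ⊆ U) (hWU' : W ⊆ U') (hW : IsOpen W) (hx : x ∈ W)
    {B : Fin 4 → ∀ x : M, TangentSpace 𝓘(ℝ, Model n) x} (hB : ∀ i, SmoothFieldOn W (B i))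
    (v : TangentSpace 𝓘(ℝ, Model n) x) {O : P.H x → P.H x → P.H x → P.H x → ℝ}
    (hO : O = fourForm (P.g x) (fun s => J s x)) {b D : Fin 4 → P.H x}
    (hb : ∀ i, horizontal C.isCompl x (B i x) = b i)
    (hD : ∀ i, horizontal C.isCompl x (C.cov (B i) x v) = D i) :
    mvfderiv 𝓘(ℝ, Model n) (fun y => C.Omega J y (fun m => B m y)) x v
      = O (D 0) (b 1) (b 2) (b 3) - O (D 1) (b 0) (b 2) (b 3)
        + O (D 2) (b 0) (b 1) (b 3) - O (D 3) (b 0) (b 1) (b 2) := by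
  have hJ := hG.isUnits (hWU hx)
  have h := hF.mvfderiv_fourForm hn hG hWU hWU' hW hx (X := fun i y => horizontal C.isCompl y (B i y))
    (fun i => hF.smooth_horizontal (C := C) hWU' hW (hB i)) v (D := D)
    (fun i => (hF.horizontal_cov_horizontal hWU' hW (hB i) hx v).trans (hD i))
  simp only [hb] at h
  refine h.trans ?_
  rw [hO, fourForm_swap01 hJ (b 0) (D 1), fourForm_swap12 hJ (b 0) (b 1) (D 2),
    fourForm_swap01 hJ (b 0) (D 2), fourForm_swap23 hJ (b 0) (b 1) (b 2),
    fourForm_swap12 hJ (b 0) (b 1) (D 3), fourForm_swap01 hJ (b 0) (D 3)]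
  ring

omit [IsManifold 𝓘(ℝ, Model n) ∞ M] [T2Space M] in
lemma dForm_four (Θ : ∀ x : M, (Fin 4 → TangentSpace 𝓘(ℝ, Model n) x) → ℝ)
    (A : Fin 5 → ∀ x : M, TangentSpace 𝓘(ℝ, Model n) x) (x : M) :
    dForm Θ A x =
      mvfderiv 𝓘(ℝ, Model n) (fun y => Θ y ![A 1 y, A 2 y, A 3 y, A 4 y]) x (A 0 x)
      - mvfderiv 𝓘(ℝ, Model n) (fun y => Θ y ![A 0 y, A 2 y, A 3 y, A 4 y]) x (A 1 x)
      + mvfderiv 𝓘(ℝ, Model n) (fun y => Θ y ![A 0 y, A 1 y, A 3 y, A 4 y]) x (A 2 x)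
      - mvfderiv 𝓘(ℝ, Model n) (fun y => Θ y ![A 0 y, A 1 y, A 2 y, A 4 y]) x (A 3 x)
      + mvfderiv 𝓘(ℝ, Model n) (fun y => Θ y ![A 0 y, A 1 y, A 2 y, A 3 y]) x (A 4 x)
      - (Θ x ![VectorField.mlieBracket 𝓘(ℝ, Model n) (A 0) (A 1) x, A 2 x, A 3 x, A 4 x]
        - Θ x ![VectorField.mlieBracket 𝓘(ℝ, Model n) (A 0) (A 2) x, A 1 x, A 3 x, A 4 x]
        + Θ x ![VectorField.mlieBracket 𝓘(ℝ, Model n) (A 0) (A 3) x, A 1 x, A 2 x, A 4 x]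
        - Θ x ![VectorField.mlieBracket 𝓘(ℝ, Model n) (A 0) (A 4) x, A 1 x, A 2 x, A 3 x]
        + Θ x ![VectorField.mlieBracket 𝓘(ℝ, Model n) (A 1) (A 2) x, A 0 x, A 3 x, A 4 x]
        - Θ x ![VectorField.mlieBracket 𝓘(ℝ, Model n) (A 1) (A 3) x, A 0 x, A 2 x, A 4 x]
        + Θ x ![VectorField.mlieBracket 𝓘(ℝ, Model n) (A 1) (A 4) x, A 0 x, A 2 x, A 3 x]
        + Θ x ![VectorField.mlieBracket 𝓘(ℝ, Model n) (A 2) (A 3) x, A 0 x, A 1 x, A 4 x]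
        - Θ x ![VectorField.mlieBracket 𝓘(ℝ, Model n) (A 2) (A 4) x, A 0 x, A 1 x, A 3 x]
        + Θ x ![VectorField.mlieBracket 𝓘(ℝ, Model n) (A 3) (A 4) x, A 0 x, A 1 x, A 2 x]) := by
  -- The entry B i j with j ≥ i stands for the bracket of A_i and A_{j+1}; this shift explains the
  -- signs.
  have key : ∀ (D : Fin 5 → ℝ) (B : Fin 4 → Fin 4 → ℝ),
      ∑ i : Fin 5, (-1 : ℝ) ^ (i : ℕ) * D i
        - ∑ i : Fin 4, ∑ j ∈ Finset.Ici i, (-1 : ℝ) ^ ((i : ℕ) + (j : ℕ)) * B i j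
      = D 0 - D 1 + D 2 - D 3 + D 4 - (B 0 0 - B 0 1 + B 0 2 - B 0 3 + B 1 1 - B 1 2 + B 1 3
        + B 2 2 - B 2 3 + B 3 3) := by
    intro D B
    have i0 : Finset.Ici (0 : Fin 4) = {0, 1, 2, 3} := by decide
    have i1 : Finset.Ici (1 : Fin 4) = {1, 2, 3} := by decide
    have i2 : Finset.Ici (2 : Fin 4) = {2, 3} := by decide
    have i3 : Finset.Ici (3 : Fin 4) = {3} := by decide
    rw [Fin.sum_univ_five, Fin.sum_univ_four, i0, i1, i2, i3, Finset.sum_insert (by decide),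
      Finset.sum_insert (by decide), Finset.sum_pair (by decide), Finset.sum_insert (by decide),
      Finset.sum_pair (by decide), Finset.sum_pair (by decide), Finset.sum_singleton]
    change (-1) ^ 0 * D 0 + (-1) ^ 1 * D 1 + (-1) ^ 2 * D 2 + (-1) ^ 3 * D 3 + (-1) ^ 4 * D 4
      - ((-1) ^ 0 * B 0 0 + ((-1) ^ 1 * B 0 1 + ((-1) ^ 2 * B 0 2 + (-1) ^ 3 * B 0 3))
        + ((-1) ^ 2 * B 1 1 + ((-1) ^ 3 * B 1 2 + (-1) ^ 4 * B 1 3))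
        + ((-1) ^ 4 * B 2 2 + (-1) ^ 5 * B 2 3) + (-1) ^ 6 * B 3 3) = _
    ring
  have hr : ∀ (i : Fin 5) (y : M), i.removeNth (fun m => A m y)
      = ![A (i.succAbove 0) y, A (i.succAbove 1) y, A (i.succAbove 2) y, A (i.succAbove 3) y] :=
    fun i y => by
      funext m; fin_cases m <;> rfl
  have hr2 : ∀ (i j : Fin 4), j.removeNth (i.castSucc.removeNth (fun m => A m x))
      = ![A (i.castSucc.succAbove (j.succAbove 0)) x, A (i.castSucc.succAbove (j.succAbove 1)) x,
        A (i.castSucc.succAbove (j.succAbove 2)) x] := fun i j => by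
      funext m; fin_cases m <;> rfl
  refine (key (fun i => mvfderiv 𝓘(ℝ, Model n)
    (fun y => Θ y (i.removeNth (fun m => A m y))) x (A i x)) (fun i j => Θ x (Matrix.vecCons
          (VectorField.mlieBracket 𝓘(ℝ, Model n) (A i.castSucc) (A j.succ) x)
          (j.removeNth (i.castSucc.removeNth (fun m => A m x)))))).trans ?_
  simp only [hr2]
  simp only [hr]
  rfl

set_option maxHeartbeats 1000000 in
/-- The exterior derivative of the fundamental four-form in terms of the torsion. -/
theorem IsReebFrame.dForm_Omega (hF : IsReebFrame P C.V U' η' J' ξ) (hn : 1 ≤ n)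
    (hG : IsGauge P.H P.g P.PQ U η J) (hWU : W ⊆ U) (hWU' : W ⊆ U') (hW : IsOpen W) (hx : x ∈ W)
    {A : Fin 5 → ∀ x : M, TangentSpace 𝓘(ℝ, Model n) x} (hA : ∀ i, SmoothFieldOn W (A i))
    {O : P.H x → P.H x → P.H x → P.H x → ℝ}
    (hO : O = fourForm (P.g x) (fun s => J s x)) {a : Fin 5 → P.H x} {T : Fin 5 → Fin 5 → P.H x}
    (ha : ∀ i, horizontal C.isCompl x (A i x) = a i)
    (hT : ∀ i j, horizontal C.isCompl x (C.cov.torsion x (A i x) (A j x)) = T i j) :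
    dForm (C.Omega J) A x
      = O (T 0 1) (a 2) (a 3) (a 4) - O (T 0 2) (a 1) (a 3) (a 4) + O (T 0 3) (a 1) (a 2) (a 4)
        - O (T 0 4) (a 1) (a 2) (a 3) + O (T 1 2) (a 0) (a 3) (a 4) - O (T 1 3) (a 0) (a 2) (a 4)
        + O (T 1 4) (a 0) (a 2) (a 3) + O (T 2 3) (a 0) (a 1) (a 4) - O (T 2 4) (a 0) (a 1) (a 3)
        + O (T 3 4) (a 0) (a 1) (a 2) := by
  obtain ⟨N, hN⟩ : ∃ N : Fin 5 → Fin 5 → P.H x,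
    ∀ i j, horizontal C.isCompl x (C.cov (A j) x (A i x)) = N i j := ⟨_, fun _ _ => rfl⟩
  have hd : ∀ i j k l m, mvfderiv 𝓘(ℝ, Model n)
      (fun y => C.Omega J y ![A j y, A k y, A l y, A m y]) x (A i x)
      = O (N i j) (a k) (a l) (a m) - O (N i k) (a j) (a l) (a m)
        + O (N i l) (a j) (a k) (a m) - O (N i m) (a j) (a k) (a l) := fun i j k l m =>
    hF.mvfderiv_Omega hn hG hWU hWU' hW hx (B := ![A j, A k, A l, A m])
      (fun q => by fin_cases q <;> exact hA _) (A i x) hO (b := ![a j, a k, a l, a m])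
      (D := ![N i j, N i k, N i l, N i m]) (fun q => by fin_cases q <;> exact ha _)
      (fun q => by fin_cases q <;> exact hN _ _)
  have hB : ∀ i j k l m, C.Omega J x
      ![VectorField.mlieBracket 𝓘(ℝ, Model n) (A i) (A j) x, A k x, A l x, A m x]
      = O (N i j) (a k) (a l) (a m) - O (N j i) (a k) (a l) (a m)
        - O (T i j) (a k) (a l) (a m) := fun i j k l m => by
    -- Brackets are covariant derivatives minus torsion. As Ω is parallel, the covariant derivatives
    -- cancel in the alternating sum and only torsion terms remain.
    have h : horizontal C.isCompl x (VectorField.mlieBracket 𝓘(ℝ, Model n) (A i) (A j) x)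
        = N i j - N j i - T i j := by
      rw [← hT, torsion_field hW (hA i) (hA j) hx, ← hN, ← hN, map_sub, map_sub]
      abel
    rw [hO, ← fourForm_sub, ← fourForm_sub, ← h, ← ha, ← ha, ← ha]
    rfl
  rw [dForm_four]
  simp only [hd, hB]
  ring

/-- Every value of the torsion is vertical: on H × H always, on H × V because it vanishes, on V × V
by part (b). Vertical vectors annihilate Ω. -/
theorem torsionEndVanish_imp_omegaClosed (hn : 1 < n) (h0 : C.TorsionEndVanish) : C.OmegaClosed := by
  intro U η J hG W hW hWU A hA x hx
  obtain ⟨U', η', J', ξ, hxU, hF⟩ := C.exists_reebFrame x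
  have hT : ∀ u v, horizontal C.isCompl x (C.cov.torsion x u v) = 0 := by
    intro u v
    have hs : ∀ w : TangentSpace 𝓘(ℝ, Model n) x, ∃ a ∈ P.H x, ∃ b ∈ C.V x, a + b = w := fun w => by
      have : w ∈ P.H x ⊔ C.V x := by rw [(C.isCompl x).sup_eq_top]; trivial
      exact Submodule.mem_sup.1 this
    obtain ⟨a, ha, b, hb, rfl⟩ := hs u
    obtain ⟨c, hc, d, hd, rfl⟩ := hs v
    simp only [map_add, add_apply]
    rw [torsion_swap a d, h0 x d hd a ha, h0 x b hb c hc, neg_zero, map_zero, add_zero, zero_add,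
      horizontal_eq_zero (hF.torsion_mem_V hn h0 hxU hb hd),
      add_zero, hF.torsion_horizontal hxU ⟨a, ha⟩ ⟨c, hc⟩]
    exact horizontal_eq_zero (sum_mem fun s _ => Submodule.smul_mem _ _ (hF.xi_mem hxU s))
  have hx' : x ∈ W ∩ U' := ⟨hx, hxU⟩
  rw [hF.dForm_Omega hn.le hG (W := W ∩ U') (Set.inter_subset_left.trans hWU)
    Set.inter_subset_right (hW.inter hF.gauge.isOpen) hx'
    (fun i => (hA i).mono Set.inter_subset_left) rfl (a := fun i => horizontal C.isCompl x (A i x))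
    (T := fun _ _ => 0) (fun _ => rfl) (fun _ _ => hT _ _)]
  simp [fourForm_zero]

set_option maxHeartbeats 1000000 in
-- In dΩ(ξ_s, X, Y, Z, Q) a term in which ξ_s remains an argument of Ω vanishes, so only T(ξ_s, ·)
-- contributes: it acts on Ω as a derivation.
lemma IsReebFrame.annihilates_of_omegaClosed (hF : IsReebFrame P C.V U η J ξ) (hn : 1 ≤ n)
    (h : C.OmegaClosed) (hx : x ∈ U) (s : Fin 3) (X Y Z Q : P.H x) :
    fourForm (P.g x) (fun s => J s x) (C.torEnd x (ξ s x) X) Y Z Q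
      - fourForm (P.g x) (fun s => J s x) (C.torEnd x (ξ s x) Y) X Z Q
      + fourForm (P.g x) (fun s => J s x) (C.torEnd x (ξ s x) Z) X Y Q
      - fourForm (P.g x) (fun s => J s x) (C.torEnd x (ξ s x) Q) X Y Z = 0 := by
  have hU := hF.gauge.isOpen
  have hJ := hF.gauge.isUnits hx
  obtain ⟨X, hX, rfl⟩ := hF.exists_section (C := C) subset_rfl hU X
  obtain ⟨Y, hY, rfl⟩ := hF.exists_section (C := C) subset_rfl hU Y
  obtain ⟨Z, hZ, rfl⟩ := hF.exists_section (C := C) subset_rfl hU Z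
  obtain ⟨Q, hQ, rfl⟩ := hF.exists_section (C := C) subset_rfl hU Q
  let A : Fin 5 → ∀ y : M, TangentSpace 𝓘(ℝ, Model n) y :=
    ![ξ s, fun y => X y, fun y => Y y, fun y => Z y, fun y => Q y]
  have hA : ∀ i, SmoothFieldOn U (A i) := by
    intro i
    fin_cases i
    exacts [hF.reeb.smooth s, hX, hY, hZ, hQ]
  have h1 := h U η J hF.gauge U hU subset_rfl A hA x hx
  obtain ⟨T, hT⟩ : ∃ T : Fin 5 → Fin 5 → P.H x,
    ∀ i j, horizontal C.isCompl x (C.cov.torsion x (A i x) (A j x)) = T i j := ⟨_, fun _ _ => rfl⟩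
  obtain ⟨O, hO⟩ : ∃ O, O = fourForm (P.g x) (fun s => J s x) := ⟨_, rfl⟩
  rw [hF.dForm_Omega hn hF.gauge subset_rfl subset_rfl hU hx hA hO
    (a := ![0, X x, Y x, Z x, Q x]) (fun i => by
      fin_cases i
      exacts [horizontal_eq_zero (hF.xi_mem hx s), horizontal_coe _, horizontal_coe _,
        horizontal_coe _, horizontal_coe _]) hT] at h1
  have z : ∀ a b c : P.H x, O a 0 b c = 0 := fun a b c => by
    rw [hO, fourForm_swap01 hJ, fourForm_zero, neg_zero]
  have e1 : T 0 1 = C.torEnd x (ξ s x) (X x) := (hT 0 1).symm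
  have e2 : T 0 2 = C.torEnd x (ξ s x) (Y x) := (hT 0 2).symm
  have e3 : T 0 3 = C.torEnd x (ξ s x) (Z x) := (hT 0 3).symm
  have e4 : T 0 4 = C.torEnd x (ξ s x) (Q x) := (hT 0 4).symm
  simp only [Matrix.cons_val_zero, Matrix.cons_val_one, Matrix.cons_val, z, e1, e2, e3, e4] at h1
  rw [← hO]
  linarith

theorem omegaClosed_imp_torsionEndVanish (hn : 1 < n) (h : C.OmegaClosed) :
    C.TorsionEndVanish := by
  intro x v hv u hu
  obtain ⟨U, η, J, ξ, hx, hF⟩ := C.exists_reebFrame x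
  have := P.nontrivial hn.le x
  have hJ := hF.gauge.isUnits hx
  obtain ⟨m, p, q, r, l, hT, hR⟩ := hF.exists_torsionForm hn.le hx
  refine hF.torsion_eq_zero_of_torEnd hx (fun s => hT.torsion_eq_zero
    (hT.eq_zero_of_annihilates hJ (P.isOrthonormalBasis_basis x) (by simp; omega)
      fun s X Y Z Q => ?_) s) hv hu
  have h1 := hF.annihilates_of_omegaClosed hn.le h hx s X Y Z Q
  rw [fourForm_derivation hJ] at h1
  exact (mul_eq_zero.1 h1).resolve_left (by norm_num)

end Closed
end PQC

end

theorem mainTheorem5 (n : ℕ) (hn : 1 ≤ n) (M : Type*) [TopologicalSpace M]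
    [ChartedSpace (PQC.Model n) M] [IsManifold 𝓘(ℝ, PQC.Model n) ∞ M] [T2Space M]
    [SecondCountableTopology M] (P : PQC.Structure n M) (C : PQC.CanonicalConnection P) :
    ((C.IsEinstein ↔ C.TauMuVanish) ∧ (C.TauMuVanish ↔ C.TorsionEndVanish)) ∧
    (1 < n → C.IsEinstein →
      ((∀ x : M, HasMFDerivAt 𝓘(ℝ, PQC.Model n) 𝓘(ℝ, ℝ) C.scal x 0) ∧
        IsLocallyConstant C.scal) ∧ C.VerticalIntegrable) ∧
    (1 < n → (C.IsEinstein ↔ C.OmegaClosed)) := by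
  have hE : C.IsEinstein ↔ C.TorsionEndVanish :=
    ⟨PQC.einstein_imp_torsionEndVanish hn, PQC.torsionEndVanish_imp_einstein hn⟩
  have hT : C.TauMuVanish ↔ C.TorsionEndVanish :=
    ⟨PQC.tauMuVanish_imp_torsionEndVanish hn, PQC.torsionEndVanish_imp_tauMuVanish⟩
  refine ⟨⟨hE.trans hT.symm, hT⟩, fun h1 h => ?_, fun h1 => hE.trans
    ⟨PQC.torsionEndVanish_imp_omegaClosed h1, PQC.omegaClosed_imp_torsionEndVanish h1⟩⟩
  have hd := PQC.hasMFDerivAt_scal h1 (hE.1 h)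
  exact ⟨⟨hd, PQC.isLocallyConstant_of_hasMFDerivAt_zero hd⟩, PQC.verticalIntegrable h1 (hE.1 h)⟩
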